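/- For integers $Q\ge 1$, $k\ge 2$, $m\ge 1$ and $b$ with $\gcd(b,m)=1$, let \[\mathscr F_{Q,k}^{(m)}=\Big\{\tfrac aq : 1\le a\le q\le Q,\ \gcd(a,q)=1,\ q \text{ is } k\text{-free},\ q\equiv b \pmod m\Big\},\] where $q$ is called $k$-free if $p^k\nmid q$ for every prime $p$. Let $\mathcal N=\mathcal N(Q,k,m)$ be the number of elements of this set, let $\gamma_1<\gamma_2<\dots<\gamma_{\mathcal N}$ be its elements in increasing order, and put \[S_{k,m,b}(Q)=\sum_{j=1}^{\mathcal N}\Big|\gamma_j-\frac{j}{\mathcal N}\Big| .\] Say that GRH holds modulo $m$ if for every Dirichlet character $\chi$ modulo $m$ all zeros of $L(s,\chi)$ with $0<\Re s<1$ satisfy $\Re s=\tfrac12$, and that GRH holds if it holds modulo $m$ for every $m\ge1$. Then: (1) GRH holds if and only if, for every $m\ge 1$ and every $\varepsilon>0$, $S_{k,m,b}(Q)=O_{m,\varepsilon}(Q^{1/2+\varepsilon})$ for all $Q\ge1$, $k\ge2$ and $b$ coprime to $m$, where the implied constant depends only on $m$ and $\varepsilon$. (2) For each fixed $m\ge 1$,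 GRH holds modulo $m$ if and only if, for every $\varepsilon>0$, $S_{k,m,b}(Q)=O_{m,\varepsilon}(Q^{1/2+\varepsilon})$ for all $Q\ge 1$, $k\ge 2$ and $b$ coprime to $m$, where the implied constant depends only on $m$ and $\varepsilon$. (3) For each fixed choice of $m\ge 1$, $k\ge 2$ and $b$ coprime to $m$, GRH holds modulo $m$ if and only if, for every $\varepsilon>0$, $S_{k,m,b}(Q)=O(Q^{1/2+\varepsilon})$ for all $Q\ge1$, where the implied constant does not depend on $Q$. -/

import Mathlib

/-- A natural number `n` is `k`-free if no prime `p` satisfies `p ^ k ∣ n`. -/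
def IsPowFree (k n : ℕ) : Prop :=
  ∀ p : ℕ, p.Prime → ¬ p ^ k ∣ n

open Classical in
/-- The set of the Farey fractions `a / q` of order `Q` (`1 ≤ a ≤ q ≤ Q`, `gcd (a, q) = 1`) whose
denominator `q` is `k`-free and congruent to `b` modulo `m`. -/
noncomputable def kFreeFarey (Q k m : ℕ) (b : ℤ) : Finset ℚ :=
  ((Finset.Icc 1 Q ×ˢ Finset.Icc 1 Q).filter fun x : ℕ × ℕ =>
      x.1 ≤ x.2 ∧ Nat.gcd x.1 x.2 = 1 ∧ IsPowFree k x.2 ∧ (x.2 : ℤ) ≡ b [ZMOD (m : ℤ)]).image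
    fun x => (x.1 : ℚ) / (x.2 : ℚ)

/-- The sum `∑_{j = 1}^{N} |γ_j - j / N|`, where `γ_1 < γ_2 < ⋯ < γ_N` are the elements of
`kFreeFarey Q k m b` in increasing order and `N` is their number. The index `j : Fin N` starts
at `0`, so that it stands for the index `j + 1`. -/
noncomputable def fareyDisplacement (Q k m : ℕ) (b : ℤ) : ℝ :=
  ∑ j : Fin (kFreeFarey Q k m b).card,
    |(((kFreeFarey Q k m b).orderEmbOfFin rfl j : ℚ) : ℝ)
      - (((j : ℕ) : ℝ) + 1) / ((kFreeFarey Q k m b).card : ℝ)|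

/-- The generalized Riemann hypothesis for the Dirichlet `L`-functions modulo `m`: for every
Dirichlet character `χ` modulo `m`, all zeros of `L(s, χ)` in the critical strip `0 < Re s < 1` lie
on the line `Re s = 1 / 2`. -/
def GRHModulo (m : ℕ) [NeZero m] : Prop :=
  ∀ (χ : DirichletCharacter ℂ m) (s : ℂ),
    DirichletCharacter.LFunction χ s = 0 → 0 < s.re → s.re < 1 → s.re = 1 / 2

/-- The generalized Riemann hypothesis for all Dirichlet `L`-functions. -/
def GRH : Prop :=
  ∀ (m : ℕ) [NeZero m], GRHModulo m

/-! ### Möbius inversion: sums over Farey fractions as weighted sums over complete residue systems.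
-/

section

open Finset ArithmeticFunction
open scoped ArithmeticFunction.Moebius

/-! Removing the coprimality condition by Möbius inversion gives, for every function `f`, `∑ f γ =
∑_d w d ∑_{a ≤ d} f (a / d)`, where `w d = fareyWeight Q k m b d` is a sum of `μ e` over `e ≤ Q / d`
with `d * e` admissible (`sum_kFreeFarey`). Both directions compare the displacement with these
weights, and the weights with the sums of `μ χ`.

GRH implies the bound. The displacement is at most the `L¹`-norm of `∑ w d ψ(d x)`, up to a
constant, with `ψ` the centred sawtooth (`fareyDisplacement_le_integral`). Dilates of `ψ` are nearly
orthogonal: the correlation at `d`, `e` is at most `gcd(d, e)² / (d e)`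
(`abs_integral_sawtooth_mul_le`). Under GRH, Littlewood's bound for `1 / L(s, χ)`
(`exists_norm_inv_le_rpow`) and a smoothed Perron formula (`exists_norm_sum_le_rpow`) give `∑_{e ≤
x} μ(e) χ(e) = O(x ^ (1/2 + ε))`. Orthogonality of characters handles the congruence, and being
`k`-free only forbids `e` certain prime factors of `d`, which costs a partial Euler product of size
`O(d ^ η)`. Hence `w d` is about `(Q / d) ^ (1/2 + ε)` at most, uniformly in `k` and `b`, the double
sum over gcds converges, and the `L²`-norm is `O(Q ^ (1/2 + ε))`.

The bound implies GRH. The exponential sum of frequency `n` over the fractions equals `∑_{d ∣ n} w d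
* d` and is `O(n)` times the displacement plus one; the frequencies `1` and `p` isolate `w p`
(`abs_fareyWeight_prime_le`). With `Q = p x` this bounds the partial sums of a Dirichlet series
which therefore continues to `Re s > 1/2`, and which is a combination of the functions `1 / L(s, χ)`
with coefficients involving `χ p`. A zero `s₀` there would give, through its leading polar terms, a
linear relation valid for all primes `p` with coefficients independent of `p`
(`exists_leading_coeff`). Primes tending to infinity in each reduced class turn it into a relation
between characters, contradicting their independence. The functional equation excludes zeros to the
left of `1/2`.

One pair `k`, `b` suffices for the second direction and the first is uniform in both, so all the
criteria follow together. -/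

/-- The denominators of `kFreeFarey`: the `k`-free numbers congruent to `b` modulo `m`. -/
def IsFareyDenominator (k m : ℕ) (b : ℤ) (q : ℕ) : Prop :=
  IsPowFree k q ∧ (q : ℤ) ≡ b [ZMOD (m : ℤ)]

open Classical in
/-- The weight `∑ μ e` over `e ≤ Q / d` for which `d * e` is an admissible denominator. -/
noncomputable def fareyWeight (Q k m : ℕ) (b : ℤ) (d : ℕ) : ℤ :=
  ∑ e ∈ (Icc 1 (Q / d)).filter (fun e => IsFareyDenominator k m b (d * e)), μ e

lemma sum_moebius_divisors_gcd {a q : ℕ} (hq : q ≠ 0) :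
    ∑ e ∈ q.divisors.filter (· ∣ a), μ e = if Nat.gcd a q = 1 then 1 else 0 := by
  have h : q.divisors.filter (· ∣ a) = (Nat.gcd a q).divisors := by
    ext e
    have : Nat.gcd a q ≠ 0 := (Nat.gcd_pos_of_pos_right a (Nat.pos_of_ne_zero hq)).ne'
    simp only [mem_filter, Nat.mem_divisors, Nat.dvd_gcd_iff]
    tauto
  have h2 := congrArg (fun f => f (Nat.gcd a q)) moebius_mul_coe_zeta
  rw [h]
  rw [coe_mul_zeta_apply, one_apply] at h2
  exact h2

/-- The indicator of coprimality is a sum of `μ e` over common divisors. Multiples `e * a'` of `e`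
over `q = d * e` cancel to `a' / d`, so `e` contributes all fractions of denominator `d`, reduced or
not. -/
lemma sum_coprime_eq_sum_divisorsAntidiagonal {R : Type*} [CommRing R] (f : ℚ → R) {q : ℕ}
    (hq : 1 ≤ q) :
    ∑ a ∈ (Icc 1 q).filter (fun a => Nat.gcd a q = 1), f ((a : ℚ) / q) =
      ∑ x ∈ q.divisorsAntidiagonal, (μ x.2 : R) * ∑ a ∈ Icc 1 x.1, f ((a : ℚ) / x.1) := by
  have hq0 : q ≠ 0 := by omega
  have h1 : ∑ a ∈ (Icc 1 q).filter (fun a => Nat.gcd a q = 1), f ((a : ℚ) / q) =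
      ∑ a ∈ Icc 1 q, ∑ e ∈ q.divisors, if e ∣ a then (μ e : R) * f ((a : ℚ) / q) else 0 := by
    rw [sum_filter]
    refine sum_congr rfl fun a _ => ?_
    rw [← sum_filter, ← sum_mul, ← Int.cast_sum, sum_moebius_divisors_gcd hq0]
    split_ifs <;> simp
  rw [h1, sum_comm, Nat.sum_divisorsAntidiagonal' (n := q)
    (fun d e => (μ e : R) * ∑ a ∈ Icc 1 d, f ((a : ℚ) / d))]
  refine sum_congr rfl fun e he => ?_
  have heq : e ∣ q := Nat.dvd_of_mem_divisors he
  have he0 : 0 < e := Nat.pos_of_dvd_of_pos heq (by omega)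
  obtain ⟨d, rfl⟩ := heq
  rw [Nat.mul_div_cancel_left _ he0, ← sum_filter, mul_sum]
  symm
  refine sum_bij (fun a _ => e * a) ?_ ?_ ?_ ?_
  · intro a ha
    simp only [mem_Icc, mem_filter] at ha ⊢
    exact ⟨⟨Nat.mul_pos he0 ha.1, Nat.mul_le_mul_left _ ha.2⟩, dvd_mul_right _ _⟩
  · intro a _ a' _ h
    exact Nat.eq_of_mul_eq_mul_left he0 h
  · intro a ha
    simp only [mem_Icc, mem_filter] at ha
    obtain ⟨⟨h1, h2⟩, c, rfl⟩ := ha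
    refine ⟨c, ?_, rfl⟩
    simp only [mem_Icc]
    exact ⟨Nat.pos_of_ne_zero (by rintro rfl; simp at h1), Nat.le_of_mul_le_mul_left h2 he0⟩
  · intro a _
    have : (e : ℚ) ≠ 0 := by positivity
    push_cast
    rw [mul_div_mul_left _ _ this]

lemma sum_divisorsAntidiagonal_Icc {M : Type*} [AddCommMonoid M] (Q : ℕ) (F : ℕ → ℕ → M) :
    ∑ q ∈ Icc 1 Q, ∑ x ∈ q.divisorsAntidiagonal, F x.1 x.2 =
      ∑ d ∈ Icc 1 Q, ∑ e ∈ Icc 1 (Q / d), F d e := by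
  rw [sum_sigma', sum_sigma']
  refine sum_bij' (fun x _ => ⟨x.2.1, x.2.2⟩) (fun y _ => ⟨y.1 * y.2, (y.1, y.2)⟩) ?_ ?_ ?_ ?_ ?_
  · rintro ⟨q, d, e⟩ h
    simp only [mem_sigma, mem_Icc, Nat.mem_divisorsAntidiagonal] at h ⊢
    obtain ⟨⟨h1, h2⟩, rfl, h3⟩ := h
    have hd : 0 < d := Nat.pos_of_ne_zero (by rintro rfl; simp at h3)
    have he : 0 < e := Nat.pos_of_ne_zero (by rintro rfl; simp at h3)
    refine ⟨⟨hd, (Nat.le_mul_of_pos_right d he).trans h2⟩, he, ?_⟩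
    rw [Nat.le_div_iff_mul_le hd, mul_comm]
    exact h2
  · rintro ⟨d, e⟩ h
    simp only [mem_sigma, mem_Icc, Nat.mem_divisorsAntidiagonal] at h ⊢
    obtain ⟨⟨h1, h2⟩, h3, h4⟩ := h
    rw [Nat.le_div_iff_mul_le h1, mul_comm] at h4
    have : 0 < d * e := Nat.mul_pos h1 h3
    exact ⟨⟨this, h4⟩, trivial, this.ne'⟩
  · rintro ⟨q, d, e⟩ h
    simp only [mem_sigma, Nat.mem_divisorsAntidiagonal] at h
    obtain ⟨_, rfl, _⟩ := h
    rfl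
  · rintro ⟨d, e⟩ _
    rfl
  · rintro ⟨q, d, e⟩ _
    rfl

/-- Sums over `kFreeFarey` in terms of the sums over all fractions with a given denominator. -/
theorem sum_kFreeFarey {R : Type*} [CommRing R] (f : ℚ → R) (Q k m : ℕ) (b : ℤ) :
    ∑ γ ∈ kFreeFarey Q k m b, f γ =
      ∑ d ∈ Icc 1 Q, (fareyWeight Q k m b d : R) * ∑ a ∈ Icc 1 d, f ((a : ℚ) / d) := by
  classical
  have h1 : ∑ γ ∈ kFreeFarey Q k m b, f γ = ∑ q ∈ Icc 1 Q,
      if IsFareyDenominator k m b q then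
        ∑ a ∈ (Icc 1 q).filter (fun a => Nat.gcd a q = 1), f ((a : ℚ) / q) else 0 := by
    rw [kFreeFarey, sum_image]
    · rw [sum_filter, sum_product_right]
      refine sum_congr rfl fun q hq => ?_
      rw [mem_Icc] at hq
      split_ifs with hK
      · have : (Icc 1 q).filter (fun a => Nat.gcd a q = 1) =
            (Icc 1 Q).filter (fun a => a ≤ q ∧ Nat.gcd a q = 1) := by
          ext a
          simp only [mem_filter, mem_Icc]
          have := hq.2
          constructor <;> rintro ⟨⟨_, _⟩, _⟩ <;> refine ⟨⟨?_, ?_⟩, ?_⟩ <;> omega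
        rw [this, sum_filter]
        refine sum_congr rfl fun a _ => ?_
        obtain ⟨hK1, hK2⟩ := hK
        simp [hK1, hK2]
      · refine sum_eq_zero fun a _ => ?_
        rw [if_neg]
        rintro ⟨_, _, h3, h4⟩
        exact hK ⟨h3, h4⟩
    -- Reduced fractions determine numerator and denominator, so the image defining the Farey set
    -- identifies no two pairs.
    · rintro ⟨a, q⟩ h ⟨a', q'⟩ h' heq
      simp only [coe_filter, Set.mem_ofPred_eq, mem_product, mem_Icc] at h h' heq
      have hq : (0 : ℤ) < q := by exact_mod_cast h.1.2.1
      have hq' : (0 : ℤ) < q' := by exact_mod_cast h'.1.2.1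
      have e1 := Rat.num_div_eq_of_coprime (a := a) hq (by simpa using h.2.2.1)
      have e2 := Rat.num_div_eq_of_coprime (a := a') hq' (by simpa using h'.2.2.1)
      have e3 := Rat.den_div_eq_of_coprime (a := a) hq (by simpa using h.2.2.1)
      have e4 := Rat.den_div_eq_of_coprime (a := a') hq' (by simpa using h'.2.2.1)
      push_cast at e1 e2 e3 e4
      rw [heq] at e1 e3
      simp only [Prod.mk.injEq]
      constructor
      · exact_mod_cast e1.symm.trans e2
      · exact_mod_cast e3.symm.trans e4
  rw [h1]
  have h2 : ∀ q ∈ Icc 1 Q, (if IsFareyDenominator k m b q then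
        ∑ a ∈ (Icc 1 q).filter (fun a => Nat.gcd a q = 1), f ((a : ℚ) / q) else 0) =
      ∑ x ∈ q.divisorsAntidiagonal, if IsFareyDenominator k m b (x.1 * x.2) then
        (μ x.2 : R) * ∑ a ∈ Icc 1 x.1, f ((a : ℚ) / x.1) else 0 := by
    intro q hq
    rw [mem_Icc] at hq
    rw [sum_coprime_eq_sum_divisorsAntidiagonal f hq.1]
    split_ifs with h
    · refine sum_congr rfl fun x hx => ?_
      rw [(Nat.mem_divisorsAntidiagonal.1 hx).1, if_pos h]
    · refine (sum_eq_zero fun x hx => ?_).symm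
      rw [(Nat.mem_divisorsAntidiagonal.1 hx).1, if_neg h]
  rw [sum_congr rfl h2, sum_divisorsAntidiagonal_Icc Q (fun d e =>
    if IsFareyDenominator k m b (d * e) then
        (μ e : R) * ∑ a ∈ Icc 1 d, f ((a : ℚ) / d) else 0)]
  refine sum_congr rfl fun d _ => ?_
  rw [fareyWeight, ← sum_filter, Int.cast_sum, sum_mul]

/-- The weights sum to `1` or `0`, according to whether `1` is an admissible denominator. -/
lemma abs_sum_fareyWeight_le (Q k m : ℕ) (b : ℤ) :
    |∑ d ∈ Icc 1 Q, fareyWeight Q k m b d| ≤ 1 := by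
  classical
  have h := sum_divisorsAntidiagonal_Icc Q (fun d e =>
    if IsFareyDenominator k m b (d * e) then μ e else 0)
  -- Grouping the pairs by `q = d * e`, the admissibility condition depends on `q` alone and `∑_{e ∣
  -- q} μ e` vanishes unless `q = 1`.
  have h1 : ∑ d ∈ Icc 1 Q, fareyWeight Q k m b d = ∑ q ∈ Icc 1 Q,
      if IsFareyDenominator k m b q then (if q = 1 then 1 else 0) else 0 := by
    simp only [fareyWeight, sum_filter]
    rw [← h]
    refine sum_congr rfl fun q hq => ?_
    have h2 := congrArg (fun f => f q) coe_zeta_mul_moebius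
    simp only [mul_apply, one_apply] at h2
    rw [← h2]
    split_ifs with hK
    · refine sum_congr rfl fun x hx => ?_
      have hx' := Nat.mem_divisorsAntidiagonal.1 hx
      rw [hx'.1, if_pos hK]
      have : x.1 ≠ 0 := by rintro h0; simp [h0] at hx'; omega
      simp [this]
    · refine sum_eq_zero fun x hx => ?_
      rw [(Nat.mem_divisorsAntidiagonal.1 hx).1, if_neg hK]
  rw [h1]
  have h3 : ∀ q : ℕ, (if IsFareyDenominator k m b q then (if q = 1 then (1 : ℤ) else 0) else 0) =
      if q = 1 then (if IsFareyDenominator k m b 1 then 1 else 0) else 0 := by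
    intro q
    by_cases hq : q = 1
    · subst hq; simp
    · simp [hq]
  simp only [h3, sum_ite_eq']
  split_ifs <;> simp

end

/-! ### From the displacement to the `L¹`-norm of a sum of sawtooth functions. -/

section

open Finset ArithmeticFunction MeasureTheory
open scoped ArithmeticFunction.Moebius Interval

lemma measurable_ite_le (u : ℝ) : Measurable fun x : ℝ => if u ≤ x then (1 : ℝ) else 0 :=
  Measurable.ite measurableSet_Ici measurable_const measurable_const

/-- The two indicators differ exactly on the interval between `u` and `v`. Summed over `j`, this
turns a displacement into an integral over thresholds `x`. -/
lemma abs_sub_eq_integral_abs_sub_ite {u v : ℝ} (hu : u ∈ Set.Icc (0 : ℝ) 1)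
    (hv : v ∈ Set.Icc (0 : ℝ) 1) :
    |u - v| = ∫ x in (0 : ℝ)..1, |(if u ≤ x then (1 : ℝ) else 0) - if v ≤ x then 1 else 0| := by
  wlog huv : u ≤ v generalizing u v
  · rw [abs_sub_comm, this hv hu (le_of_not_ge huv)]
    simp only [abs_sub_comm]
  have h : ∀ x : ℝ, |(if u ≤ x then (1 : ℝ) else 0) - if v ≤ x then 1 else 0| =
      (Set.Ico u v).indicator (fun _ => (1 : ℝ)) x := by
    intro x
    by_cases h1 : u ≤ x <;> by_cases h2 : v ≤ x
    · simp [h1, h2]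
    · rw [Set.indicator_of_mem (show x ∈ Set.Ico u v from ⟨h1, not_le.1 h2⟩)]
      simp [h1, h2]
    · exact absurd (huv.trans h2) h1
    · simp [h1, h2]
  simp only [h]
  rw [intervalIntegral.integral_of_le zero_le_one, integral_Ioc_eq_integral_Ioo,
    ← integral_Ico_eq_integral_Ioo, setIntegral_indicator measurableSet_Ico,
    Set.inter_eq_self_of_subset_right (Set.Ico_subset_Ico hu.1 hv.2)]
  simp [huv, abs_sub_comm u v, abs_of_nonneg (sub_nonneg.2 huv)]

/-- For fixed `x` the indices counted on either side form initial segments, and these are nested.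
All differences therefore have the same sign, and the absolute value moves outside the sum. The
equally spaced points contribute `⌊N x⌋`, within `1` of `N x`. -/
lemma sum_abs_ite_sub_ite_le {N : ℕ} {g : Fin N → ℝ} (hg : Monotone g) {x : ℝ}
    (hx : x ∈ Set.Icc (0 : ℝ) 1) :
    ∑ j : Fin N, |(if g j ≤ x then (1 : ℝ) else 0) - if ((j : ℕ) + 1 : ℝ) / N ≤ x then 1 else 0| ≤
      |(∑ j : Fin N, if g j ≤ x then (1 : ℝ) else 0) - N * x| + 1 := by
  have h1 : ∑ j : Fin N, |(if g j ≤ x then (1 : ℝ) else 0) -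
        if ((j : ℕ) + 1 : ℝ) / N ≤ x then 1 else 0| =
      |∑ j : Fin N, ((if g j ≤ x then (1 : ℝ) else 0) -
        if ((j : ℕ) + 1 : ℝ) / N ≤ x then 1 else 0)| := by
    by_cases H : ∃ j : Fin N, g j ≤ x ∧ ¬ ((j : ℕ) + 1 : ℝ) / N ≤ x
    · obtain ⟨j, hj1, hj2⟩ := H
      have key : ∀ i : Fin N, 0 ≤ ((if g i ≤ x then (1 : ℝ) else 0) -
          if ((i : ℕ) + 1 : ℝ) / N ≤ x then 1 else 0) := by
        intro i
        by_cases hi : g i ≤ x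
        · split_ifs <;> simp
        · have hij : j < i := by
            by_contra hc
            exact hi ((hg (not_lt.1 hc)).trans hj1)
          have : ¬ ((i : ℕ) + 1 : ℝ) / N ≤ x := by
            refine fun hc => hj2 (le_trans ?_ hc)
            have : (j : ℕ) ≤ i := hij.le
            gcongr
          simp [hi, this]
      rw [abs_of_nonneg (sum_nonneg fun i _ => key i)]
      exact sum_congr rfl fun i _ => abs_of_nonneg (key i)
    · push Not at H
      have key : ∀ i : Fin N, ((if g i ≤ x then (1 : ℝ) else 0) -
          if ((i : ℕ) + 1 : ℝ) / N ≤ x then 1 else 0) ≤ 0 := by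
        intro i
        by_cases hi : g i ≤ x
        · simp [hi, H i hi]
        · split_ifs <;> simp
      rw [abs_of_nonpos (sum_nonpos fun i _ => key i), ← sum_neg_distrib]
      exact sum_congr rfl fun i _ => abs_of_nonpos (key i)
  have h2 : ∑ j : Fin N, (if ((j : ℕ) + 1 : ℝ) / N ≤ x then (1 : ℝ) else 0) = ⌊(N : ℝ) * x⌋₊ := by
    rw [Fin.sum_univ_eq_sum_range (fun j : ℕ => if ((j : ℕ) + 1 : ℝ) / N ≤ x then (1 : ℝ) else 0) N]
    rw [← sum_filter, sum_const, nsmul_eq_mul, mul_one]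
    congr 1
    have hle : ⌊(N : ℝ) * x⌋₊ ≤ N := by
      have : (N : ℝ) * x ≤ N := mul_le_of_le_one_right (by positivity) hx.2
      simpa using Nat.floor_le_floor this
    have : (range N).filter (fun j : ℕ => ((j : ℕ) + 1 : ℝ) / N ≤ x) = range ⌊(N : ℝ) * x⌋₊ := by
      ext j
      simp only [mem_filter, mem_range]
      constructor
      · rintro ⟨hj, hj2⟩
        have hN : (0 : ℝ) < N := by exact_mod_cast (Nat.zero_le j).trans_lt hj
        rw [div_le_iff₀ hN] at hj2
        exact Nat.lt_of_succ_le (Nat.le_floor (by push_cast; linarith))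
      · intro hj
        have hjN := hj.trans_le hle
        have hN : (0 : ℝ) < N := by exact_mod_cast (Nat.zero_le j).trans_lt hjN
        refine ⟨hjN, ?_⟩
        rw [div_le_iff₀ hN]
        have := (Nat.le_floor_iff (mul_nonneg hN.le hx.1)).1 (Nat.succ_le_of_lt hj)
        push_cast at this
        linarith
    rw [this, card_range]
  rw [h1, sum_sub_distrib, h2]
  have h3 : |(N : ℝ) * x - ⌊(N : ℝ) * x⌋₊| ≤ 1 := by
    have h4 := Nat.floor_le (mul_nonneg (Nat.cast_nonneg N) hx.1)
    have h5 := Nat.lt_floor_add_one ((N : ℝ) * x)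
    rw [abs_le]
    constructor <;> linarith
  calc _ = |((∑ j : Fin N, if g j ≤ x then (1 : ℝ) else 0) - N * x) +
        (N * x - ⌊(N : ℝ) * x⌋₊)| := by ring_nf
    _ ≤ _ := (abs_add_le _ _).trans (by gcongr)

lemma intervalIntegrable_of_measurable_bounded {f : ℝ → ℝ} (hf : Measurable f) {C : ℝ}
    (hC : ∀ x ∈ Set.Ioc (0 : ℝ) 1, |f x| ≤ C) : IntervalIntegrable f volume 0 1 := by
  rw [intervalIntegrable_iff_integrableOn_Ioc_of_le zero_le_one]
  refine Measure.integrableOn_of_bounded (M := C) (by simp) hf.aestronglyMeasurable ?_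
  exact (ae_restrict_iff' measurableSet_Ioc).2 (ae_of_all _ hC)

/-- The displacement of an increasing sequence in `[0, 1]` from the uniform one is controlled by
the `L¹`-norm of its discrepancy function. -/
theorem sum_abs_sub_le_integral {N : ℕ} {g : Fin N → ℝ} (hg : Monotone g)
    (hg1 : ∀ j, g j ∈ Set.Icc (0 : ℝ) 1) :
    ∑ j : Fin N, |g j - ((j : ℕ) + 1 : ℝ) / N| ≤
      (∫ x in (0 : ℝ)..1, |(∑ j : Fin N, if g j ≤ x then (1 : ℝ) else 0) - N * x|) + 1 := by
  have hm : ∀ u : ℝ, Measurable fun x : ℝ => if u ≤ x then (1 : ℝ) else 0 := measurable_ite_le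
  have hI : IntervalIntegrable
      (fun x : ℝ => |(∑ j : Fin N, if g j ≤ x then (1 : ℝ) else 0) - N * x|) volume 0 1 := by
    refine intervalIntegrable_of_measurable_bounded (C := N + N) ?_ ?_
    · have : Measurable fun x : ℝ => (∑ j : Fin N, if g j ≤ x then (1 : ℝ) else 0) :=
        Finset.measurable_sum _ fun j _ => hm (g j)
      exact (this.sub (measurable_id.const_mul _)).abs
    · intro x hx
      rw [abs_abs]
      refine (abs_sub _ _).trans (add_le_add ?_ ?_)
      · refine (abs_sum_le_sum_abs _ _).trans ?_
        refine (sum_le_card_nsmul _ _ 1 fun j _ => ?_).trans (by simp)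
        split_ifs <;> simp
      · rw [abs_of_nonneg (mul_nonneg (Nat.cast_nonneg _) hx.1.le)]
        exact mul_le_of_le_one_right (Nat.cast_nonneg _) hx.2
  have hJ : ∀ j : Fin N, IntervalIntegrable (fun x : ℝ => |(if g j ≤ x then (1 : ℝ) else 0) -
      if ((j : ℕ) + 1 : ℝ) / N ≤ x then 1 else 0|) volume 0 1 := by
    intro j
    refine intervalIntegrable_of_measurable_bounded (C := 1) ((hm _).sub (hm _)).abs ?_
    intro x _
    split_ifs <;> simp
  have h1 : ∀ j : Fin N, |g j - ((j : ℕ) + 1 : ℝ) / N| = ∫ x in (0 : ℝ)..1,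
      |(if g j ≤ x then (1 : ℝ) else 0) - if ((j : ℕ) + 1 : ℝ) / N ≤ x then 1 else 0| := by
    intro j
    refine abs_sub_eq_integral_abs_sub_ite (hg1 j) ⟨by positivity, ?_⟩
    have hN : (0 : ℝ) < N := by exact_mod_cast (Nat.zero_le _).trans_lt j.2
    rw [div_le_one hN]
    exact_mod_cast j.2
  rw [sum_congr rfl fun j _ => h1 j, ← intervalIntegral.integral_finsetSum fun j _ => hJ j]
  have h2 : (∫ x in (0 : ℝ)..1, |(∑ j : Fin N, if g j ≤ x then (1 : ℝ) else 0) - N * x|) + 1 =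
      ∫ x in (0 : ℝ)..1, (|(∑ j : Fin N, if g j ≤ x then (1 : ℝ) else 0) - N * x| + 1) := by
    rw [intervalIntegral.integral_add hI (by simp)]
    simp
  rw [h2]
  refine intervalIntegral.integral_mono_on zero_le_one ?_ (hI.add (by simp)) fun x hx =>
    sum_abs_ite_sub_ite_le hg hx
  have := IntervalIntegrable.sum univ (fun j (_ : j ∈ univ) => hJ j)
  rw [Finset.sum_fn] at this
  exact this

/-- The sum over the enumerated elements is the sum over the set. -/
lemma sum_orderEmbOfFin {M : Type*} [AddCommMonoid M] (T : Finset ℚ) (f : ℚ → M) :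
    ∑ j : Fin T.card, f (T.orderEmbOfFin rfl j) = ∑ γ ∈ T, f γ := by
  have h : T = univ.map (T.orderEmbOfFin rfl).toEmbedding := by
    rw [Finset.map_eq_image]
    exact (Finset.image_orderEmbOfFin_univ T rfl).symm
  conv_rhs => rw [h]
  rw [sum_map]
  rfl

lemma mem_Icc_of_mem_kFreeFarey {Q k m : ℕ} {b : ℤ} {γ : ℚ} (h : γ ∈ kFreeFarey Q k m b) :
    (γ : ℝ) ∈ Set.Icc (0 : ℝ) 1 := by
  rw [kFreeFarey, mem_image] at h
  obtain ⟨⟨a, q⟩, h, rfl⟩ := h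
  simp only [mem_filter, mem_product, mem_Icc] at h
  push_cast
  refine ⟨by positivity, ?_⟩
  rw [div_le_one (by exact_mod_cast h.1.2.1)]
  exact_mod_cast h.2.1

lemma card_filter_div_le {d : ℕ} (hd : 1 ≤ d) {x : ℝ} (hx : x ∈ Set.Icc (0 : ℝ) 1) :
    ∑ a ∈ Icc 1 d, (if (((a : ℚ) / d : ℚ) : ℝ) ≤ x then (1 : ℝ) else 0) =
      d * x - Int.fract (d * x) := by
  have hd0 : (0 : ℝ) < d := by exact_mod_cast hd
  have hx0 : 0 ≤ (d : ℝ) * x := mul_nonneg hd0.le hx.1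
  rw [← sum_filter, sum_const, nsmul_eq_mul, mul_one, Int.self_sub_fract,
    ← natCast_floor_eq_intCast_floor hx0]
  congr 1
  have : (Icc 1 d).filter (fun a : ℕ => (((a : ℚ) / d : ℚ) : ℝ) ≤ x) = Icc 1 ⌊(d : ℝ) * x⌋₊ := by
    ext a
    simp only [mem_filter, mem_Icc]
    push_cast
    rw [div_le_iff₀ hd0, Nat.le_floor_iff hx0, mul_comm x]
    constructor
    · exact fun h => ⟨h.1.1, h.2⟩
    · refine fun h => ⟨⟨h.1, ?_⟩, h.2⟩
      exact_mod_cast h.2.trans (mul_le_of_le_one_right hd0.le hx.2)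
  rw [this, Nat.card_Icc, Nat.add_sub_cancel]

/-- The main terms `d x` add up to `N x` and cancel, leaving fractional parts. Centring these at `1
/ 2` costs half the total weight, which `abs_sum_fareyWeight_le` bounds by `1 / 2`. -/
lemma abs_discrepancy_le (Q k m : ℕ) (b : ℤ) {x : ℝ} (hx : x ∈ Set.Icc (0 : ℝ) 1) :
    |(∑ γ ∈ kFreeFarey Q k m b, if (γ : ℝ) ≤ x then (1 : ℝ) else 0) -
        (kFreeFarey Q k m b).card * x| ≤
      |∑ d ∈ Icc 1 Q, (fareyWeight Q k m b d : ℝ) * (Int.fract (d * x) - 1 / 2)| + 1 / 2 := by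
  have h1 : ((kFreeFarey Q k m b).card : ℝ) =
      ∑ d ∈ Icc 1 Q, (fareyWeight Q k m b d : ℝ) * d := by
    have := sum_kFreeFarey (fun _ => (1 : ℝ)) Q k m b
    simpa using this
  have h2 := sum_kFreeFarey (fun γ => if (γ : ℝ) ≤ x then (1 : ℝ) else 0) Q k m b
  rw [h2, h1, sum_mul, ← sum_sub_distrib]
  have h3 : ∑ d ∈ Icc 1 Q, ((fareyWeight Q k m b d : ℝ) *
      ∑ a ∈ Icc 1 d, (if (((a : ℚ) / d : ℚ) : ℝ) ≤ x then (1 : ℝ) else 0) -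
        fareyWeight Q k m b d * d * x) =
      -(∑ d ∈ Icc 1 Q, (fareyWeight Q k m b d : ℝ) * (Int.fract (d * x) - 1 / 2)) -
        (1 / 2) * ∑ d ∈ Icc 1 Q, (fareyWeight Q k m b d : ℝ) := by
    rw [mul_sum, ← sum_neg_distrib, ← sum_sub_distrib]
    refine sum_congr rfl fun d hd => ?_
    rw [card_filter_div_le (mem_Icc.1 hd).1 hx]
    ring
  rw [h3]
  refine (abs_sub _ _).trans ?_
  rw [abs_neg, abs_mul, abs_of_pos (by norm_num : (0 : ℝ) < 1 / 2)]
  gcongr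
  have h4 : |∑ d ∈ Icc 1 Q, (fareyWeight Q k m b d : ℝ)| ≤ 1 := by
    exact_mod_cast abs_sum_fareyWeight_le Q k m b
  linarith

lemma intervalIntegrable_sum_sawtooth (s : Finset ℕ) (w : ℕ → ℝ) :
    IntervalIntegrable (fun x : ℝ => ∑ d ∈ s, w d * (Int.fract (d * x) - 1 / 2)) volume 0 1 := by
  refine intervalIntegrable_of_measurable_bounded (C := ∑ d ∈ s, |w d|) ?_ ?_
  · refine Finset.measurable_sum _ fun d _ => ?_
    exact ((measurable_fract.comp (measurable_id.const_mul _)).sub_const _).const_mul _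
  · intro x _
    refine (abs_sum_le_sum_abs _ _).trans (sum_le_sum fun d _ => ?_)
    rw [abs_mul]
    refine mul_le_of_le_one_right (abs_nonneg _) ?_
    have h1 := Int.fract_nonneg ((d : ℝ) * x)
    have h2 := Int.fract_lt_one ((d : ℝ) * x)
    rw [abs_le]
    constructor <;> linarith

/-- The constant `3 / 2` is `1` from replacing `⌊N x⌋` by `N x` and `1 / 2` from centring the
fractional parts. -/
theorem fareyDisplacement_le_integral (Q k m : ℕ) (b : ℤ) :
    fareyDisplacement Q k m b ≤ (∫ x in (0 : ℝ)..1,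
      |∑ d ∈ Icc 1 Q, (fareyWeight Q k m b d : ℝ) * (Int.fract (d * x) - 1 / 2)|) + 3 / 2 := by
  set T := kFreeFarey Q k m b with hT
  have hmono : Monotone fun j : Fin T.card => ((T.orderEmbOfFin rfl j : ℚ) : ℝ) :=
    fun i j hij =>
      Rat.cast_le.2 ((T.orderEmbOfFin rfl).monotone hij)
  have h1 := sum_abs_sub_le_integral hmono fun j =>
    mem_Icc_of_mem_kFreeFarey (Finset.orderEmbOfFin_mem T rfl j)
  have hS := (intervalIntegrable_sum_sawtooth (Icc 1 Q)
    (fun d => (fareyWeight Q k m b d : ℝ))).abs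
  have h2 : (∫ x in (0 : ℝ)..1, |(∑ j : Fin T.card,
      if ((T.orderEmbOfFin rfl j : ℚ) : ℝ) ≤ x then (1 : ℝ) else 0) - T.card * x|) ≤
      ∫ x in (0 : ℝ)..1, (|∑ d ∈ Icc 1 Q,
        (fareyWeight Q k m b d : ℝ) * (Int.fract (d * x) - 1 / 2)| + 1 / 2) := by
    refine intervalIntegral.integral_mono_on zero_le_one ?_ (hS.add (by simp)) fun x hx => ?_
    · refine intervalIntegrable_of_measurable_bounded (C := T.card + T.card) ?_ ?_
      · have : Measurable fun x : ℝ => (∑ j : Fin T.card,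
            if ((T.orderEmbOfFin rfl j : ℚ) : ℝ) ≤ x then (1 : ℝ) else 0) :=
          Finset.measurable_sum _ fun j _ => measurable_ite_le _
        exact (this.sub (measurable_id.const_mul _)).abs
      · intro x hx
        rw [abs_abs]
        refine (abs_sub _ _).trans (add_le_add ?_ ?_)
        · refine (abs_sum_le_sum_abs _ _).trans ?_
          refine (sum_le_card_nsmul _ _ 1 fun j _ => ?_).trans (by simp)
          split_ifs <;> simp
        · rw [abs_of_nonneg (mul_nonneg (Nat.cast_nonneg _) hx.1.le)]
          exact mul_le_of_le_one_right (Nat.cast_nonneg _) hx.2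
    · rw [sum_orderEmbOfFin T (fun γ => if (γ : ℝ) ≤ x then (1 : ℝ) else 0)]
      exact abs_discrepancy_le Q k m b hx
  rw [intervalIntegral.integral_add hS (by simp)] at h2
  simp only [intervalIntegral.integral_const, sub_zero, smul_eq_mul, one_mul] at h2
  have h3 : fareyDisplacement Q k m b = ∑ j : Fin T.card,
    |((T.orderEmbOfFin rfl j : ℚ) : ℝ) - ((j : ℕ) + 1 : ℝ) / T.card| := rfl
  rw [h3]
  linarith

end

/-! ### Near-orthogonality of dilated sawtooth functions. -/

section

open Finset ArithmeticFunction MeasureTheory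
open scoped ArithmeticFunction.Moebius Interval

/-- The centred sawtooth function. -/
noncomputable def sawtooth (x : ℝ) : ℝ := Int.fract x - 1 / 2

lemma measurable_sawtooth : Measurable sawtooth := measurable_fract.sub_const _

lemma abs_sawtooth_le (x : ℝ) : |sawtooth x| ≤ 1 / 2 := by
  have h1 := Int.fract_nonneg x
  have h2 := Int.fract_lt_one x
  rw [sawtooth, abs_le]
  constructor <;> linarith

lemma sawtooth_add_natCast (x : ℝ) (n : ℕ) : sawtooth (x + n) = sawtooth x := by
  simp [sawtooth]

lemma sum_range_add_mul_emod {a b : ℕ} (ha : 1 ≤ a) (hab : Nat.Coprime a b) (n : ℤ) :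
    ∑ j ∈ range a, (n + b * j) % (a : ℤ) = ∑ i ∈ range a, (i : ℤ) := by
  have ha' : (0 : ℤ) < a := by exact_mod_cast ha
  have hinj : Set.InjOn (fun j : ℕ => (((n + b * j) % (a : ℤ)).toNat)) (range a) := by
    intro i hi j hj hij
    simp only [coe_range, Set.mem_Iio] at hi hj
    have h1 := Int.emod_nonneg (n + b * i) ha'.ne'
    have h2 := Int.emod_nonneg (n + b * j) ha'.ne'
    have h3 : (n + b * i) % (a : ℤ) = (n + b * j) % (a : ℤ) := by
      simp only at hij
      omega
    have h4 : n + b * i ≡ n + b * j [ZMOD a] := h3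
    have h5 : (b : ℤ) * i ≡ b * j [ZMOD a] := Int.ModEq.add_left_cancel' n h4
    have h6 : b * i ≡ b * j [MOD a] := by
      rw [← Int.natCast_modEq_iff]
      exact_mod_cast h5
    have h7 : i ≡ j [MOD a] := Nat.ModEq.cancel_left_of_coprime hab h6
    exact Nat.ModEq.eq_of_lt_of_lt h7 hi hj
  have himg : (range a).image (fun j : ℕ => (((n + b * j) % (a : ℤ)).toNat)) = range a := by
    refine eq_of_subset_of_card_le ?_ ?_
    · intro i hi
      rw [mem_image] at hi
      obtain ⟨j, _, rfl⟩ := hi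
      have h1 := Int.emod_nonneg (n + b * j) ha'.ne'
      have h2 := Int.emod_lt_of_pos (n + b * j) ha'
      rw [mem_range]
      omega
    · rw [card_image_of_injOn hinj]
  conv_rhs => rw [← himg]
  rw [sum_image hinj]
  refine sum_congr rfl fun j _ => ?_
  rw [Int.toNat_of_nonneg (Int.emod_nonneg _ ha'.ne')]

/-- The distribution relation of the sawtooth function. -/
lemma sum_sawtooth_add {a b : ℕ} (ha : 1 ≤ a) (hab : Nat.Coprime a b) (y : ℝ) :
    ∑ j ∈ range a, sawtooth (y + b * j / a) = sawtooth (a * y) := by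
  have ha0 : (0 : ℝ) < a := by exact_mod_cast ha
  have ha' : (0 : ℤ) < a := by exact_mod_cast ha
  -- With `a y = n + r`, the points `y + b j / a` have fractional parts `(i + r) / a`, where `i`
  -- runs once over the residues modulo `a` because `b` is invertible.
  set n := ⌊(a : ℝ) * y⌋ with hn
  set r := Int.fract ((a : ℝ) * y) with hr
  have hy : y = (n + r) / a := by
    rw [hn, hr, Int.floor_add_fract]
    field_simp
  have h1 : ∀ j ∈ range a, sawtooth (y + b * j / a) =
      (((n + b * j) % (a : ℤ) : ℤ) : ℝ) / a + (r / a - 1 / 2) := by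
    intro j _
    have h2 : Int.fract (y + b * j / a) = ((((n + b * j) % (a : ℤ) : ℤ) : ℝ) + r) / a := by
      rw [Int.fract_eq_iff]
      have h3 : (0 : ℝ) ≤ (((n + b * j) % (a : ℤ) : ℤ) : ℝ) := by
        exact_mod_cast Int.emod_nonneg _ ha'.ne'
      have h4 : (((n + b * j) % (a : ℤ) : ℤ) : ℝ) + 1 ≤ a := by
        exact_mod_cast Int.emod_lt_of_pos (n + b * j) ha'
      have h5 : r < 1 := Int.fract_lt_one _
      have h6 : 0 ≤ r := Int.fract_nonneg _
      refine ⟨by positivity, ?_, (n + b * j) / (a : ℤ), ?_⟩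
      · rw [div_lt_one ha0]
        linarith
      · have h7 : (((n + b * j) % (a : ℤ) : ℤ) : ℝ) =
            n + b * j - a * (((n + b * j) / (a : ℤ) : ℤ) : ℝ) := by
          rw [Int.emod_def]
          push_cast
          ring
        rw [h7, hy]
        field_simp
        ring
    rw [sawtooth, h2]
    ring
  rw [sum_congr rfl h1, sum_add_distrib, ← sum_div, ← Int.cast_sum,
    sum_range_add_mul_emod ha hab]
  have h8 : (((∑ i ∈ range a, (i : ℤ)) : ℤ) : ℝ) = a * (a - 1) / 2 := by
    have := Finset.sum_range_id_mul_two a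
    have h9 : ((∑ i ∈ range a, i : ℕ) : ℝ) * 2 = a * (a - 1) := by
      rw [← Nat.cast_pred ha]
      exact_mod_cast this
    push_cast at h9 ⊢
    linarith
  rw [h8, sawtooth, ← hr]
  simp only [sum_const, card_range, nsmul_eq_mul]
  field_simp
  ring

lemma intervalIntegrable_sawtooth_mul (c e t u : ℝ) : IntervalIntegrable
    (fun x : ℝ => sawtooth (c * x + t) * sawtooth (e * x + u)) volume 0 1 := by
  refine intervalIntegrable_of_measurable_bounded (C := 1 / 2 * (1 / 2)) ?_ ?_
  · exact (measurable_sawtooth.comp ((measurable_id.const_mul _).add_const _)).mul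
      (measurable_sawtooth.comp ((measurable_id.const_mul _).add_const _))
  · intro x _
    rw [abs_mul]
    exact mul_le_mul (abs_sawtooth_le _) (abs_sawtooth_le _) (abs_nonneg _) (by norm_num)

/-- A shift of `x` by `j / (g a)` changes `g a c x` by an integer and `g b x` by `b j / a`. The
integral over a period is unaffected, and summing over `j` lets the distribution relation replace
the second factor by the sawtooth at `g a b x`. -/
lemma integral_sawtooth_mul_averaged {g a b c : ℕ} (hg : 1 ≤ g) (ha : 1 ≤ a)
    (hab : Nat.Coprime a b) :
    (a : ℝ) * ∫ x in (0 : ℝ)..1, sawtooth ((g * a * c : ℕ) * x) * sawtooth ((g * b : ℕ) * x) =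
      ∫ x in (0 : ℝ)..1, sawtooth ((g * a * c : ℕ) * x) * sawtooth ((g * a * b : ℕ) * x) := by
  have ha0 : (a : ℝ) ≠ 0 := by positivity
  have hg0 : (g : ℝ) ≠ 0 := by positivity
  have hper : Function.Periodic
      (fun x : ℝ => sawtooth ((g * a * c : ℕ) * x) * sawtooth ((g * b : ℕ) * x)) 1 := by
    intro x
    simp only [mul_add, mul_one, sawtooth_add_natCast]
  have hshift : ∀ j : ℕ,
      (∫ x in (0 : ℝ)..1, sawtooth ((g * a * c : ℕ) * x) * sawtooth ((g * b : ℕ) * x)) =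
      ∫ x in (0 : ℝ)..1, sawtooth ((g * a * c : ℕ) * x) *
        sawtooth ((g * b : ℕ) * x + b * j / a) := by
    intro j
    have h1 := hper.intervalIntegral_add_eq 0 ((j : ℝ) / (g * a))
    rw [zero_add] at h1
    rw [h1]
    have h2 := intervalIntegral.integral_comp_add_right (a := 0) (b := 1)
      (fun x : ℝ => sawtooth ((g * a * c : ℕ) * x) * sawtooth ((g * b : ℕ) * x))
      ((j : ℝ) / (g * a))
    rw [zero_add, add_comm (1 : ℝ)] at h2
    rw [← h2]
    congr 1
    ext x
    have e1 : ((g * a * c : ℕ) : ℝ) * (x + j / (g * a)) =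
        ((g * a * c : ℕ) : ℝ) * x + ((c * j : ℕ) : ℝ) := by
      push_cast
      field_simp
    have e2 : ((g * b : ℕ) : ℝ) * (x + j / (g * a)) = ((g * b : ℕ) : ℝ) * x + b * j / a := by
      push_cast
      field_simp
    rw [e1, e2, sawtooth_add_natCast]
  have h3 : (a : ℝ) * ∫ x in (0 : ℝ)..1,
        sawtooth ((g * a * c : ℕ) * x) * sawtooth ((g * b : ℕ) * x) =
      ∑ j ∈ range a, ∫ x in (0 : ℝ)..1, sawtooth ((g * a * c : ℕ) * x) *
        sawtooth ((g * b : ℕ) * x + b * j / a) := by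
    rw [← sum_congr rfl fun j _ => hshift j, sum_const, card_range, nsmul_eq_mul]
  rw [h3, ← intervalIntegral.integral_finsetSum]
  · congr 1
    ext x
    rw [← mul_sum, sum_sawtooth_add ha hab]
    congr 2
    push_cast
    ring
  · intro j _
    have := intervalIntegrable_sawtooth_mul ((g * a * c : ℕ) : ℝ) ((g * b : ℕ) : ℝ) 0 (b * j / a)
    simpa using this

/-- Near-orthogonality of the dilated sawtooth functions. -/
theorem abs_integral_sawtooth_mul_le {d e : ℕ} (hd : 1 ≤ d) (he : 1 ≤ e) :
    |∫ x in (0 : ℝ)..1, sawtooth (d * x) * sawtooth (e * x)| ≤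
      (Nat.gcd d e : ℝ) ^ 2 / (d * e) := by
  obtain ⟨g, a, b, hg, hab, rfl, rfl⟩ := Nat.exists_coprime' (Nat.gcd_pos_of_pos_left e hd)
  have ha : 1 ≤ a := Nat.pos_of_ne_zero (by rintro rfl; simp at hd)
  have hb : 1 ≤ b := Nat.pos_of_ne_zero (by rintro rfl; simp at he)
  have hgcd : Nat.gcd (a * g) (b * g) = g := by
    rw [Nat.gcd_mul_right, hab.gcd_eq_one, one_mul]
  rw [hgcd]
  -- One averaging over `a` and one over `b` raise both frequencies to `g a b`, so the correlation
  -- is `J / (a b)` with `J` the mean square at that frequency. The crude `|J| ≤ 1` is enough.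
  have h1 := integral_sawtooth_mul_averaged (c := 1) hg ha hab
  have h2 := integral_sawtooth_mul_averaged (c := a) hg hb hab.symm
  set J := ∫ x in (0 : ℝ)..1, sawtooth ((g * b * a : ℕ) * x) * sawtooth ((g * b * a : ℕ) * x)
  have hJ : |J| ≤ 1 := by
    have := intervalIntegral.norm_integral_le_of_norm_le_const (a := (0 : ℝ)) (b := 1) (C := 1)
      (f := fun x => sawtooth ((g * b * a : ℕ) * x) * sawtooth ((g * b * a : ℕ) * x)) ?_
    · rw [sub_zero, abs_one, mul_one] at this
      exact this
    · intro x _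
      rw [norm_mul]
      have := abs_sawtooth_le ((g * b * a : ℕ) * x)
      simp only [Real.norm_eq_abs]
      nlinarith [abs_nonneg (sawtooth ((g * b * a : ℕ) * x))]
  have h3 : ∫ x in (0 : ℝ)..1, sawtooth ((a * g : ℕ) * x) * sawtooth ((b * g : ℕ) * x) =
      J / (a * b) := by
    have e1 : ∫ x in (0 : ℝ)..1, sawtooth ((g * a * 1 : ℕ) * x) * sawtooth ((g * a * b : ℕ) * x) =
        ∫ x in (0 : ℝ)..1, sawtooth ((g * b * a : ℕ) * x) * sawtooth ((g * a : ℕ) * x) := by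
      congr 1
      ext x
      rw [mul_comm, mul_one, mul_right_comm]
    rw [e1] at h1
    rw [← h1] at h2
    rw [← h2, mul_comm a g, mul_comm b g, mul_one]
    have : (a : ℝ) ≠ 0 := by positivity
    have : (b : ℝ) ≠ 0 := by positivity
    rw [eq_div_iff (by positivity)]
    ring
  rw [h3, abs_div, abs_of_pos (by positivity : (0 : ℝ) < a * b)]
  have : (g : ℝ) ≠ 0 := by positivity
  have e2 : (g : ℝ) ^ 2 / (((a * g : ℕ) : ℝ) * ((b * g : ℕ) : ℝ)) = 1 / (a * b) := by
    push_cast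
    field_simp
  rw [e2]
  gcongr

/-- The `L¹`-norm of a combination of sawtooth functions, bounded by means of its `L²`-norm. -/
theorem integral_abs_sum_sawtooth_le (s : Finset ℕ) (hs : ∀ d ∈ s, 1 ≤ d) (w : ℕ → ℝ) {c : ℝ}
    (hc : 0 < c) :
    ∫ x in (0 : ℝ)..1, |∑ d ∈ s, w d * sawtooth (d * x)| ≤
      (∑ d ∈ s, ∑ e ∈ s, |w d| * |w e| * ((Nat.gcd d e : ℝ) ^ 2 / (d * e))) / c + c := by
  have hI : ∀ d ∈ s, ∀ e ∈ s, IntervalIntegrable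
      (fun x : ℝ => w d * w e * (sawtooth (d * x) * sawtooth (e * x))) volume 0 1 := by
    intro d _ e _
    have := intervalIntegrable_sawtooth_mul d e 0 0
    simp only [add_zero] at this
    exact this.const_mul _
  have hI2 : ∀ d ∈ s, IntervalIntegrable
      (fun x : ℝ => ∑ e ∈ s, w d * w e * (sawtooth (d * x) * sawtooth (e * x))) volume 0 1 := by
    intro d hd
    have := IntervalIntegrable.sum s (hI d hd)
    rwa [Finset.sum_fn] at this
  have hI3 : IntervalIntegrable (fun x : ℝ =>
      ∑ d ∈ s, ∑ e ∈ s, w d * w e * (sawtooth (d * x) * sawtooth (e * x))) volume 0 1 := by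
    have := IntervalIntegrable.sum s hI2
    rwa [Finset.sum_fn] at this
  -- The pointwise inequality `y ≤ y ^ 2 / c + c` replaces Cauchy–Schwarz; `c` should be of the
  -- expected size of the `L²`-norm.
  have h1 : ∫ x in (0 : ℝ)..1, |∑ d ∈ s, w d * sawtooth (d * x)| ≤ ∫ x in (0 : ℝ)..1,
      ((∑ d ∈ s, ∑ e ∈ s, w d * w e * (sawtooth (d * x) * sawtooth (e * x))) / c + c) := by
    refine intervalIntegral.integral_mono_on zero_le_one ?_ ((hI3.div_const c).add (by simp)) ?_
    · exact (intervalIntegrable_sum_sawtooth s w).abs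
    · intro x _
      have h2 : ∑ d ∈ s, ∑ e ∈ s, w d * w e * (sawtooth (d * x) * sawtooth (e * x)) =
          |∑ d ∈ s, w d * sawtooth (d * x)| ^ 2 := by
        rw [sq_abs, sq, sum_mul_sum]
        refine sum_congr rfl fun d _ => sum_congr rfl fun e _ => by ring
      rw [h2]
      set y := |∑ d ∈ s, w d * sawtooth (d * x)|
      have h3 : y ^ 2 / c + c - y = ((y - c / 2) ^ 2 + 3 / 4 * c ^ 2) / c := by
        field_simp
        ring
      have h4 : 0 ≤ ((y - c / 2) ^ 2 + 3 / 4 * c ^ 2) / c := by positivity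
      linarith
  refine h1.trans ?_
  rw [intervalIntegral.integral_add (hI3.div_const c) (by simp), intervalIntegral.integral_div,
    intervalIntegral.integral_finsetSum hI2]
  simp only [intervalIntegral.integral_const, sub_zero, smul_eq_mul, one_mul]
  gcongr with d hd
  rw [intervalIntegral.integral_finsetSum (hI d hd)]
  gcongr with e he
  rw [intervalIntegral.integral_const_mul]
  refine (le_abs_self _).trans ?_
  rw [abs_mul, abs_mul]
  gcongr
  exact abs_integral_sawtooth_mul_le (hs d hd) (hs e he)

end

/-! ### Bounding the weights by sums of `μ χ`, and the displacement by the weights. -/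

section

open Finset ArithmeticFunction MeasureTheory
open scoped ArithmeticFunction.Moebius Interval

lemma sum_filter_dvd_rpow_le {s : ℝ} (hs : 1 < s) (Q : ℕ) {g : ℕ} (hg : 1 ≤ g) :
    ∑ d ∈ (Icc 1 Q).filter (g ∣ ·), (d : ℝ) ^ (-s) ≤
      (g : ℝ) ^ (-s) * ∑' l : ℕ, (l : ℝ) ^ (-s) := by
  have hsum : Summable fun l : ℕ => (l : ℝ) ^ (-s) :=
    Real.summable_nat_rpow.2 (by linarith)
  have hsub : (Icc 1 Q).filter (g ∣ ·) ⊆ (Icc 1 Q).image (g * ·) := by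
    intro d hd
    simp only [mem_filter, mem_Icc, mem_image] at hd ⊢
    obtain ⟨⟨h1, h2⟩, l, rfl⟩ := hd
    refine ⟨l, ⟨Nat.pos_of_ne_zero (by rintro rfl; simp at h1), ?_⟩, rfl⟩
    exact (Nat.le_mul_of_pos_left l hg).trans h2
  calc _ ≤ ∑ d ∈ (Icc 1 Q).image (g * ·), (d : ℝ) ^ (-s) :=
        sum_le_sum_of_subset_of_nonneg hsub fun _ _ _ => by positivity
    _ = ∑ l ∈ Icc 1 Q, ((g * l : ℕ) : ℝ) ^ (-s) := by
        rw [sum_image]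
        intro a _ b _ hab
        exact Nat.eq_of_mul_eq_mul_left hg hab
    _ = (g : ℝ) ^ (-s) * ∑ l ∈ Icc 1 Q, (l : ℝ) ^ (-s) := by
        rw [mul_sum]
        refine sum_congr rfl fun l _ => ?_
        rw [Nat.cast_mul, Real.mul_rpow (by positivity) (by positivity)]
    _ ≤ _ := by
        gcongr
        exact hsum.sum_le_tsum _ fun _ _ => by positivity

/-- Boundedness of the sums `∑ gcd (d, e) ^ 2 / (d e) ^ s` for `s > 3 / 2`. -/
lemma exists_sum_gcd_sq_le {s : ℝ} (hs : 3 / 2 < s) : ∃ B : ℝ, 0 ≤ B ∧ ∀ Q : ℕ,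
    ∑ d ∈ Icc 1 Q, ∑ e ∈ Icc 1 Q, (Nat.gcd d e : ℝ) ^ 2 * ((d : ℝ) ^ (-s) * (e : ℝ) ^ (-s)) ≤ B := by
  set Z := ∑' l : ℕ, (l : ℝ) ^ (-s) with hZ
  have hZ0 : 0 ≤ Z := tsum_nonneg fun _ => by positivity
  have hsum : Summable fun l : ℕ => (l : ℝ) ^ (2 - 2 * s) :=
    Real.summable_nat_rpow.2 (by linarith)
  refine ⟨Z ^ 2 * ∑' l : ℕ, (l : ℝ) ^ (2 - 2 * s),
    mul_nonneg (by positivity) (tsum_nonneg fun _ => by positivity), fun Q => ?_⟩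
  -- Replacing the square of the gcd by the sum of `g ^ 2` over all common divisors `g` separates
  -- `d` from `e`. Each `g` then contributes at most `Z ^ 2 * g ^ (2 - 2 s)`, summable for `s > 3 /
  -- 2`.
  have h1 : ∀ d ∈ Icc 1 Q, ∀ e ∈ Icc 1 Q,
      (Nat.gcd d e : ℝ) ^ 2 * ((d : ℝ) ^ (-s) * (e : ℝ) ^ (-s)) ≤
      ∑ g ∈ Icc 1 Q, if g ∣ d ∧ g ∣ e then (g : ℝ) ^ 2 * ((d : ℝ) ^ (-s) * (e : ℝ) ^ (-s))
        else 0 := by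
    intro d hd e he
    rw [mem_Icc] at hd he
    have hg : Nat.gcd d e ∈ Icc 1 Q := by
      rw [mem_Icc]
      exact ⟨Nat.gcd_pos_of_pos_left e hd.1, (Nat.gcd_le_left e hd.1).trans hd.2⟩
    refine le_trans (le_of_eq ?_) (single_le_sum (f := fun g : ℕ => if g ∣ d ∧ g ∣ e then
      (g : ℝ) ^ 2 * ((d : ℝ) ^ (-s) * (e : ℝ) ^ (-s)) else 0) (fun g _ => ?_) hg)
    · simp [Nat.gcd_dvd_left, Nat.gcd_dvd_right]
    · split_ifs <;> positivity
  calc _ ≤ ∑ d ∈ Icc 1 Q, ∑ e ∈ Icc 1 Q, ∑ g ∈ Icc 1 Q, if g ∣ d ∧ g ∣ e then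
        (g : ℝ) ^ 2 * ((d : ℝ) ^ (-s) * (e : ℝ) ^ (-s)) else 0 :=
        sum_le_sum fun d hd => sum_le_sum fun e he => h1 d hd e he
    _ = ∑ g ∈ Icc 1 Q, (g : ℝ) ^ 2 * (∑ d ∈ (Icc 1 Q).filter (g ∣ ·), (d : ℝ) ^ (-s)) ^ 2 := by
        have e1 : ∀ d ∈ Icc 1 Q, (∑ e ∈ Icc 1 Q, ∑ g ∈ Icc 1 Q, if g ∣ d ∧ g ∣ e then
            (g : ℝ) ^ 2 * ((d : ℝ) ^ (-s) * (e : ℝ) ^ (-s)) else 0) =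
            ∑ g ∈ Icc 1 Q, ∑ e ∈ Icc 1 Q, if g ∣ d ∧ g ∣ e then
            (g : ℝ) ^ 2 * ((d : ℝ) ^ (-s) * (e : ℝ) ^ (-s)) else 0 := fun d _ => sum_comm
        rw [sum_congr rfl e1, sum_comm]
        refine sum_congr rfl fun g _ => ?_
        rw [sq (∑ d ∈ (Icc 1 Q).filter (g ∣ ·), (d : ℝ) ^ (-s)), sum_mul_sum, mul_sum, sum_filter]
        refine sum_congr rfl fun d _ => ?_
        by_cases hd : g ∣ d
        · simp only [hd, true_and, if_true]
          rw [← sum_filter, mul_sum]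
        · simp [hd]
    _ ≤ ∑ g ∈ Icc 1 Q, Z ^ 2 * (g : ℝ) ^ (2 - 2 * s) := by
        refine sum_le_sum fun g hg => ?_
        have hg1 := (mem_Icc.1 hg).1
        have hg0 : (0 : ℝ) < g := by exact_mod_cast hg1
        have h2 := sum_filter_dvd_rpow_le (by linarith : 1 < s) Q hg1
        have h3 : (g : ℝ) ^ (2 - 2 * s) = (g : ℝ) ^ 2 * ((g : ℝ) ^ (-s)) ^ 2 := by
          rw [← Real.rpow_natCast, ← Real.rpow_natCast, ← Real.rpow_mul hg0.le,
            ← Real.rpow_add hg0]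
          congr 1
          push_cast
          ring
        calc (g : ℝ) ^ 2 * (∑ d ∈ (Icc 1 Q).filter (g ∣ ·), (d : ℝ) ^ (-s)) ^ 2
            ≤ (g : ℝ) ^ 2 * ((g : ℝ) ^ (-s) * Z) ^ 2 := by
              gcongr
          _ = _ := by rw [h3]; ring
    _ ≤ _ := by
        rw [← mul_sum]
        gcongr
        exact hsum.sum_le_tsum _ fun _ _ => by positivity

/-- A bound for the partial Euler products over the prime divisors of `d`. -/
lemma exists_prod_primes_le {α η : ℝ} (hα : 1 / 2 ≤ α) (hη : 0 < η) : ∃ C : ℝ, 0 ≤ C ∧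
    ∀ d : ℕ, 1 ≤ d → ∀ P ⊆ d.primeFactors,
      ∏ p ∈ P, (1 - (p : ℝ) ^ (-α))⁻¹ ≤ C * (d : ℝ) ^ η := by
  -- Every Euler factor is at most `4`, since `p ^ (-α) ≤ 2 ^ (-1/2) ≤ 3 / 4`. From `p₀` on, `p ^ η`
  -- absorbs it; the fewer than `p₀ + 1` smaller primes cost at most `4 ^ p₀`.
  obtain ⟨p₀, hp₀⟩ : ∃ p₀ : ℕ, ∀ p : ℕ, p₀ ≤ p → (4 : ℝ) ≤ (p : ℝ) ^ η := by
    have := (tendsto_rpow_atTop hη).comp tendsto_natCast_atTop_atTop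
    exact Filter.eventually_atTop.1 (this.eventually_ge_atTop 4)
  refine ⟨4 ^ p₀, by positivity, fun d hd P hP => ?_⟩
  have hfac : ∀ p : ℕ, 2 ≤ p → 0 ≤ (1 - (p : ℝ) ^ (-α))⁻¹ ∧ (1 - (p : ℝ) ^ (-α))⁻¹ ≤ 4 := by
    intro p hp
    have h1 : (p : ℝ) ^ (-α) ≤ 3 / 4 := by
      have hp' : (2 : ℝ) ≤ p := by exact_mod_cast hp
      calc (p : ℝ) ^ (-α) ≤ (p : ℝ) ^ (-(1 / 2) : ℝ) :=
            Real.rpow_le_rpow_of_exponent_le (by linarith) (by linarith)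
        _ ≤ (2 : ℝ) ^ (-(1 / 2) : ℝ) :=
            Real.rpow_le_rpow_of_nonpos (by norm_num) hp' (by norm_num)
        _ ≤ 3 / 4 := by
            rw [Real.rpow_neg (by norm_num), ← Real.sqrt_eq_rpow, inv_le_comm₀ (by positivity)
              (by norm_num)]
            rw [Real.le_sqrt (by norm_num) (by norm_num)]
            norm_num
    constructor
    · exact inv_nonneg.2 (by linarith)
    · rw [inv_le_comm₀ (by linarith) (by norm_num)]
      linarith
  have hp2 : ∀ p ∈ P, 2 ≤ p := fun p hp => (Nat.prime_of_mem_primeFactors (hP hp)).two_le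
  calc ∏ p ∈ P, (1 - (p : ℝ) ^ (-α))⁻¹
      ≤ ∏ p ∈ P, ((if p < p₀ then (4 : ℝ) else 1) * (p : ℝ) ^ η) := by
        refine prod_le_prod (fun p hp => (hfac p (hp2 p hp)).1) fun p hp => ?_
        have hp1 : (1 : ℝ) ≤ p := by exact_mod_cast (one_le_two.trans (hp2 p hp))
        split_ifs with h
        · have := Real.one_le_rpow hp1 hη.le
          linarith [(hfac p (hp2 p hp)).2]
        · rw [one_mul]
          exact (hfac p (hp2 p hp)).2.trans (hp₀ p (not_lt.1 h))
    _ = (∏ p ∈ P, if p < p₀ then (4 : ℝ) else 1) * ((∏ p ∈ P, p : ℕ) : ℝ) ^ η := by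
        rw [prod_mul_distrib, Nat.cast_prod, Real.finsetProd_rpow]
        intro p _
        positivity
    _ ≤ 4 ^ p₀ * (d : ℝ) ^ η := by
        gcongr
        · rw [← prod_filter, prod_const]
          refine pow_le_pow_right₀ (by norm_num) ?_
          have : P.filter (· < p₀) ⊆ range p₀ := by
            intro p hp
            rw [mem_filter] at hp
            exact mem_range.2 hp.2
          simpa using card_le_card this
        · refine Nat.le_of_dvd hd ?_
          exact (prod_dvd_prod_of_subset _ _ _ hP).trans (Nat.prod_primeFactors_dvd d)

/-- The summatory function of `μ χ` over the integers without prime factors in `P`. -/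
noncomputable def mertensTwist {m : ℕ} (χ : DirichletCharacter ℂ m) (P : Finset ℕ) (x : ℕ) : ℂ :=
  ∑ e ∈ (Icc 1 x).filter (fun e => ∀ p ∈ P, ¬ p ∣ e), (μ e : ℂ) * χ e

/-- The terms removed by sieving out `p` are those at `p * e`. Only `e` prime to `p` matters, by
squarefreeness, and there `μ (p * e) = -μ e`, which reproduces the sieved sum at `x / p`. -/
lemma mertensTwist_insert {m : ℕ} (χ : DirichletCharacter ℂ m) {P : Finset ℕ}
    (hP : ∀ p ∈ P, p.Prime) {p : ℕ} (hp : p.Prime) (hpP : p ∉ P) (x : ℕ) :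
    mertensTwist χ (insert p P) x =
      mertensTwist χ P x + χ p * mertensTwist χ (insert p P) (x / p) := by
  have h1 : mertensTwist χ P x = mertensTwist χ (insert p P) x +
      ∑ e ∈ (Icc 1 x).filter (fun e => p ∣ e ∧ ∀ q ∈ P, ¬ q ∣ e), (μ e : ℂ) * χ e := by
    rw [mertensTwist, mertensTwist,
      ← sum_filter_add_sum_filter_not _ (fun e => ¬ p ∣ e), filter_filter, filter_filter]
    congr 1
    · refine sum_congr (filter_congr fun e _ => ?_) fun _ _ => rfl
      simp only [mem_insert, forall_eq_or_imp]
      tauto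
    · refine sum_congr (filter_congr fun e _ => ?_) fun _ _ => rfl
      tauto
  have h2 : ∑ e ∈ (Icc 1 x).filter (fun e => p ∣ e ∧ ∀ q ∈ P, ¬ q ∣ e), (μ e : ℂ) * χ e =
      ∑ e ∈ (Icc 1 (x / p)).filter (fun e => ∀ q ∈ P, ¬ q ∣ e), (μ (p * e) : ℂ) * χ (p * e : ℕ) := by
    symm
    refine sum_bij (fun e _ => p * e) ?_ ?_ ?_ ?_
    · intro e he
      simp only [mem_filter, mem_Icc] at he ⊢
      refine ⟨⟨Nat.mul_pos hp.pos he.1.1, ?_⟩, dvd_mul_right _ _, fun q hq hqe => ?_⟩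
      · rw [mul_comm]
        exact (Nat.le_div_iff_mul_le hp.pos).1 he.1.2
      · rcases (hP q hq).dvd_mul.1 hqe with h | h
        · rw [(Nat.prime_dvd_prime_iff_eq (hP q hq) hp).1 h] at hq
          exact hpP hq
        · exact he.2 q hq h
    · intro a _ b _ h
      exact Nat.eq_of_mul_eq_mul_left hp.pos h
    · intro e he
      simp only [mem_filter, mem_Icc] at he
      obtain ⟨⟨h1, h2⟩, ⟨c, rfl⟩, h3⟩ := he
      refine ⟨c, ?_, rfl⟩
      simp only [mem_filter, mem_Icc]
      refine ⟨⟨Nat.pos_of_ne_zero (by rintro rfl; simp at h1), ?_⟩, fun q hq hqc =>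
        h3 q hq (hqc.mul_left p)⟩
      rw [Nat.le_div_iff_mul_le hp.pos, mul_comm]
      exact h2
    · intro e _
      rfl
  have h3 : ∑ e ∈ (Icc 1 (x / p)).filter (fun e => ∀ q ∈ P, ¬ q ∣ e),
      (μ (p * e) : ℂ) * χ (p * e : ℕ) = -(χ p * mertensTwist χ (insert p P) (x / p)) := by
    rw [mertensTwist, mul_sum, ← sum_neg_distrib]
    have h4 : (Icc 1 (x / p)).filter (fun e => ∀ q ∈ insert p P, ¬ q ∣ e) =
        ((Icc 1 (x / p)).filter (fun e => ∀ q ∈ P, ¬ q ∣ e)).filter (fun e => ¬ p ∣ e) := by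
      rw [filter_filter]
      refine filter_congr fun e _ => ?_
      simp only [mem_insert, forall_eq_or_imp]
      tauto
    rw [h4, sum_filter (fun e => ¬ p ∣ e)]
    refine sum_congr rfl fun e _ => ?_
    by_cases hpe : p ∣ e
    · rw [if_neg (not_not.2 hpe), moebius_eq_zero_of_not_squarefree]
      · simp
      · obtain ⟨c, rfl⟩ := hpe
        intro hsq
        have : IsUnit p := hsq p ⟨c, by ring⟩
        exact hp.one_lt.ne' (Nat.isUnit_iff.1 this)
    · have hcop : Nat.Coprime p e := (Nat.Prime.coprime_iff_not_dvd hp).2 hpe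
      rw [if_pos hpe, isMultiplicative_moebius.map_mul_of_coprime hcop, moebius_apply_prime hp]
      push_cast
      rw [map_mul]
      ring
  rw [h1, h2, h3]
  ring

/-- Removing finitely many primes costs at most a partial Euler product. -/
lemma norm_mertensTwist_le {m : ℕ} (χ : DirichletCharacter ℂ m) {α C : ℝ} (hα : 0 < α)
    (hC : ∀ x : ℕ, ‖mertensTwist χ ∅ x‖ ≤ C * (x : ℝ) ^ α) {P : Finset ℕ}
    (hP : ∀ p ∈ P, p.Prime) (x : ℕ) :
    ‖mertensTwist χ P x‖ ≤ C * (∏ p ∈ P, (1 - (p : ℝ) ^ (-α))⁻¹) * (x : ℝ) ^ α := by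
  have hC0 : 0 ≤ C := by simpa using (norm_nonneg _).trans (hC 1)
  have hlt : ∀ p : ℕ, p.Prime → (p : ℝ) ^ (-α) < 1 := fun p hp =>
    Real.rpow_lt_one_of_one_lt_of_neg (by exact_mod_cast hp.one_lt) (by linarith)
  -- Besides the induction on the primes, each new prime needs a strong induction on `x`, because
  -- the recursion refers to the same sum at `x / p`. The factor `(1 - p ^ (-α))⁻¹` is the fixed
  -- point of `c ↦ 1 + p ^ (-α) * c`.
  induction P using Finset.induction_on generalizing x with
  | empty => simpa using hC x
  | insert p P hpP ih =>
    have hp : p.Prime := hP p (mem_insert_self _ _)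
    have hP' : ∀ q ∈ P, q.Prime := fun q hq => hP q (mem_insert_of_mem hq)
    induction x using Nat.strong_induction_on with
    | _ x ihx =>
      rcases Nat.eq_zero_or_pos x with rfl | hx
      · simp [mertensTwist, Real.zero_rpow hα.ne']
      have h1 := ihx (x / p) (Nat.div_lt_self hx hp.one_lt)
      have h2 := ih hP' x
      set K := ∏ q ∈ P, (1 - (q : ℝ) ^ (-α))⁻¹ with hK
      have hK0 : 0 ≤ K := prod_nonneg fun q hq => inv_nonneg.2 (by linarith [hlt q (hP' q hq)])
      rw [prod_insert hpP, ← hK] at h1 ⊢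
      have hp1 := hlt p hp
      have hp0 : (0 : ℝ) < p := by exact_mod_cast hp.pos
      have h3 : ((x / p : ℕ) : ℝ) ^ α ≤ (x : ℝ) ^ α * (p : ℝ) ^ (-α) := by
        rw [Real.rpow_neg hp0.le, ← div_eq_mul_inv, ← Real.div_rpow (by positivity) hp0.le]
        exact Real.rpow_le_rpow (by positivity) Nat.cast_div_le hα.le
      have h4 : 0 < 1 - (p : ℝ) ^ (-α) := by linarith
      rw [mertensTwist_insert χ hP' hp hpP x]
      calc _ ≤ ‖mertensTwist χ P x‖ + ‖χ p‖ * ‖mertensTwist χ (insert p P) (x / p)‖ := by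
            rw [← norm_mul]
            exact norm_add_le _ _
        _ ≤ C * K * (x : ℝ) ^ α + 1 * (C * ((1 - (p : ℝ) ^ (-α))⁻¹ * K) *
              ((x : ℝ) ^ α * (p : ℝ) ^ (-α))) := by
            gcongr
            · exact χ.norm_le_one _
            · refine h1.trans ?_
              gcongr
        _ = _ := by
            field_simp
            ring

/-- A squarefree `e` raises each exponent of `d` by at most one, so only primes of exponent `k - 1`
in `d` are forbidden in `e`. This turns the `k`-free condition into a sieve by primes dividing `d`.
-/
lemma isPowFree_mul_iff {k d e : ℕ} (hk : 2 ≤ k) (hd : IsPowFree k d) (hd0 : d ≠ 0)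
    (he : Squarefree e) :
    IsPowFree k (d * e) ↔ ∀ p ∈ d.primeFactors.filter (fun p => p ^ (k - 1) ∣ d), ¬ p ∣ e := by
  constructor
  · intro h p hp hpe
    rw [mem_filter] at hp
    refine h p (Nat.prime_of_mem_primeFactors hp.1) ?_
    have : p ^ k = p ^ (k - 1) * p := by
      rw [← pow_succ]
      congr 1
      omega
    rw [this]
    exact mul_dvd_mul hp.2 hpe
  · intro h p hp hpk
    by_cases hpe : p ∣ e
    · obtain ⟨c, rfl⟩ := hpe
      have hpc : ¬ p ∣ c := by
        rintro ⟨c', rfl⟩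
        have : IsUnit p := he p ⟨c', by ring⟩
        exact hp.one_lt.ne' (Nat.isUnit_iff.1 this)
      have h1 : p ^ (k - 1) ∣ d * c := by
        have : p ^ k = p * p ^ (k - 1) := by
          rw [← pow_succ']
          congr 1
          omega
        rw [this, mul_left_comm] at hpk
        exact Nat.dvd_of_mul_dvd_mul_left hp.pos hpk
      have h2 : p ^ (k - 1) ∣ d :=
        (((Nat.Prime.coprime_iff_not_dvd hp).2 hpc).pow_left _).dvd_of_dvd_mul_right h1
      refine h p ?_ (dvd_mul_right _ _)
      rw [mem_filter, Nat.mem_primeFactors]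
      exact ⟨⟨hp, (dvd_pow_self p (by omega)).trans h2, hd0⟩, h2⟩
    · exact hd p hp ((((Nat.Prime.coprime_iff_not_dvd hp).2 hpe).pow_left _).dvd_of_dvd_mul_right hpk)

/-- The Farey weights in terms of Dirichlet characters. -/
lemma abs_fareyWeight_le_sum {m : ℕ} [NeZero m] {k : ℕ} (hk : 2 ≤ k) {b : ℤ}
    (hb : IsCoprime b (m : ℤ)) (Q : ℕ) {d : ℕ} (hd : 1 ≤ d) :
    |(fareyWeight Q k m b d : ℝ)| ≤ ∑ χ : DirichletCharacter ℂ m,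
      ‖mertensTwist χ (d.primeFactors.filter (fun p => p ^ (k - 1) ∣ d)) (Q / d)‖ := by
  classical
  set P := d.primeFactors.filter (fun p => p ^ (k - 1) ∣ d) with hP
  by_cases hdk : IsPowFree k d
  swap
  · have : fareyWeight Q k m b d = 0 := by
      rw [fareyWeight, filter_false_of_mem, sum_empty]
      rintro e _ ⟨h, _⟩
      exact hdk fun p hp hpd => h p hp (hpd.mul_right e)
    rw [this]
    simp only [Int.cast_zero, abs_zero]
    positivity
  have hbu : IsUnit (b : ZMod m) := 
    (ZMod.coe_int_isUnit_iff_isCoprime b m).2 hb.symm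
  have hφ : (0 : ℝ) < m.totient := by exact_mod_cast Nat.totient_pos.2 (NeZero.pos m)
  -- Orthogonality of characters detects `d * e ≡ b`. The `k`-free condition becomes the sieve by
  -- `P` for squarefree `e`, the only ones on which `μ` does not vanish.
  have h1 : (m.totient : ℂ) * (fareyWeight Q k m b d : ℂ) =
      ∑ χ : DirichletCharacter ℂ m, χ (b : ZMod m)⁻¹ * χ d * mertensTwist χ P (Q / d) := by
    have h2 : ∀ e : ℕ, (∑ χ : DirichletCharacter ℂ m, χ (b : ZMod m)⁻¹ * χ d * χ e) =
        if ((d * e : ℕ) : ℤ) ≡ b [ZMOD (m : ℤ)] then (m.totient : ℂ) else 0 := by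
      intro e
      have h3 := DirichletCharacter.sum_char_inv_mul_char_eq ℂ hbu ((d * e : ℕ) : ZMod m)
      have h4 : (b : ZMod m) = ((d * e : ℕ) : ZMod m) ↔ ((d * e : ℕ) : ℤ) ≡ b [ZMOD (m : ℤ)] := by
        rw [← ZMod.intCast_eq_intCast_iff, eq_comm]
        simp
      simp only [h4] at h3
      rw [← h3]
      refine sum_congr rfl fun χ _ => ?_
      push_cast
      rw [map_mul, mul_assoc]
    simp only [mertensTwist, mul_sum]
    rw [sum_comm, fareyWeight, sum_filter, sum_filter, Int.cast_sum, mul_sum]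
    refine sum_congr rfl fun e _ => ?_
    have h5 : (∑ χ : DirichletCharacter ℂ m, χ (b : ZMod m)⁻¹ * χ d * ((μ e : ℂ) * χ e)) =
        (μ e : ℂ) * if ((d * e : ℕ) : ℤ) ≡ b [ZMOD (m : ℤ)] then (m.totient : ℂ) else 0 := by
      rw [← h2, mul_sum]
      exact sum_congr rfl fun χ _ => by ring
    rw [h5]
    by_cases he : Squarefree e
    · have h6 := isPowFree_mul_iff hk hdk (by omega) he
      rw [← hP] at h6
      rw [IsFareyDenominator, h6]
      by_cases h7 : ∀ p ∈ P, ¬ p ∣ e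
      · by_cases h8 : ((d * e : ℕ) : ℤ) ≡ b [ZMOD (m : ℤ)]
        · simp only [if_pos h7, if_pos h8, if_pos (And.intro h7 h8)]
          ring
        · rw [if_neg h8, if_neg fun h => h8 h.2]
          simp
      · rw [if_neg h7, if_neg fun h => h7 h.1]
        simp
    · simp [moebius_eq_zero_of_not_squarefree he]
  have h2 : (m.totient : ℝ) * |(fareyWeight Q k m b d : ℝ)| ≤
      ∑ χ : DirichletCharacter ℂ m, ‖mertensTwist χ P (Q / d)‖ := by
    have := congrArg norm h1
    rw [norm_mul, Complex.norm_natCast, Complex.norm_intCast] at this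
    rw [this]
    refine (norm_sum_le _ _).trans (sum_le_sum fun χ _ => ?_)
    rw [norm_mul, norm_mul]
    have h3 := χ.norm_le_one ((b : ZMod m)⁻¹)
    have h4 := χ.norm_le_one (d : ZMod m)
    have h5 : ‖χ (b : ZMod m)⁻¹‖ * ‖χ (d : ZMod m)‖ ≤ 1 := mul_le_one₀ h3 (norm_nonneg _) h4
    exact mul_le_of_le_one_left (norm_nonneg _) h5
  refine le_trans (le_mul_of_one_le_left (abs_nonneg _) ?_) h2
  exact_mod_cast Nat.totient_pos.2 (NeZero.pos m)

/-- Square-root cancellation in the sums of `μ χ` bounds the displacement of the Farey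
fractions, uniformly in the other parameters. -/
theorem exists_fareyDisplacement_le {m : ℕ} [NeZero m]
    (H : ∀ χ : DirichletCharacter ℂ m, ∀ α : ℝ, 1 / 2 < α → ∃ C : ℝ, ∀ x : ℕ,
      ‖mertensTwist χ ∅ x‖ ≤ C * (x : ℝ) ^ α) {ε : ℝ} (hε : 0 < ε) :
    ∃ C : ℝ, ∀ k : ℕ, 2 ≤ k → ∀ b : ℤ, IsCoprime b (m : ℤ) → ∀ Q : ℕ, 1 ≤ Q →
      fareyDisplacement Q k m b ≤ C * (Q : ℝ) ^ (1 / 2 + ε) := by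
  set α : ℝ := 1 / 2 + ε with hα
  choose c hc using fun χ : DirichletCharacter ℂ m => H χ α (by linarith)
  -- Half of `ε` pays for the Euler products, uniformly in `k`. Then `|w d| / d` is bounded by `Q ^
  -- α * d ^ (-s)` up to a constant, with `s = 1 + α - ε / 2 = 3 / 2 + ε / 2`, just inside the range
  -- where the gcd sum converges.
  obtain ⟨C₁, hC₁, hprod⟩ := exists_prod_primes_le (α := α) (η := ε / 2) (by linarith) (by linarith)
  obtain ⟨B, hB, hgcd⟩ := exists_sum_gcd_sq_le (s := 1 + α - ε / 2) (by linarith)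
  have hc0 : ∀ χ, 0 ≤ c χ := fun χ => by simpa using (norm_nonneg _).trans (hc χ 1)
  set C₀ := ∑ χ, c χ with hC₀
  have hC₀0 : 0 ≤ C₀ := sum_nonneg fun χ _ => hc0 χ
  refine ⟨(C₀ * C₁) ^ 2 * B + 5 / 2, fun k hk b hb Q hQ => ?_⟩
  have hQ0 : (0 : ℝ) < Q := by exact_mod_cast hQ
  have hw : ∀ d ∈ Icc 1 Q, |(fareyWeight Q k m b d : ℝ)| ≤
      C₀ * C₁ * (Q : ℝ) ^ α * (d : ℝ) ^ (ε / 2 - α) := by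
    intro d hd
    have hd1 := (mem_Icc.1 hd).1
    have hd0 : (0 : ℝ) < d := by exact_mod_cast hd1
    refine (abs_fareyWeight_le_sum hk hb Q hd1).trans ?_
    rw [hC₀, sum_mul, sum_mul, sum_mul]
    refine sum_le_sum fun χ _ => ?_
    refine (norm_mertensTwist_le χ (by linarith) (hc χ) (fun p hp =>
      Nat.prime_of_mem_primeFactors (mem_filter.1 hp).1) _).trans ?_
    have h1 := hprod d hd1 _ (filter_subset (fun p => p ^ (k - 1) ∣ d) _)
    have h2 : ((Q / d : ℕ) : ℝ) ^ α ≤ (Q : ℝ) ^ α * (d : ℝ) ^ (-α) := by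
      rw [Real.rpow_neg hd0.le, ← div_eq_mul_inv, ← Real.div_rpow (by positivity) hd0.le]
      exact Real.rpow_le_rpow (by positivity) Nat.cast_div_le (by linarith)
    calc _ ≤ c χ * (C₁ * (d : ℝ) ^ (ε / 2)) * ((Q : ℝ) ^ α * (d : ℝ) ^ (-α)) := by
          have := hc0 χ
          gcongr
      _ = _ := by
          rw [sub_eq_add_neg, Real.rpow_add hd0]
          ring
  have h1 := fareyDisplacement_le_integral Q k m b
  -- The squared `L²`-norm is `O(Q ^ (2 α))`, so `c = Q ^ α` balances the two terms. That term and
  -- the additive `3 / 2` account for the constant `5 / 2`.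
  have h2 := integral_abs_sum_sawtooth_le (Icc 1 Q) (fun d hd => (mem_Icc.1 hd).1)
    (fun d => (fareyWeight Q k m b d : ℝ)) (Real.rpow_pos_of_pos hQ0 α)
  have h3 : ∑ d ∈ Icc 1 Q, ∑ e ∈ Icc 1 Q, |(fareyWeight Q k m b d : ℝ)| *
      |(fareyWeight Q k m b e : ℝ)| * ((Nat.gcd d e : ℝ) ^ 2 / (d * e)) ≤
      (C₀ * C₁ * (Q : ℝ) ^ α) ^ 2 * B := by
    refine le_trans ?_ (mul_le_mul_of_nonneg_left (hgcd Q) (by positivity))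
    rw [mul_sum]
    refine sum_le_sum fun d hd => ?_
    rw [mul_sum]
    refine sum_le_sum fun e he => ?_
    have hd0 : (0 : ℝ) < d := by exact_mod_cast (mem_Icc.1 hd).1
    have he0 : (0 : ℝ) < e := by exact_mod_cast (mem_Icc.1 he).1
    have hexp : ∀ y : ℝ, 0 < y → y ^ (-(1 + α - ε / 2)) = y ^ (ε / 2 - α) / y := by
      intro y hy
      rw [← Real.rpow_sub_one hy.ne']
      congr 1
      ring
    calc _ ≤ (C₀ * C₁ * (Q : ℝ) ^ α * (d : ℝ) ^ (ε / 2 - α)) *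
          (C₀ * C₁ * (Q : ℝ) ^ α * (e : ℝ) ^ (ε / 2 - α)) * ((Nat.gcd d e : ℝ) ^ 2 / (d * e)) := by
          have := hw d hd
          have := hw e he
          gcongr
      _ = _ := by
          rw [hexp d hd0, hexp e he0]
          field_simp
  have h4 : (1 : ℝ) ≤ (Q : ℝ) ^ α := Real.one_le_rpow (by exact_mod_cast hQ) (by linarith)
  have h5 : (C₀ * C₁ * (Q : ℝ) ^ α) ^ 2 * B / (Q : ℝ) ^ α = (C₀ * C₁) ^ 2 * B * (Q : ℝ) ^ α := by
    field_simp
  have h6 := (div_le_div_of_nonneg_right h3 (by positivity : 0 ≤ (Q : ℝ) ^ α)).trans_eq h5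
  simp only [sawtooth] at h2
  linarith

end

/-! ### Holomorphic logarithms and interpolation in vertical strips. -/

section

open Complex Set

/-- A nonvanishing holomorphic function on a disc has a holomorphic logarithm. -/
lemma exists_exp_eq_on_ball {F : ℂ → ℂ} {c : ℂ} {r : ℝ} (hr : 0 < r)
    (hF : DifferentiableOn ℂ F (Metric.ball c r)) (h0 : ∀ z ∈ Metric.ball c r, F z ≠ 0) :
    ∃ g : ℂ → ℂ, DifferentiableOn ℂ g (Metric.ball c r) ∧
      ∀ z ∈ Metric.ball c r, Complex.exp (g z) = F z := by
  have hopen : IsOpen (Metric.ball c r) := Metric.isOpen_ball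
  have hd : DifferentiableOn ℂ (fun z => deriv F z / F z) (Metric.ball c r) :=
    (hF.deriv hopen).div hF h0
  -- A primitive `P` of `F' / F` is a logarithm of `F` up to a constant, as `F * exp (-P)` has
  -- derivative zero.
  obtain ⟨P, hP⟩ := hd.isExactOn_ball
  have hPd : DifferentiableOn ℂ P (Metric.ball c r) := fun z hz =>
    (hP z hz).differentiableAt.differentiableWithinAt
  have hquot : ∀ z ∈ Metric.ball c r, HasDerivAt (fun w => F w * Complex.exp (-P w)) 0 z := by
    intro z hz
    have h1 := (hF.differentiableAt (hopen.mem_nhds hz)).hasDerivAt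
    have h2 : HasDerivAt (fun w => Complex.exp (-P w))
        (Complex.exp (-P z) * -(deriv F z / F z)) z := (hP z hz).neg.cexp
    have h3 : deriv F z * Complex.exp (-P z) + F z * (Complex.exp (-P z) * -(deriv F z / F z)) =
        0 := by
      have := h0 z hz
      field_simp
      ring
    exact h3 ▸ h1.mul h2
  obtain ⟨a, ha⟩ := hopen.exists_is_const_of_deriv_eq_zero
    (convex_ball c r).isPreconnected
    (fun z hz => (hquot z hz).differentiableAt.differentiableWithinAt)
    (fun z hz => (hquot z hz).deriv)
  have hc : c ∈ Metric.ball c r := Metric.mem_ball_self hr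
  have ha0 : a ≠ 0 := by
    rw [← ha c hc]
    exact mul_ne_zero (h0 c hc) (Complex.exp_ne_zero _)
  refine ⟨fun z => P z + Complex.log a, hPd.add_const _, fun z hz => ?_⟩
  rw [Complex.exp_add, Complex.exp_log ha0, ← ha z hz, Complex.exp_neg]
  field_simp [Complex.exp_ne_zero (P z)]

/-- A nonvanishing holomorphic function on a right half-plane has a holomorphic logarithm. -/
lemma exists_exp_eq_on_halfPlane {F : ℂ → ℂ} {a : ℝ}
    (hF : DifferentiableOn ℂ F {s | a < s.re}) (h0 : ∀ s : ℂ, a < s.re → F s ≠ 0) :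
    ∃ g : ℂ → ℂ, DifferentiableOn ℂ g {s | a < s.re} ∧
      ∀ s : ℂ, a < s.re → Complex.exp (g s) = F s := by
  -- The Cayley map `w ↦ a + (1 + w) / (1 - w)` and its inverse transport the result from the unit
  -- disc to the half-plane.
  have hφ : ∀ w ∈ Metric.ball (0 : ℂ) 1, w ≠ 1 ∧ a < ((a : ℂ) + (1 + w) / (1 - w)).re := by
    intro w hw
    rw [mem_ball_zero_iff] at hw
    have hw1 : w ≠ 1 := by rintro rfl; simp at hw
    refine ⟨hw1, ?_⟩
    have h1 : 0 < ((1 + w) / (1 - w)).re := by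
      rw [Complex.div_re, ← add_div]
      have hn : 0 < normSq (1 - w) := normSq_pos.2 (sub_ne_zero.2 hw1.symm)
      refine div_pos ?_ hn
      have h2 : normSq w < 1 := by
        rw [normSq_eq_norm_sq]
        exact pow_lt_one₀ (norm_nonneg _) hw two_ne_zero
      rw [normSq_apply] at h2
      simp
      nlinarith
    simpa using h1
  have hψ : ∀ s : ℂ, a < s.re → s - a + 1 ≠ 0 ∧ (s - a - 1) / (s - a + 1) ∈ Metric.ball (0 : ℂ) 1 := by
    intro s hs
    have h1 : s - a + 1 ≠ 0 := by
      intro h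
      have := congrArg re h
      simp at this
      linarith
    refine ⟨h1, ?_⟩
    rw [mem_ball_zero_iff, norm_div, div_lt_one (norm_pos_iff.2 h1)]
    rw [← sq_lt_sq₀ (norm_nonneg _) (norm_nonneg _), ← normSq_eq_norm_sq, ← normSq_eq_norm_sq,
      normSq_apply, normSq_apply]
    simp
    nlinarith
  obtain ⟨P, hPd, hP⟩ := exists_exp_eq_on_ball (F := fun w => F (a + (1 + w) / (1 - w)))
    (c := 0) (r := 1) one_pos
    (by
      refine hF.comp (t := {s | a < s.re}) (f := fun w : ℂ => (a : ℂ) + (1 + w) / (1 - w)) ?_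
        fun w hw => (hφ w hw).2
      intro w hw
      have : 1 - w ≠ 0 := sub_ne_zero.2 (hφ w hw).1.symm
      exact (DifferentiableAt.const_add _ (DifferentiableAt.div (by fun_prop) (by fun_prop)
        this)).differentiableWithinAt)
    (fun w hw => h0 _ (hφ w hw).2)
  refine ⟨fun s => P ((s - a - 1) / (s - a + 1)), ?_, fun s hs => ?_⟩
  · refine hPd.comp (f := fun s : ℂ => (s - a - 1) / (s - a + 1)) ?_ fun s hs => (hψ s hs).2
    intro s hs
    have h : DifferentiableAt ℂ (fun s : ℂ => (s - a - 1) / (s - a + 1)) s :=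
      DifferentiableAt.div (by fun_prop) (by fun_prop) (hψ s hs).1
    exact h.differentiableWithinAt
  · rw [hP _ (hψ s hs).2]
    congr 1
    have h1 := (hψ s hs).1
    have h2 : 1 - (s - a - 1) / (s - a + 1) ≠ 0 := sub_ne_zero.2 (hφ _ (hψ s hs).2).1.symm
    field_simp
    ring

lemma one_add_abs_mul_exp_neg_sq_le (y : ℝ) : (1 + |y|) * Real.exp (-y ^ 2) ≤ 2 := by
  have h1 := Real.add_one_le_exp (y ^ 2)
  have h2 : 1 + |y| ≤ 2 * Real.exp (y ^ 2) := by
    nlinarith [sq_nonneg (|y| - 1), sq_abs y, sq_nonneg y]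
  rw [Real.exp_neg, ← div_eq_mul_inv, div_le_iff₀ (Real.exp_pos _)]
  exact h2

/-- An interpolation inequality for functions of linear growth on a vertical strip. -/
lemma norm_le_of_linear_growth {g : ℂ → ℂ} {l u A B T : ℝ} (hl : 0 ≤ l) (hlu : l < u) (hu : u ≤ 2)
    (hA : 0 ≤ A) (hB : 0 ≤ B)
    (hg : DifferentiableOn ℂ g {s | 0 < s.re}) (hl0 : 0 < l)
    (hgA : ∀ s : ℂ, l ≤ s.re → s.re ≤ u → ‖g s‖ ≤ A * (1 + |s.im - T|))
    (hgB : ∀ s : ℂ, s.re = u → ‖g s‖ ≤ B * (1 + |s.im - T|)) {σ : ℝ} (h1 : l ≤ σ) (h2 : σ ≤ u) :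
    ‖g (σ + T * I)‖ ≤ (2 * Real.exp 4 * A) ^ (1 - (σ - l) / (u - l)) *
      (2 * Real.exp 4 * B) ^ ((σ - l) / (u - l)) := by
  -- The Gaussian factor `exp (z ^ 2)` beats linear growth and makes the three lines theorem
  -- applicable. It costs at most `exp 4` as `Re z ≤ 2`, and its modulus at the real point `σ` is at
  -- least `1`, so it can be dropped at the end.
  set f : ℂ → ℂ := fun z => g (z + T * I) * Complex.exp (z ^ 2) with hf
  have hexp : ∀ z : ℂ, l ≤ z.re → z.re ≤ u →
      ‖Complex.exp (z ^ 2)‖ ≤ Real.exp 4 * Real.exp (-z.im ^ 2) := by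
    intro z hz1 hz2
    rw [Complex.norm_exp, ← Real.exp_add]
    refine Real.exp_le_exp.2 ?_
    rw [sq, mul_re]
    nlinarith
  have key : ∀ (D : ℝ) (z : ℂ), 0 ≤ D → l ≤ z.re → z.re ≤ u →
      ‖g (z + T * I)‖ ≤ D * (1 + |(z + T * I).im - T|) → ‖f z‖ ≤ 2 * Real.exp 4 * D := by
    intro D z hD hz1 hz2 hgz
    have him : (z + T * I).im - T = z.im := by simp
    rw [him] at hgz
    calc ‖f z‖ = ‖g (z + T * I)‖ * ‖Complex.exp (z ^ 2)‖ := norm_mul _ _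
      _ ≤ (D * (1 + |z.im|)) * (Real.exp 4 * Real.exp (-z.im ^ 2)) :=
          mul_le_mul hgz (hexp z hz1 hz2) (norm_nonneg _) (by positivity)
      _ = Real.exp 4 * D * ((1 + |z.im|) * Real.exp (-z.im ^ 2)) := by ring
      _ ≤ Real.exp 4 * D * 2 := by
          gcongr
          exact one_add_abs_mul_exp_neg_sq_le _
      _ = _ := by ring
  have hre : ∀ z : ℂ, (z + T * I).re = z.re := fun z => by simp
  have hdiff : DifferentiableOn ℂ f {s | 0 < s.re} := by
    refine DifferentiableOn.mul ?_ (by fun_prop)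
    exact hg.comp (f := fun z : ℂ => z + T * I) (by fun_prop) fun z hz => by
      rw [mem_ofPred_eq, hre]
      exact hz
  have h := HadamardThreeLines.norm_le_interp_of_mem_verticalClosedStrip' (f := f) (z := (σ : ℂ))
    (a := 2 * Real.exp 4 * A) (b := 2 * Real.exp 4 * B) hlu ?_ ?_ ?_ ?_ ?_
  · rw [ofReal_re] at h
    refine le_trans ?_ h
    rw [hf]
    simp only
    rw [norm_mul, Complex.norm_exp]
    refine le_mul_of_one_le_right (norm_nonneg _) (Real.one_le_exp ?_)
    rw [← ofReal_pow, ofReal_re]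
    positivity
  · exact ⟨by simpa using h1, by simpa using h2⟩
  · refine DifferentiableOn.diffContOnCl (hdiff.mono ?_)
    have hsub : closure (HadamardThreeLines.verticalStrip l u) ⊆
        HadamardThreeLines.verticalClosedStrip l u := by
      refine closure_minimal ?_ (isClosed_Icc.preimage continuous_re)
      exact preimage_mono Ioo_subset_Icc_self
    exact hsub.trans fun z hz => hl0.trans_le hz.1
  · refine ⟨2 * Real.exp 4 * A, ?_⟩
    rintro _ ⟨z, hz, rfl⟩
    exact key A z hA hz.1 hz.2 (hgA _ (by rw [hre]; exact hz.1) (by rw [hre]; exact hz.2))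
  · intro z hz
    have hz' : z.re = l := hz
    exact key A z hA hz'.ge (hz'.le.trans hlu.le) (hgA _ (by rw [hre, hz']) (by
      rw [hre, hz']
      exact hlu.le))
  · intro z hz
    have hz' : z.re = u := hz
    exact key B z hB (hlu.le.trans hz'.ge) hz'.le (hgB _ (by rw [hre, hz']))

end

/-! ### Littlewood's bound for the reciprocal of a zero-free function. -/

section

open Complex Set

/-- Subpolynomial growth of `exp (D (1 + log y) ^ β)` for `β < 1`. -/
lemma exists_exp_rpow_log_le {D β ε : ℝ} (hD : 0 ≤ D) (hβ : β < 1) (hε : 0 < ε) :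
    ∃ C : ℝ, 0 ≤ C ∧ ∀ y : ℝ, 2 ≤ y → Real.exp (D * (1 + Real.log y) ^ β) ≤ C * y ^ ε := by
  -- Beyond `X` the term `D * x ^ β` is at most `ε * x`; below, it is bounded by a constant. The
  -- claim is this with `x = 1 + log y`.
  obtain ⟨X, hX⟩ : ∃ X : ℝ, ∀ x : ℝ, X ≤ x → D / ε ≤ x ^ (1 - β) :=
    Filter.eventually_atTop.1
      ((tendsto_rpow_atTop (by linarith : 0 < 1 - β)).eventually_ge_atTop (D / ε))
  set X₁ := max X 1 with hX₁
  have hX1 : 1 ≤ X₁ := le_max_right _ _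
  have key : ∀ x : ℝ, 1 ≤ x → D * x ^ β ≤ ε * x + D * X₁ ^ |β| := by
    intro x hx
    have hx0 : 0 < x := by linarith
    rcases le_total X₁ x with h | h
    · have h1 := hX x ((le_max_left _ _).trans h)
      rw [div_le_iff₀ hε] at h1
      have h2 : x = x ^ (1 - β) * x ^ β := by
        rw [← Real.rpow_add hx0]
        simp
      have h3 : D * x ^ β ≤ x ^ (1 - β) * ε * x ^ β := by gcongr
      have h4 : x ^ (1 - β) * ε * x ^ β = ε * x := by
        conv_rhs => rw [h2]
        ring
      have h5 : 0 ≤ D * X₁ ^ |β| := by positivity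
      linarith
    · have h1 : x ^ β ≤ X₁ ^ |β| :=
        (Real.rpow_le_rpow_of_exponent_le hx (le_abs_self β)).trans
          (Real.rpow_le_rpow hx0.le h (abs_nonneg _))
      have h2 : D * x ^ β ≤ D * X₁ ^ |β| := by gcongr
      have : 0 ≤ ε * x := by positivity
      linarith
  refine ⟨Real.exp (ε + D * X₁ ^ |β|), (Real.exp_pos _).le, fun y hy => ?_⟩
  have hy0 : 0 < y := by linarith
  have hlog : 0 ≤ Real.log y := Real.log_nonneg (by linarith)
  rw [Real.rpow_def_of_pos hy0, ← Real.exp_add]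
  refine Real.exp_le_exp.2 ((key (1 + Real.log y) (by linarith)).trans (le_of_eq ?_))
  ring

/-- Recentring a logarithmic bound at height `T` costs only `|t - T|`, the linear growth that
`norm_le_of_linear_growth` tolerates. -/
lemma log_two_add_abs_le (t T : ℝ) :
    Real.log (2 + |t|) ≤ Real.log (2 + |T|) + |t - T| := by
  have h1 : 2 + |t| ≤ (2 + |T|) * (1 + |t - T|) := by
    have : |t| ≤ |T| + |t - T| := by
      have := abs_add_le T (t - T)
      simpa using this
    nlinarith [abs_nonneg T, abs_nonneg (t - T)]
  have h2 : Real.log (1 + |t - T|) ≤ |t - T| := by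
    have := Real.log_le_sub_one_of_pos (by positivity : 0 < 1 + |t - T|)
    linarith
  calc Real.log (2 + |t|) ≤ Real.log ((2 + |T|) * (1 + |t - T|)) :=
        Real.log_le_log (by positivity) h1
    _ = Real.log (2 + |T|) + Real.log (1 + |t - T|) := Real.log_mul (by positivity) (by positivity)
    _ ≤ _ := by linarith

/-- The Borel–Carathéodory bound for a logarithm `g` of a function of linear growth. -/
lemma norm_log_le_of_linear_growth {g : ℂ → ℂ} {A δ σ t : ℝ} (hA : 1 ≤ A)
    (hg : DifferentiableOn ℂ g {s | 1 / 2 < s.re})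
    (hre : ∀ s : ℂ, 1 / 2 < s.re → (g s).re ≤ Real.log (A * (1 + ‖s‖)))
    (hδ : 0 < δ) (h1 : 1 / 2 + δ ≤ σ) (h2 : σ ≤ 2) :
    ‖g (σ + t * I)‖ ≤ 6 / δ * (Real.log (3 * A) + Real.log (2 + |t|) + ‖g (2 + t * I)‖) := by
  set M := Real.log (3 * A) + Real.log (2 + |t|) with hM
  have hM0 : 0 < M := add_pos_of_nonneg_of_pos (Real.log_nonneg (by linarith))
    (Real.log_pos (by linarith [abs_nonneg t]))
  have hball : ∀ z ∈ Metric.ball (0 : ℂ) (3 / 2 : ℝ), 1 / 2 < (z + (2 + t * I)).re := by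
    intro z hz
    rw [mem_ball_zero_iff] at hz
    have := (abs_le.1 ((abs_re_le_norm z).trans hz.le))
    have h3 := abs_lt.1 ((abs_re_le_norm z).trans_lt hz)
    simp
    linarith
  -- The disc of radius `3 / 2` about `2 + i t` reaches the line `Re s = 1 / 2`, while `σ + i t`
  -- stays at distance at least `δ` from its boundary; hence the loss `1 / δ`.
  have h := borelCaratheodory (f := fun z => g (z + (2 + t * I))) (M := M) (R := 3 / 2)
    (z := ((σ - 2 : ℝ) : ℂ)) hM0 ?_ ?_ (by norm_num) ?_
  · have hz : ‖((σ - 2 : ℝ) : ℂ)‖ = 2 - σ := by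
      rw [norm_real, Real.norm_eq_abs, abs_of_nonpos (by linarith)]
      ring
    have e1 : ((σ - 2 : ℝ) : ℂ) + (2 + t * I) = σ + t * I := by
      push_cast
      ring
    simp only [hz, e1, zero_add] at h
    have hden : δ ≤ 3 / 2 - (2 - σ) := by linarith
    have hr : 0 < 3 / 2 - (2 - σ) := by linarith
    have hσ : 2 - σ ≤ 3 / 2 := by linarith
    refine h.trans ?_
    rw [← add_div, div_le_iff₀ hr]
    have hn := norm_nonneg (g (2 + t * I))
    have h3 : 2 * M * (2 - σ) + ‖g (2 + t * I)‖ * (3 / 2 + (2 - σ)) ≤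
        6 * (M + ‖g (2 + t * I)‖) := by nlinarith
    have h4 : 6 * (M + ‖g (2 + t * I)‖) ≤
        6 / δ * (M + ‖g (2 + t * I)‖) * (3 / 2 - (2 - σ)) := by
      calc 6 * (M + ‖g (2 + t * I)‖) = 6 / δ * (M + ‖g (2 + t * I)‖) * δ := by field_simp
        _ ≤ _ := by gcongr
    exact h3.trans h4
  · exact hg.comp (f := fun z : ℂ => z + (2 + t * I)) (by fun_prop) hball
  · intro z hz
    rw [mem_ofPred_eq]
    refine (hre _ (hball z hz)).trans ?_
    rw [mem_ball_zero_iff] at hz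
    rw [hM, ← Real.log_mul (by positivity) (by positivity)]
    refine Real.log_le_log (by positivity) ?_
    have h3 : ‖z + (2 + t * I)‖ ≤ 3 / 2 + (2 + |t|) := by
      refine (norm_add_le _ _).trans (add_le_add hz.le ((norm_add_le _ _).trans ?_))
      simp
    calc A * (1 + ‖z + (2 + t * I)‖) ≤ A * (1 + (3 / 2 + (2 + |t|))) := by gcongr
      _ ≤ 3 * A * (2 + |t|) := by nlinarith [abs_nonneg t]
  · rw [mem_ball_zero_iff, norm_real, Real.norm_eq_abs, abs_of_nonpos (by linarith)]
    linarith

/-- Littlewood's bound: a nonvanishing holomorphic function on `Re s > 1 / 2` of at most linear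
growth, with bounded logarithmic derivative to the right of `1`, has a reciprocal of
subpolynomial growth. -/
theorem exists_norm_inv_le_rpow {F : ℂ → ℂ} (hF : DifferentiableOn ℂ F {s | 1 / 2 < s.re})
    (h0 : ∀ s : ℂ, 1 / 2 < s.re → F s ≠ 0)
    (hgrowth : ∃ A : ℝ, ∀ s : ℂ, 1 / 2 < s.re → ‖F s‖ ≤ A * (1 + ‖s‖))
    (hder : ∀ δ : ℝ, 0 < δ → ∃ K : ℝ, ∀ s : ℂ, 1 + δ ≤ s.re → ‖deriv F s / F s‖ ≤ K)
    (htwo : ∃ K : ℝ, ∀ t : ℝ, |Real.log ‖F (2 + t * I)‖| ≤ K)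
    {δ ε : ℝ} (hδ : 0 < δ) (hδ2 : δ < 1 / 4) (hε : 0 < ε) :
    ∃ C : ℝ, 0 ≤ C ∧ ∀ σ t : ℝ, 1 / 2 + 2 * δ ≤ σ → σ ≤ 2 →
      ‖(F (σ + t * I))⁻¹‖ ≤ C * (2 + |t|) ^ ε := by
  obtain ⟨A₀, hA₀⟩ := hgrowth
  set A := max A₀ 1 with hA
  have hA1 : 1 ≤ A := le_max_right _ _
  have hFA : ∀ s : ℂ, 1 / 2 < s.re → ‖F s‖ ≤ A * (1 + ‖s‖) := fun s hs =>
    (hA₀ s hs).trans (by gcongr; exact le_max_left _ _)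
  obtain ⟨K₁, hK₁⟩ := hder δ hδ
  obtain ⟨K₂, hK₂⟩ := htwo
  have hK₁0 : 0 ≤ K₁ := (norm_nonneg _).trans (hK₁ ((1 + δ : ℝ) : ℂ) (by simp))
  have hK₂0 : 0 ≤ K₂ := (abs_nonneg _).trans (hK₂ 0)
  -- It is enough to bound a logarithm of `F`. It is `O(log T)` near the line `1 / 2` and `O(1)` to
  -- the right of `1`; interpolation gives `O((log T) ^ (1 - 2 δ))`, whose exponential grows slower
  -- than any power.
  obtain ⟨g, hgd, hg⟩ := exists_exp_eq_on_halfPlane hF h0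
  have hopen : IsOpen {s : ℂ | 1 / 2 < s.re} := isOpen_lt continuous_const continuous_re
  have hgderiv : ∀ s : ℂ, 1 / 2 < s.re → deriv g s = deriv F s / F s := by
    intro s hs
    have h1 := (hgd.differentiableAt (hopen.mem_nhds hs)).hasDerivAt.cexp
    have h2 : (fun s => Complex.exp (g s)) =ᶠ[nhds s] F := by
      filter_upwards [hopen.mem_nhds hs] with z hz using hg z hz
    rw [← h2.deriv_eq, h1.deriv, ← hg s hs]
    field_simp [Complex.exp_ne_zero (g s)]
  set K := K₂ + Real.pi + 2 * K₁ with hK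
  have hK0 : 0 ≤ K := by have := Real.pi_pos; positivity
  set B := 6 / δ * (Real.log (3 * A) + K + 1) with hB
  have hlogA : 0 ≤ Real.log (3 * A) := Real.log_nonneg (by linarith)
  have hB0 : 0 ≤ B := by positivity
  set D := max (2 * Real.exp 4 * B) (max (2 * Real.exp 4 * K) 1) with hD
  have hD1 : 1 ≤ D := (le_max_right _ _).trans (le_max_right _ _)
  have hDB : 2 * Real.exp 4 * B ≤ D := le_max_left _ _
  have hDK : 2 * Real.exp 4 * K ≤ D := (le_max_left _ _).trans (le_max_right _ _)
  have hDK' : K ≤ D := by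
    refine le_trans (le_mul_of_one_le_left hK0 ?_) hDK
    have := Real.one_le_exp (by norm_num : (0 : ℝ) ≤ 4)
    linarith
  obtain ⟨C, hC0, hC⟩ := exists_exp_rpow_log_le (D := D) (β := 1 - 2 * δ) (ε := ε) (by linarith)
    (by linarith) hε
  refine ⟨C, hC0, fun σ T h1 h2 => ?_⟩
  -- the branch of the logarithm normalised at `2 + i T`
  have h2T : (1 / 2 : ℝ) < (2 + T * I : ℂ).re := by simp; norm_num
  obtain ⟨n, hn⟩ : ∃ n : ℤ, g (2 + T * I) =
      Complex.log (F (2 + T * I)) + n * (2 * Real.pi * I) := by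
    rw [← Complex.exp_eq_exp_iff_exists_int, hg _ h2T, Complex.exp_log (h0 _ h2T)]
  set G : ℂ → ℂ := fun s => g s - n * (2 * Real.pi * I) with hG
  have hGd : DifferentiableOn ℂ G {s | 1 / 2 < s.re} := hgd.sub_const _
  have hGF : ∀ s : ℂ, 1 / 2 < s.re → Complex.exp (G s) = F s := by
    intro s hs
    rw [hG]
    simp only
    rw [Complex.exp_sub, Complex.exp_int_mul_two_pi_mul_I, div_one, hg s hs]
  have hGderiv : ∀ s : ℂ, 1 / 2 < s.re → deriv G s = deriv F s / F s := by
    intro s hs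
    rw [hG, deriv_sub_const, hgderiv s hs]
  have hGre : ∀ s : ℂ, 1 / 2 < s.re → (G s).re = Real.log ‖F s‖ := by
    intro s hs
    rw [← hGF s hs, Complex.norm_exp, Real.log_exp]
  have hG2 : ‖G (2 + T * I)‖ ≤ K₂ + Real.pi := by
    have : G (2 + T * I) = Complex.log (F (2 + T * I)) := by
      rw [hG]
      simp only
      rw [hn]
      ring
    rw [this]
    refine (Complex.norm_le_abs_re_add_abs_im _).trans (add_le_add ?_ ?_)
    · rw [Complex.log_re]
      exact hK₂ T
    · rw [Complex.log_im]
      exact Complex.abs_arg_le_pi _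
  -- Integrating the bounded logarithmic derivative from `2 + i T`, where the chosen branch is
  -- bounded independently of `T`.
  have hright : ∀ s : ℂ, 1 + δ ≤ s.re → s.re ≤ 2 → ‖G s‖ ≤ K * (1 + |s.im - T|) := by
    intro s hs hs2
    have hconv : Convex ℝ {s : ℂ | 1 + δ ≤ s.re} := convex_halfSpace_re_ge _
    have h3 := hconv.norm_image_sub_le_of_norm_deriv_le (𝕜 := ℂ) (f := G) (C := K₁)
      (x := 2 + T * I) (y := s)
      (fun z hz => hGd.differentiableAt (hopen.mem_nhds (by
        rw [mem_ofPred_eq] at hz ⊢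
        linarith)))
      (fun z hz => by
        rw [mem_ofPred_eq] at hz
        rw [hGderiv z (by linarith)]
        exact hK₁ z hz) (by simp; linarith) hs
    have h4 : ‖s - (2 + T * I)‖ ≤ 1 + |s.im - T| := by
      refine (Complex.norm_le_abs_re_add_abs_im _).trans ?_
      have e1 : (s - (2 + T * I)).re = s.re - 2 := by simp
      have e2 : (s - (2 + T * I)).im = s.im - T := by simp
      rw [e1, e2]
      gcongr
      rw [abs_le]
      constructor <;> linarith
    have h5 : ‖G s‖ ≤ ‖G (2 + T * I)‖ + ‖G s - G (2 + T * I)‖ := by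
      have := norm_add_le (G (2 + T * I)) (G s - G (2 + T * I))
      simpa using this
    have h6 : K₁ * ‖s - (2 + T * I)‖ ≤ K₁ * (1 + |s.im - T|) := by gcongr
    have h7 := abs_nonneg (s.im - T)
    have h8 := Real.pi_pos
    rw [hK]
    nlinarith
  set Λ := 1 + Real.log (2 + |T|) with hΛ
  have hlogT : 0 ≤ Real.log (2 + |T|) := Real.log_nonneg (by linarith [abs_nonneg T])
  have hΛ1 : 1 ≤ Λ := by linarith
  have hleft : ∀ s : ℂ, 1 / 2 + δ ≤ s.re → s.re ≤ 2 → ‖G s‖ ≤ B * Λ * (1 + |s.im - T|) := by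
    intro s hs hs2
    have h3 := norm_log_le_of_linear_growth (g := G) (t := s.im) hA1 hGd
      (fun s hs => by
        rw [hGre s hs]
        exact Real.log_le_log (norm_pos_iff.2 (h0 s hs)) (hFA s hs)) hδ hs hs2
    rw [Complex.re_add_im] at h3
    have h4 := hright (2 + s.im * I) (by simp; linarith) (by simp)
    have e2 : (2 + s.im * I : ℂ).im = s.im := by simp
    rw [e2] at h4
    have h5 := log_two_add_abs_le s.im T
    refine h3.trans ?_
    rw [hB, mul_assoc, mul_assoc]
    gcongr
    have h6 := abs_nonneg (s.im - T)
    have h7 : 1 * (1 + |s.im - T|) ≤ Λ * (1 + |s.im - T|) := by gcongr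
    have h8 : (Real.log (3 * A) + K) * (1 * (1 + |s.im - T|)) ≤
        (Real.log (3 * A) + K) * (Λ * (1 + |s.im - T|)) := by gcongr
    have h9 : Real.log (2 + |T|) + |s.im - T| ≤ Λ * (1 + |s.im - T|) := by nlinarith
    nlinarith
  have hbound : ‖G (σ + T * I)‖ ≤ D * Λ ^ (1 - 2 * δ) := by
    have hΛpow : 1 ≤ Λ ^ (1 - 2 * δ) := Real.one_le_rpow hΛ1 (by linarith)
    rcases le_total (1 + δ) σ with hσ | hσ
    · have h3 := hright (σ + T * I) (by simpa using hσ) (by simpa using h2)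
      simp at h3
      calc _ ≤ K := h3
        _ ≤ D * 1 := by linarith
        _ ≤ _ := by gcongr
    -- Three lines between `1 / 2 + δ` and `1 + δ`, translated by `1 / 2` to fit the half-plane `Re
    -- s > 0`. The strip has width `1 / 2`, so `σ ≥ 1 / 2 + 2 δ` yields `θ ≥ 2 δ`, the saving in the
    -- exponent of `Λ`.
    · have h3 := norm_le_of_linear_growth (g := fun s => G (s + ((1 / 2 : ℝ) : ℂ)))
        (l := δ) (u := 1 / 2 + δ) (A := B * Λ) (B := K) (T := T) (σ := σ - 1 / 2)
        hδ.le (by linarith) (by linarith) (by positivity) hK0 ?_ hδ ?_ ?_ (by linarith)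
        (by linarith)
      · have e1 : ((σ - 1 / 2 : ℝ) : ℂ) + T * I + ((1 / 2 : ℝ) : ℂ) = σ + T * I := by
          push_cast
          ring
        simp only [e1] at h3
        set θ := (σ - 1 / 2 - δ) / (1 / 2 + δ - δ) with hθ
        have hθ' : θ = 2 * (σ - 1 / 2 - δ) := by
          rw [hθ]
          ring
        have hθ0 : 0 ≤ θ := by rw [hθ']; linarith
        have hθ1 : θ ≤ 1 := by rw [hθ']; linarith
        have hθ2 : 2 * δ ≤ θ := by rw [hθ']; linarith
        have hΛ0 : 0 ≤ Λ := by linarith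
        have hD0 : 0 < D := by linarith
        calc _ ≤ _ := h3
          _ ≤ (D * Λ) ^ (1 - θ) * D ^ θ := by
            have e2 : 2 * Real.exp 4 * (B * Λ) ≤ D * Λ := by
              rw [← mul_assoc]
              gcongr
            gcongr
          _ = D * Λ ^ (1 - θ) := by
            rw [Real.mul_rpow hD0.le hΛ0, mul_right_comm, ← Real.rpow_add hD0]
            simp
          _ ≤ D * Λ ^ (1 - 2 * δ) := by
            gcongr
      · refine hGd.comp (f := fun s : ℂ => s + ((1 / 2 : ℝ) : ℂ)) (by fun_prop) fun s hs => ?_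
        rw [mem_ofPred_eq] at hs ⊢
        rw [add_re, ofReal_re]
        linarith
      · intro s hs1 hs2
        have := hleft (s + ((1 / 2 : ℝ) : ℂ)) (by rw [add_re, ofReal_re]; linarith)
          (by rw [add_re, ofReal_re]; linarith)
        simpa using this
      · intro s hs
        have := hright (s + ((1 / 2 : ℝ) : ℂ)) (by rw [add_re, ofReal_re]; linarith)
          (by rw [add_re, ofReal_re]; linarith)
        simpa using this
  have hσ0 : (1 / 2 : ℝ) < (σ + T * I : ℂ).re := by
    simp
    linarith
  rw [← hGF _ hσ0, ← Complex.exp_neg, Complex.norm_exp]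
  refine le_trans (Real.exp_le_exp.2 ?_) (hC (2 + |T|) (by linarith [abs_nonneg T]))
  rw [neg_re]
  exact (neg_le_abs _).trans ((abs_re_le_norm _).trans hbound)

end

/-! ### Abel summation and the continuation of `L(s, χ)` to `Re s > 0`. -/

section

open Complex Set MeasureTheory Filter Topology

/-- The integral `∫_1^∞ f(t) t^{-s-1} dt` attached to a summatory function. -/
noncomputable def tailMellin (f : ℝ → ℂ) (s : ℂ) : ℂ :=
  ∫ t in Ioi (1 : ℝ), f t * (t : ℂ) ^ (-(s + 1))

lemma integrableOn_rpow_tail {α σ : ℝ} (h : α < σ) (C : ℝ) :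
    IntegrableOn (fun t : ℝ => C * t ^ (α - σ - 1)) (Ioi 1) :=
  (integrableOn_Ioi_rpow_of_lt (by linarith) one_pos).const_mul C

lemma norm_mul_cpow_tail_le {f : ℝ → ℂ} {α C : ℝ} (hC : ∀ t : ℝ, 1 < t → ‖f t‖ ≤ C * t ^ α)
    (s : ℂ) {t : ℝ} (ht : 1 < t) :
    ‖f t * (t : ℂ) ^ (-(s + 1))‖ ≤ C * t ^ (α - s.re - 1) := by
  have ht0 : 0 < t := by linarith
  rw [norm_mul, Complex.norm_cpow_eq_rpow_re_of_pos ht0]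
  have e : t ^ (α - s.re - 1) = t ^ α * t ^ (-(s + 1)).re := by
    rw [← Real.rpow_add ht0]
    congr 1
    simp
    ring
  rw [e, ← mul_assoc]
  gcongr
  exact hC t ht

lemma integrableOn_tailMellin {f : ℝ → ℂ} (hf : Measurable f) {α C : ℝ}
    (hC : ∀ t : ℝ, 1 < t → ‖f t‖ ≤ C * t ^ α) {s : ℂ} (hs : α < s.re) :
    IntegrableOn (fun t : ℝ => f t * (t : ℂ) ^ (-(s + 1))) (Ioi 1) := by
  refine Integrable.mono' (integrableOn_rpow_tail hs C) ?_ ?_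
  · exact (hf.mul (by fun_prop)).aestronglyMeasurable
  · exact (ae_restrict_iff' measurableSet_Ioi).2
      (ae_of_all _ fun t ht => norm_mul_cpow_tail_le hC s ht)

lemma norm_tailMellin_le {f : ℝ → ℂ} {α C : ℝ}
    (hC : ∀ t : ℝ, 1 < t → ‖f t‖ ≤ C * t ^ α) {s : ℂ} (hs : α < s.re) :
    ‖tailMellin f s‖ ≤ C / (s.re - α) := by
  have h1 : ∫ t in Ioi (1 : ℝ), C * t ^ (α - s.re - 1) = C / (s.re - α) := by
    rw [integral_const_mul, integral_Ioi_rpow_of_lt (by linarith) one_pos]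
    have : α - s.re ≠ 0 := by linarith
    have : s.re - α ≠ 0 := by linarith
    rw [Real.one_rpow, sub_add_cancel]
    rw [show s.re - α = -(α - s.re) by ring]
    field_simp
  rw [← h1]
  refine norm_integral_le_of_norm_le (integrableOn_rpow_tail hs C) ?_
  exact (ae_restrict_iff' measurableSet_Ioi).2
      (ae_of_all _ fun t ht => norm_mul_cpow_tail_le hC s ht)

/-- This is a Mellin transform at `-s` of `f` cut off below `1`; the cut-off function vanishes near
`0`, so only its growth at infinity restricts `s`. -/
lemma differentiableAt_tailMellin {f : ℝ → ℂ} (hf : Measurable f) {α C : ℝ}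
    (hC : ∀ t : ℝ, 1 < t → ‖f t‖ ≤ C * t ^ α) {s : ℂ} (hs : α < s.re) :
    DifferentiableAt ℂ (tailMellin f) s := by
  have heq : tailMellin f = fun s => mellin ((Ioi (1 : ℝ)).indicator f) (-s) := by
    ext s
    rw [tailMellin, mellin]
    have : ∀ t : ℝ, (t : ℂ) ^ (-s - 1) • (Ioi (1 : ℝ)).indicator f t =
        (Ioi (1 : ℝ)).indicator (fun t : ℝ => f t * (t : ℂ) ^ (-(s + 1))) t := by
      intro t
      by_cases ht : t ∈ Ioi (1 : ℝ)
      · rw [indicator_of_mem ht, indicator_of_mem ht, smul_eq_mul, mul_comm]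
        congr 2
        ring
      · rw [indicator_of_notMem ht, indicator_of_notMem ht, smul_zero]
    simp only [this]
    rw [setIntegral_indicator measurableSet_Ioi,
      inter_eq_self_of_subset_right (Ioi_subset_Ioi zero_le_one)]
  rw [heq]
  refine DifferentiableAt.comp (g := mellin ((Ioi (1 : ℝ)).indicator f)) s ?_
    differentiableAt_id.neg
  refine mellin_differentiableAt_of_isBigO_rpow (a := -α) (b := -s.re - 1) ?_ ?_ ?_ ?_ ?_
  · rw [locallyIntegrableOn_iff isOpen_Ioi.isLocallyClosed]
    intro k _ hk
    obtain ⟨M, hM⟩ := hk.isBounded.subset_ball 0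
    refine Measure.integrableOn_of_bounded (M := |C| * (|M| + 1) ^ |α|) hk.measure_lt_top.ne
      (hf.indicator measurableSet_Ioi).aestronglyMeasurable ?_
    refine (ae_restrict_iff' hk.measurableSet).2 (ae_of_all _ fun t htk => ?_)
    by_cases ht : t ∈ Ioi (1 : ℝ)
    · rw [indicator_of_mem ht]
      have ht1 : 1 < t := ht
      have htM := hM htk
      rw [mem_ball_zero_iff, Real.norm_eq_abs, abs_of_pos (by linarith)] at htM
      have h1 : t ^ α ≤ (|M| + 1) ^ |α| :=
        (Real.rpow_le_rpow_of_exponent_le ht1.le (le_abs_self α)).trans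
          (Real.rpow_le_rpow (by linarith) (by linarith [le_abs_self M]) (abs_nonneg _))
      calc ‖f t‖ ≤ C * t ^ α := hC t ht1
        _ ≤ |C| * t ^ α := by gcongr; exact le_abs_self C
        _ ≤ _ := by gcongr
    · rw [indicator_of_notMem ht, norm_zero]
      positivity
  · rw [neg_neg]
    refine Asymptotics.IsBigO.of_bound C ?_
    filter_upwards [eventually_gt_atTop 1] with t ht
    have ht1 : t ∈ Ioi (1 : ℝ) := ht
    rw [indicator_of_mem ht1, Real.norm_of_nonneg (by positivity)]
    exact hC t ht
  · simpa using hs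
  · refine Asymptotics.IsBigO.of_bound 0 ?_
    have : ∀ᶠ t : ℝ in 𝓝[>] 0, t < 1 :=
      (eventually_lt_nhds one_pos).filter_mono nhdsWithin_le_nhds
    filter_upwards [this] with t ht
    rw [indicator_of_notMem (by simp [ht.le])]
    simp
  · simp

/-- The partial sums of a periodic sequence grow linearly up to a bounded error. -/
lemma exists_sum_periodic_sub_le {m : ℕ} (hm : 0 < m) {f : ℕ → ℂ} (hf : Function.Periodic f m) :
    ∃ c : ℂ, ∃ C : ℝ, ∀ n : ℕ, ‖∑ k ∈ Finset.Icc 1 n, f k - c * n‖ ≤ C := by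
  set A : ℕ → ℂ := fun n => ∑ k ∈ Finset.Icc 1 n, f k with hA
  have hstep : ∀ n, A (n + 1) = A n + f (n + 1) := fun n => by
    rw [hA]
    simp only
    rw [Finset.sum_Icc_succ_top (by omega)]
  have hadd : ∀ n, A (n + m) = A n + A m := by
    intro n
    induction n with
    | zero => simp [hA]
    | succ n ih =>
      rw [add_right_comm, hstep, ih, hstep, add_right_comm n m 1, hf (n + 1)]
      ring
  have hm0 : (m : ℂ) ≠ 0 := by exact_mod_cast hm.ne'
  -- Removing the mean over a period leaves a periodic, hence bounded, remainder.
  set R : ℕ → ℂ := fun n => A n - A m / m * n with hR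
  have hper : Function.Periodic R m := by
    intro n
    rw [hR]
    simp only
    rw [hadd]
    push_cast
    field_simp
    ring
  refine ⟨A m / m, ∑ n ∈ Finset.range m, ‖R n‖, fun n => ?_⟩
  have h1 : ∑ k ∈ Finset.Icc 1 n, f k - A m / m * n = R (n % m) := (hper.map_mod_nat n).symm
  rw [h1]
  exact Finset.single_le_sum (f := fun n => ‖R n‖) (fun _ _ => norm_nonneg _)
    (Finset.mem_range.2 (Nat.mod_lt n hm))

variable {m : ℕ} [NeZero m]

/-- `(s - 1) L(s, χ)`, continued to `s = 1`. -/
noncomputable def poleFreeLFunction (χ : DirichletCharacter ℂ m) (s : ℂ) : ℂ :=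
  open Classical in
  if χ = 1 then DirichletCharacter.LFunctionTrivChar₁ m s
  else (s - 1) * DirichletCharacter.LFunction χ s

lemma differentiable_poleFreeLFunction (χ : DirichletCharacter ℂ m) :
    Differentiable ℂ (poleFreeLFunction χ) := by
  by_cases h : χ = 1
  · have : poleFreeLFunction χ = DirichletCharacter.LFunctionTrivChar₁ m := by
      ext s
      rw [poleFreeLFunction, if_pos h]
    rw [this]
    exact DirichletCharacter.differentiable_LFunctionTrivChar₁ m
  · have : poleFreeLFunction χ = fun s => (s - 1) * DirichletCharacter.LFunction χ s := by
      ext s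
      rw [poleFreeLFunction, if_neg h]
    rw [this]
    exact (differentiable_id.sub_const 1).mul (DirichletCharacter.differentiable_LFunction h)

lemma poleFreeLFunction_eq (χ : DirichletCharacter ℂ m) {s : ℂ} (hs : s ≠ 1) :
    poleFreeLFunction χ s = (s - 1) * DirichletCharacter.LFunction χ s := by
  rw [poleFreeLFunction]
  split_ifs with h
  · rw [h]
    exact Function.update_of_ne hs _ _
  · rfl

/-- The partial sums of `χ` are `c t + E t` with `E` bounded. In the Abel summation formula the
linear part integrates to `c s / (s - 1)`, the bounded part to a tail integral. The exponent `0`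
matches the form `C * t ^ α` of the other lemmas. -/
lemma LFunction_eq_tailMellin (χ : DirichletCharacter ℂ m) : ∃ c : ℂ, ∃ E : ℝ → ℂ, ∃ C : ℝ,
    0 ≤ C ∧ Measurable E ∧ (∀ t : ℝ, 1 < t → ‖E t‖ ≤ C * t ^ (0 : ℝ)) ∧ ∀ s : ℂ, 1 < s.re →
      DirichletCharacter.LFunction χ s = c * s / (s - 1) + s * tailMellin E s := by
  have hper : Function.Periodic (fun n : ℕ => χ (n : ZMod m)) m := by
    intro n
    simp
  obtain ⟨c, C, hC⟩ := exists_sum_periodic_sub_le (NeZero.pos m) hper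
  have hC0 : 0 ≤ C := (norm_nonneg _).trans (hC 0)
  set E : ℝ → ℂ := fun t => ∑ k ∈ Finset.Icc 1 ⌊t⌋₊, χ (k : ZMod m) - c * t with hE
  have hEm : Measurable E := by
    have h1 : Measurable fun n : ℕ => ∑ k ∈ Finset.Icc 1 n, χ (k : ZMod m) :=
      measurable_from_nat
    exact (h1.comp Nat.measurable_floor).sub (by fun_prop)
  have hEb : ∀ t : ℝ, 1 < t → ‖E t‖ ≤ (C + ‖c‖) * t ^ (0 : ℝ) := by
    intro t ht
    rw [Real.rpow_zero, mul_one]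
    have h1 : E t = (∑ k ∈ Finset.Icc 1 ⌊t⌋₊, χ (k : ZMod m) - c * ⌊t⌋₊) +
        c * ((⌊t⌋₊ - t : ℝ) : ℂ) := by
      rw [hE]
      push_cast
      ring
    rw [h1]
    refine (norm_add_le _ _).trans (add_le_add (hC _) ?_)
    rw [norm_mul, norm_real, Real.norm_eq_abs]
    refine mul_le_of_le_one_right (norm_nonneg _) ?_
    have h2 := Nat.floor_le (by linarith : 0 ≤ t)
    have h3 := Nat.lt_floor_add_one t
    rw [abs_le]
    constructor <;> linarith
  refine ⟨c, E, C + ‖c‖, by positivity, hEm, hEb, fun s hs => ?_⟩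
  have hs1 : s - 1 ≠ 0 := by
    intro h
    have := congrArg re h
    simp at this
    linarith
  have hs0 : s ≠ 0 := by
    rintro rfl
    simp at hs
    linarith
  rw [DirichletCharacter.LFunction_eq_LSeries χ hs,
    LSeries_eq_mul_integral (fun n : ℕ => χ (n : ZMod m)) zero_le_one hs
      (DirichletCharacter.LSeriesSummable_of_one_lt_re χ hs)]
  · have h1 : ∀ t ∈ Ioi (1 : ℝ), (∑ k ∈ Finset.Icc 1 ⌊t⌋₊, χ (k : ZMod m)) * (t : ℂ) ^ (-(s + 1)) =
        c * (t : ℂ) ^ (-s) + E t * (t : ℂ) ^ (-(s + 1)) := by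
      intro t ht
      have ht0 : (t : ℂ) ≠ 0 := by
        have : (0 : ℝ) < t := zero_lt_one.trans ht
        exact_mod_cast this.ne'
      have h2 : (t : ℂ) ^ (-s) = t * (t : ℂ) ^ (-(s + 1)) := by
        rw [show -s = -(s + 1) + 1 by ring, Complex.cpow_add _ _ ht0, Complex.cpow_one, mul_comm]
      rw [h2, hE]
      ring
    rw [setIntegral_congr_fun measurableSet_Ioi h1, integral_add]
    · rw [integral_const_mul, integral_Ioi_cpow_of_lt (by simpa using hs) one_pos, tailMellin]
      have h3 : -s + 1 ≠ 0 := by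
        rw [show -s + 1 = -(s - 1) by ring]
        exact neg_ne_zero.2 hs1
      rw [mul_add]
      congr 1
      rw [ofReal_one, Complex.one_cpow, show -s + 1 = -(s - 1) by ring]
      field_simp
    · exact (integrableOn_Ioi_cpow_of_lt (by simpa using hs) one_pos).const_mul c
    · exact integrableOn_tailMellin hEm hEb (by linarith)
  · refine Asymptotics.IsBigO.of_bound 1 (Filter.Eventually.of_forall fun n => ?_)
    rw [Real.rpow_one, one_mul, Real.norm_of_nonneg (Nat.cast_nonneg n)]
    refine (norm_sum_le _ _).trans ?_
    refine (Finset.sum_le_card_nsmul _ _ 1 fun k _ => χ.norm_le_one _).trans ?_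
    simp

/-- The tail integral of a bounded function is holomorphic on `Re s > 0`, so the identity theorem
extends the formula from `Re s > 1`. -/
lemma poleFreeLFunction_eq_tailMellin (χ : DirichletCharacter ℂ m) : ∃ c : ℂ, ∃ E : ℝ → ℂ,
    ∃ C : ℝ, 0 ≤ C ∧ (∀ t : ℝ, 1 < t → ‖E t‖ ≤ C * t ^ (0 : ℝ)) ∧ ∀ s : ℂ, 0 < s.re →
      poleFreeLFunction χ s = c * s + s * (s - 1) * tailMellin E s := by
  obtain ⟨c, E, C, hC0, hEm, hEb, hL⟩ := LFunction_eq_tailMellin χ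
  refine ⟨c, E, C, hC0, hEb, ?_⟩
  have hopen : IsOpen {s : ℂ | 0 < s.re} := isOpen_lt continuous_const continuous_re
  have hG : DifferentiableOn ℂ (fun s => c * s + s * (s - 1) * tailMellin E s)
      {s : ℂ | 0 < s.re} := by
    intro s hs
    have h1 := differentiableAt_tailMellin hEm hEb (s := s) hs
    have h2 : DifferentiableAt ℂ (fun s => c * s + s * (s - 1) * tailMellin E s) s :=
      (DifferentiableAt.add (by fun_prop) (DifferentiableAt.mul (by fun_prop) h1))
    exact h2.differentiableWithinAt
  have h := AnalyticOnNhd.eqOn_of_preconnected_of_eventuallyEq (z₀ := (2 : ℂ))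
    ((differentiable_poleFreeLFunction χ).differentiableOn.analyticOnNhd hopen)
    (hG.analyticOnNhd hopen) (convex_halfSpace_re_gt 0).isPreconnected (by simp) ?_
  · exact fun s hs => h hs
  · have hopen1 : IsOpen {s : ℂ | 1 < s.re} := isOpen_lt continuous_const continuous_re
    filter_upwards [hopen1.mem_nhds (show (2 : ℂ) ∈ {s : ℂ | 1 < s.re} by simp)] with s hs
    have hs1 : s ≠ 1 := by
      rintro rfl
      simp at hs
    rw [poleFreeLFunction_eq χ hs1, hL s hs]
    have : s - 1 ≠ 0 := sub_ne_zero.2 hs1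
    field_simp

end

/-! ### The regularised `L`-function satisfies the hypotheses of Littlewood's bound. -/

section

open Complex Set MeasureTheory Filter Topology

variable {m : ℕ} [NeZero m]

/-- The factor `(s - 1) / (s + 1)` for the trivial character and `1` for the others. -/
noncomputable def poleFactor (χ : DirichletCharacter ℂ m) (s : ℂ) : ℂ :=
  open Classical in if χ = 1 then (s - 1) / (s + 1) else 1

/-- The product of `L(s, χ)` and `poleFactor χ s`, which is holomorphic on `Re s > -1`. -/
noncomputable def regularLFunction (χ : DirichletCharacter ℂ m) (s : ℂ) : ℂ :=
  open Classical in
  if χ = 1 then poleFreeLFunction χ s / (s + 1) else DirichletCharacter.LFunction χ s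

lemma add_one_ne_zero_of_re {s : ℂ} (hs : 0 < s.re) : s + 1 ≠ 0 := by
  intro h
  have := congrArg re h
  simp at this
  linarith

lemma norm_le_norm_add_one {s : ℂ} (hs : 0 ≤ s.re) : ‖s‖ ≤ ‖s + 1‖ := by
  rw [← sq_le_sq₀ (norm_nonneg _) (norm_nonneg _), ← normSq_eq_norm_sq, ← normSq_eq_norm_sq,
    normSq_apply, normSq_apply]
  simp
  nlinarith

lemma norm_sub_one_le_norm_add_one {s : ℂ} (hs : 0 ≤ s.re) : ‖s - 1‖ ≤ ‖s + 1‖ := by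
  rw [← sq_le_sq₀ (norm_nonneg _) (norm_nonneg _), ← normSq_eq_norm_sq, ← normSq_eq_norm_sq,
    normSq_apply, normSq_apply]
  simp
  nlinarith

/-- The reason for cancelling the pole by `(s - 1) / (s + 1)` and not by `s - 1`: the factor does
not enlarge growth estimates. -/
lemma norm_poleFactor_le (χ : DirichletCharacter ℂ m) {s : ℂ} (hs : 0 < s.re) :
    ‖poleFactor χ s‖ ≤ 1 := by
  rw [poleFactor]
  split_ifs
  · rw [norm_div, div_le_one (norm_pos_iff.2 (add_one_ne_zero_of_re hs))]
    exact norm_sub_one_le_norm_add_one hs.le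
  · simp

lemma differentiableOn_poleFactor (χ : DirichletCharacter ℂ m) :
    DifferentiableOn ℂ (poleFactor χ) {s | 0 < s.re} := by
  intro s hs
  by_cases h : χ = 1
  · have : poleFactor χ = fun s => (s - 1) / (s + 1) := by
      ext s
      rw [poleFactor, if_pos h]
    rw [this]
    have h2 : DifferentiableAt ℂ (fun s : ℂ => (s - 1) / (s + 1)) s :=
      DifferentiableAt.div (by fun_prop) (by fun_prop) (add_one_ne_zero_of_re hs)
    exact h2.differentiableWithinAt
  · have : poleFactor χ = fun s => 1 := by
      ext s
      rw [poleFactor, if_neg h]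
    rw [this]
    exact differentiableWithinAt_const 1

lemma regularLFunction_eq (χ : DirichletCharacter ℂ m) {s : ℂ} (hs1 : s ≠ 1) :
    regularLFunction χ s = poleFactor χ s * DirichletCharacter.LFunction χ s := by
  rw [regularLFunction, poleFactor]
  split_ifs with h
  · rw [poleFreeLFunction_eq χ hs1]
    ring
  · rw [one_mul]

lemma poleFactor_ne_zero (χ : DirichletCharacter ℂ m) {s : ℂ} (hs : 0 < s.re) (hs1 : s ≠ 1) :
    poleFactor χ s ≠ 0 := by
  rw [poleFactor]
  split_ifs
  · exact div_ne_zero (sub_ne_zero.2 hs1) (add_one_ne_zero_of_re hs)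
  · exact one_ne_zero

lemma differentiableOn_regularLFunction (χ : DirichletCharacter ℂ m) :
    DifferentiableOn ℂ (regularLFunction χ) {s | 0 < s.re} := by
  intro s hs
  by_cases h : χ = 1
  · have : regularLFunction χ = fun s => poleFreeLFunction χ s / (s + 1) := by
      ext s
      rw [regularLFunction, if_pos h]
    rw [this]
    have h2 : DifferentiableAt ℂ (fun s : ℂ => poleFreeLFunction χ s / (s + 1)) s :=
      DifferentiableAt.div (differentiable_poleFreeLFunction χ s) (by fun_prop)
        (add_one_ne_zero_of_re hs)
    exact h2.differentiableWithinAt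
  · have : regularLFunction χ = DirichletCharacter.LFunction χ := by
      ext s
      rw [regularLFunction, if_neg h]
    rw [this]
    exact (DirichletCharacter.differentiable_LFunction h s).differentiableWithinAt

lemma regularLFunction_ne_zero_of_one_le_re (χ : DirichletCharacter ℂ m) {s : ℂ}
    (hs : 1 ≤ s.re) : regularLFunction χ s ≠ 0 := by
  have hs0 : 0 < s.re := by linarith
  by_cases hs1 : s = 1
  · rw [regularLFunction]
    split_ifs with h
    · refine div_ne_zero ?_ (add_one_ne_zero_of_re hs0)
      rw [poleFreeLFunction, if_pos h, hs1]
      exact DirichletCharacter.LFunctionTrivChar₁_apply_one_ne_zero m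
    · exact DirichletCharacter.LFunction_ne_zero_of_one_le_re χ (Or.inl h) hs
  · rw [regularLFunction_eq χ hs1]
    exact mul_ne_zero (poleFactor_ne_zero χ hs0 hs1)
      (DirichletCharacter.LFunction_ne_zero_of_one_le_re χ (Or.inr hs1) hs)

/-- The tail integral is at most `2 C` on `Re s > 1 / 2`, so the growth is that of its prefactor: `s
(s - 1) / (s + 1)` for the trivial character and `s` for the others. -/
lemma exists_norm_regularLFunction_le (χ : DirichletCharacter ℂ m) : ∃ A : ℝ, ∀ s : ℂ,
    1 / 2 < s.re → ‖regularLFunction χ s‖ ≤ A * (1 + ‖s‖) := by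
  obtain ⟨c, E, C, hC0, hE, hL⟩ := poleFreeLFunction_eq_tailMellin χ
  have hG : ∀ s : ℂ, 1 / 2 < s.re → ‖tailMellin E s‖ ≤ 2 * C := by
    intro s hs
    refine (norm_tailMellin_le hE (s := s) (by linarith)).trans ?_
    rw [sub_zero, div_le_iff₀ (by linarith)]
    nlinarith
  by_cases h : χ = 1
  · refine ⟨‖c‖ + 2 * C, fun s hs => ?_⟩
    have hs1 : 0 < ‖s + 1‖ := norm_pos_iff.2 (add_one_ne_zero_of_re (by linarith))
    rw [regularLFunction, if_pos h, hL s (by linarith), norm_div, div_le_iff₀ hs1]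
    have h1 := norm_le_norm_add_one (s := s) (by linarith)
    have h2 := norm_sub_one_le_norm_add_one (s := s) (by linarith)
    calc ‖c * s + s * (s - 1) * tailMellin E s‖
        ≤ ‖c‖ * ‖s‖ + ‖s‖ * ‖s - 1‖ * ‖tailMellin E s‖ := by
          refine (norm_add_le _ _).trans ?_
          rw [norm_mul, norm_mul, norm_mul]
      _ ≤ ‖c‖ * ‖s + 1‖ + ‖s‖ * ‖s + 1‖ * (2 * C) := by
          gcongr
          exact hG s hs
      _ ≤ (‖c‖ + 2 * C) * (1 + ‖s‖) * ‖s + 1‖ := by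
          have := mul_nonneg (mul_nonneg (norm_nonneg c) (norm_nonneg s)) hs1.le
          nlinarith
  -- For a nontrivial character the pole-free function vanishes at `s = 1`, where the formula
  -- reduces to `c`.
  · have hc : c = 0 := by
      have h1 := hL 1 (by simp)
      rw [poleFreeLFunction, if_neg h] at h1
      simpa using h1.symm
    have hL' : ∀ s : ℂ, 0 < s.re → s ≠ 1 → regularLFunction χ s = s * tailMellin E s := by
      intro s hs hs1
      have h1 := hL s hs
      rw [poleFreeLFunction, if_neg h, hc, zero_mul, zero_add] at h1
      rw [regularLFunction, if_neg h]
      have : s - 1 ≠ 0 := sub_ne_zero.2 hs1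
      apply mul_left_cancel₀ this
      rw [h1]
      ring
    refine ⟨2 * C + ‖regularLFunction χ 1‖, fun s hs => ?_⟩
    by_cases hs1 : s = 1
    · rw [hs1, norm_one]
      nlinarith [norm_nonneg (regularLFunction χ 1)]
    · rw [hL' s (by linarith) hs1, norm_mul]
      have h1 := hG s hs
      have h2 := norm_nonneg s
      have h3 := norm_nonneg (regularLFunction χ 1)
      calc ‖s‖ * ‖tailMellin E s‖ ≤ ‖s‖ * (2 * C) := by gcongr
        _ ≤ _ := by nlinarith [mul_nonneg h3 h2]

lemma exists_norm_LSeries_le {f : ℕ → ℂ} {σ : ℝ} (hf : LSeriesSummable f σ) : ∃ K : ℝ,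
    ∀ s : ℂ, σ ≤ s.re → ‖LSeries f s‖ ≤ K := by
  refine ⟨∑' n, ‖LSeries.term f σ n‖, fun s hs => ?_⟩
  have h1 : ∀ n, ‖LSeries.term f s n‖ ≤ ‖LSeries.term f σ n‖ := fun n =>
    LSeries.norm_term_le_of_re_le_re f (by simpa using hs) n
  have h2 : Summable fun n => ‖LSeries.term f σ n‖ := hf.norm
  exact tsum_of_norm_bounded h2.hasSum h1

/-- `-L' / L` is the absolutely convergent series of `Λ χ`, dominated by its terms at `1 + δ`. The
pole factor adds `1 / (s - 1) - 1 / (s + 1)`, at most `1 / δ + 1`. -/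
lemma exists_norm_logDeriv_regularLFunction_le (χ : DirichletCharacter ℂ m) {δ : ℝ} (hδ : 0 < δ) :
    ∃ K : ℝ, ∀ s : ℂ, 1 + δ ≤ s.re →
      ‖deriv (regularLFunction χ) s / regularLFunction χ s‖ ≤ K := by
  obtain ⟨K, hK⟩ := exists_norm_LSeries_le (σ := 1 + δ)
    (DirichletCharacter.LSeriesSummable_twist_vonMangoldt χ (s := ((1 + δ : ℝ) : ℂ))
      (by rw [ofReal_re]; linarith))
  refine ⟨1 / δ + 1 + K, fun s hs => ?_⟩
  have hs1 : s ≠ 1 := by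
    rintro rfl
    simp at hs
    linarith
  have hs' : 1 < s.re := by linarith
  have hev : regularLFunction χ =ᶠ[𝓝 s]
      fun z => poleFactor χ z * LSeries (fun n : ℕ => χ (n : ZMod m)) z := by
    have hopen1 : IsOpen {s : ℂ | 1 < s.re} := isOpen_lt continuous_const continuous_re
    filter_upwards [hopen1.mem_nhds hs', isOpen_ne.mem_nhds hs1] with z hz hz1
    rw [regularLFunction_eq χ hz1, DirichletCharacter.LFunction_eq_LSeries χ hz]
  have hL0 : LSeries (fun n : ℕ => χ (n : ZMod m)) s ≠ 0 :=
    DirichletCharacter.LSeries_ne_zero_of_one_lt_re χ hs'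
  have hLd : DifferentiableAt ℂ (LSeries fun n : ℕ => χ (n : ZMod m)) s := by
    refine (LSeries_hasDerivAt ?_).differentiableAt
    rw [DirichletCharacter.absicssaOfAbsConv_eq_one (NeZero.ne m)]
    exact_mod_cast hs'
  have hopen : IsOpen {s : ℂ | 0 < s.re} := isOpen_lt continuous_const continuous_re
  have hs0 : s ∈ {s : ℂ | 0 < s.re} := by
    rw [mem_ofPred_eq]
    linarith
  have hpd : DifferentiableAt ℂ (poleFactor χ) s :=
    (differentiableOn_poleFactor χ).differentiableAt (hopen.mem_nhds hs0)
  have h1 : deriv (regularLFunction χ) s / regularLFunction χ s =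
      logDeriv (poleFactor χ) s + logDeriv (LSeries fun n : ℕ => χ (n : ZMod m)) s := by
    rw [← logDeriv_mul s (poleFactor_ne_zero χ hs0 hs1) hL0 hpd hLd, logDeriv_apply,
      hev.deriv_eq, hev.eq_of_nhds]
  have h2 : ‖logDeriv (LSeries fun n : ℕ => χ (n : ZMod m)) s‖ ≤ K := by
    have h3 := DirichletCharacter.LSeries_twist_vonMangoldt_eq χ hs'
    rw [logDeriv_apply, ← norm_neg, ← neg_div]
    have h4 := hK s hs
    rwa [h3] at h4
  have h3 : ‖logDeriv (poleFactor χ) s‖ ≤ 1 / δ + 1 := by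
    by_cases h : χ = 1
    · have : poleFactor χ = fun s => (s - 1) / (s + 1) := by
        ext s
        rw [poleFactor, if_pos h]
      rw [this, logDeriv_div (f := fun z : ℂ => z - 1) (g := fun z : ℂ => z + 1) s (sub_ne_zero.2 hs1) (add_one_ne_zero_of_re hs0) (by fun_prop)
        (by fun_prop), logDeriv_apply, logDeriv_apply]
      simp only [deriv_sub_const, deriv_add_const, deriv_id'']
      refine (norm_sub_le _ _).trans (add_le_add ?_ ?_)
      · rw [norm_div, norm_one]
        have : δ ≤ ‖s - 1‖ := by
          refine le_trans ?_ (re_le_norm _)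
          simp
          linarith
        exact one_div_le_one_div_of_le hδ this
      · rw [norm_div, norm_one]
        have : 1 ≤ ‖s + 1‖ := by
          refine le_trans ?_ (re_le_norm _)
          simp
          linarith
        rw [div_le_one (by linarith)]
        exact this
    · have : poleFactor χ = fun s => 1 := by
        ext s
        rw [poleFactor, if_neg h]
      rw [this, logDeriv_apply]
      simp
      positivity
  rw [h1]
  exact (norm_add_le _ _).trans (add_le_add h3 h2)

/-- The coefficients `μ(n) χ(n)` of the reciprocal of `L(s, χ)`. -/
noncomputable def moebiusTwist {m : ℕ} (χ : DirichletCharacter ℂ m) (n : ℕ) : ℂ :=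
  (ArithmeticFunction.moebius n : ℂ) * χ n

lemma norm_moebiusTwist_le {m : ℕ} (χ : DirichletCharacter ℂ m) (n : ℕ) : ‖moebiusTwist χ n‖ ≤ 1 := by
  rw [moebiusTwist, norm_mul, norm_intCast]
  refine mul_le_one₀ ?_ (norm_nonneg _) (χ.norm_le_one _)
  exact_mod_cast ArithmeticFunction.abs_moebius_le_one

lemma LSeriesSummable_moebiusTwist {m : ℕ} (χ : DirichletCharacter ℂ m) {s : ℂ} (hs : 1 < s.re) :
    LSeriesSummable (moebiusTwist χ) s :=
  LSeriesSummable_of_bounded_of_one_lt_re (fun n _ => norm_moebiusTwist_le χ n) hs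

lemma LSeries_moebiusTwist_eq_inv (χ : DirichletCharacter ℂ m) {s : ℂ} (hs : 1 < s.re) :
    LSeries (moebiusTwist χ) s = (DirichletCharacter.LFunction χ s)⁻¹ := by
  have h := DirichletCharacter.LSeries.mul_mu_eq_one χ hs
  have h2 : moebiusTwist χ = (fun n : ℕ => χ (n : ZMod m)) *
      fun n => ((ArithmeticFunction.moebius n : ℤ) : ℂ) := by
    ext n
    rw [moebiusTwist, Pi.mul_apply, mul_comm]
  rw [DirichletCharacter.LFunction_eq_LSeries χ hs, h2]
  exact eq_inv_of_mul_eq_one_right h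

lemma LSeries_moebiusTwist (χ : DirichletCharacter ℂ m) {s : ℂ} (hs : 1 < s.re) :
    LSeries (moebiusTwist χ) s = poleFactor χ s / regularLFunction χ s := by
  have hs1 : s ≠ 1 := by
    rintro rfl
    simp at hs
  rw [LSeries_moebiusTwist_eq_inv χ hs, regularLFunction_eq χ hs1]
  have := poleFactor_ne_zero χ (by linarith) hs1
  field_simp

/-- On `Re s = 2` both `L` and `1 / L` are bounded by absolutely convergent series, and the pole
factor has modulus between `1 / 3` and `1`. -/
lemma exists_abs_log_norm_regularLFunction_le (χ : DirichletCharacter ℂ m) : ∃ K : ℝ, ∀ t : ℝ,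
    |Real.log ‖regularLFunction χ (2 + t * I)‖| ≤ K := by
  obtain ⟨K₁, hK₁⟩ := exists_norm_LSeries_le (σ := 2)
    (LSeriesSummable_moebiusTwist χ (s := ((2 : ℝ) : ℂ)) (by simp))
  obtain ⟨K₂, hK₂⟩ := exists_norm_LSeries_le (σ := 2)
    (DirichletCharacter.LSeriesSummable_of_one_lt_re χ (s := ((2 : ℝ) : ℂ)) (by simp))
  refine ⟨max (Real.log K₂) (Real.log (3 * K₁)), fun t => ?_⟩
  set s : ℂ := 2 + t * I with hs
  have hsre : s.re = 2 := by simp [hs]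
  have hs0 : 0 < s.re := by linarith
  have hs1 : s ≠ 1 := by
    intro h
    rw [h] at hsre
    simp at hsre
  have hF0 := regularLFunction_ne_zero_of_one_le_re χ (s := s) (by linarith)
  have hFpos : 0 < ‖regularLFunction χ s‖ := norm_pos_iff.2 hF0
  have h1 : ‖regularLFunction χ s‖ ≤ K₂ := by
    rw [regularLFunction_eq χ hs1, norm_mul,
      DirichletCharacter.LFunction_eq_LSeries χ (by linarith)]
    calc _ ≤ 1 * ‖LSeries (fun n : ℕ => χ (n : ZMod m)) s‖ := by
          gcongr
          exact norm_poleFactor_le χ hs0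
      _ ≤ K₂ := by
          rw [one_mul]
          exact hK₂ s hsre.ge
  have h2 : ‖regularLFunction χ s‖⁻¹ ≤ 3 * K₁ := by
    have h3 := hK₁ s hsre.ge
    rw [LSeries_moebiusTwist χ (by linarith), norm_div] at h3
    have h4 : 1 / 3 ≤ ‖poleFactor χ s‖ := by
      rw [poleFactor]
      split_ifs
      · have h5 : 1 ≤ ‖s - 1‖ := by
          refine le_trans ?_ (re_le_norm _)
          rw [sub_re, hsre, one_re]
          norm_num
        have h6 : ‖s + 1‖ ≤ ‖s - 1‖ + 2 := by
          have := norm_add_le (s - 1) 2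
          rw [show s - 1 + 2 = s + 1 by ring] at this
          simpa using this
        rw [norm_div, le_div_iff₀ (norm_pos_iff.2 (add_one_ne_zero_of_re hs0))]
        linarith
      · rw [norm_one]
        norm_num
    have h5 : 1 / 3 / ‖regularLFunction χ s‖ ≤ K₁ := le_trans (by gcongr) h3
    rw [div_div, one_div, mul_inv] at h5
    linarith
  rw [abs_le]
  constructor
  · have h3 := Real.log_le_log (inv_pos.2 hFpos) h2
    rw [Real.log_inv] at h3
    have := le_max_right (Real.log K₂) (Real.log (3 * K₁))
    linarith
  · exact (Real.log_le_log hFpos h1).trans (le_max_left _ _)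

lemma regularLFunction_ne_zero_of_GRHModulo (h : GRHModulo m) (χ : DirichletCharacter ℂ m) {s : ℂ}
    (hs : 1 / 2 < s.re) : regularLFunction χ s ≠ 0 := by
  rcases le_or_gt 1 s.re with h1 | h1
  · exact regularLFunction_ne_zero_of_one_le_re χ h1
  · have hs1 : s ≠ 1 := by
      rintro rfl
      simp at h1
    rw [regularLFunction_eq χ hs1]
    refine mul_ne_zero (poleFactor_ne_zero χ (by linarith) hs1) fun h0 => ?_
    have := h χ s h0 (by linarith) h1
    linarith

/-- Under GRH, `1 / L(s, χ)` grows subpolynomially to the right of the critical line. -/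
theorem exists_norm_poleFactor_div_le (h : GRHModulo m) (χ : DirichletCharacter ℂ m) {δ ε : ℝ}
    (hδ : 0 < δ) (hδ2 : δ < 1 / 4) (hε : 0 < ε) :
    ∃ C : ℝ, 0 ≤ C ∧ ∀ σ t : ℝ, 1 / 2 + 2 * δ ≤ σ → σ ≤ 2 →
      ‖poleFactor χ (σ + t * I) / regularLFunction χ (σ + t * I)‖ ≤ C * (2 + |t|) ^ ε := by
  obtain ⟨C, hC0, hC⟩ := exists_norm_inv_le_rpow (F := regularLFunction χ)
    ((differentiableOn_regularLFunction χ).mono fun s hs => by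
      rw [mem_ofPred_eq] at hs ⊢
      linarith)
    (fun s hs => regularLFunction_ne_zero_of_GRHModulo h χ hs)
    (exists_norm_regularLFunction_le χ)
    (fun δ hδ => exists_norm_logDeriv_regularLFunction_le χ hδ)
    (exists_abs_log_norm_regularLFunction_le χ) hδ hδ2 hε
  refine ⟨C, hC0, fun σ t h1 h2 => ?_⟩
  rw [div_eq_mul_inv, norm_mul]
  refine le_trans (mul_le_of_le_one_left (norm_nonneg _) ?_) (hC σ t h1 h2)
  refine norm_poleFactor_le χ ?_
  simp
  linarith

end

/-! ### A smoothed Perron formula and the shift of contours. -/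

section

open Complex Set MeasureTheory Filter Topology

lemma integrable_two_add_abs_rpow {β : ℝ} (hβ : 1 < β) (C : ℝ) :
    Integrable fun t : ℝ => C * (2 + |t|) ^ (-β) := by
  have h1 : Integrable fun t : ℝ => (1 + ‖t‖) ^ (-β) := integrable_one_add_norm (by simpa using hβ)
  refine Integrable.const_mul (h1.mono' ?_ (ae_of_all _ fun t => ?_)) C
  · refine Continuous.aestronglyMeasurable ?_
    refine Continuous.rpow_const (by fun_prop) fun t => Or.inl ?_
    positivity
  · rw [Real.norm_of_nonneg (by positivity), Real.norm_eq_abs]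
    exact Real.rpow_le_rpow_of_nonpos (by positivity) (by linarith) (by linarith)

lemma two_add_abs_im_le {s : ℂ} (hs : 1 / 2 ≤ s.re) : 2 + |s.im| ≤ 5 * ‖s‖ := by
  have h1 := abs_re_le_norm s
  have h2 := abs_im_le_norm s
  have h3 := le_abs_self s.re
  linarith

lemma ne_zero_of_half_le_re {s : ℂ} (hs : 1 / 2 ≤ s.re) : s ≠ 0 := by
  rintro rfl
  simp at hs
  linarith

lemma norm_inv_mul_add_one_le {s : ℂ} (hs : 1 / 2 ≤ s.re) :
    ‖(s * (s + 1))⁻¹‖ ≤ 25 * (2 + |s.im|) ^ (-2 : ℝ) := by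
  have h1 := two_add_abs_im_le hs
  have h2 := norm_le_norm_add_one (s := s) (by linarith)
  have h3 : 0 < 2 + |s.im| := by positivity
  have h4 : 0 < ‖s‖ := norm_pos_iff.2 (ne_zero_of_half_le_re hs)
  have h5 : 0 < ‖s + 1‖ := h4.trans_le h2
  rw [norm_inv, norm_mul, Real.rpow_neg h3.le, inv_le_comm₀ (by positivity) (by positivity),
    mul_inv, inv_inv]
  norm_cast
  nlinarith

lemma continuous_inv_mul_add_one {σ : ℝ} (hσ : 1 / 2 ≤ σ) :
    Continuous fun t : ℝ => (((σ : ℂ) + t * I) * (σ + t * I + 1))⁻¹ := by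
  refine Continuous.inv₀ (by fun_prop) fun t => ?_
  have h : 1 / 2 ≤ ((σ : ℂ) + t * I).re := by simpa using hσ
  exact mul_ne_zero (ne_zero_of_half_le_re h) (add_one_ne_zero_of_re (by linarith))

lemma integrable_inv_mul_add_one {σ : ℝ} (hσ : 1 / 2 ≤ σ) :
    Integrable fun t : ℝ => (((σ : ℂ) + t * I) * (σ + t * I + 1))⁻¹ := by
  refine (integrable_two_add_abs_rpow (β := 2) (by norm_num) 25).mono'
    (continuous_inv_mul_add_one hσ).aestronglyMeasurable (ae_of_all _ fun t => ?_)
  have h : 1 / 2 ≤ ((σ : ℂ) + t * I).re := by simpa using hσ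
  have := norm_inv_mul_add_one_le h
  simpa using this

/-- On `(0, 1]` the function is `1 - u`, with transform `1 / s - 1 / (s + 1)`. The quadratic decay
of this kernel, absent for a sharp cut-off, makes the Perron integrals absolutely convergent. -/
lemma hasMellin_max_one_sub {s : ℂ} (hs : 0 < s.re) :
    HasMellin (fun u : ℝ => ((max (1 - u) 0 : ℝ) : ℂ)) s ((s * (s + 1))⁻¹) := by
  have h1 := hasMellin_one_Ioc hs
  have h2 := hasMellin_cpow_Ioc 1 (s := s) (by simp; linarith)
  have h3 := hasMellin_sub h1.1 h2.1
  have heq : ∀ u ∈ Ioi (0 : ℝ), (Ioc (0 : ℝ) 1).indicator (fun _ => (1 : ℂ)) u -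
      (Ioc (0 : ℝ) 1).indicator (fun t : ℝ => (t : ℂ) ^ (1 : ℂ)) u =
      ((max (1 - u) 0 : ℝ) : ℂ) := by
    intro u hu
    by_cases h : u ≤ 1
    · have hu' : u ∈ Ioc (0 : ℝ) 1 := ⟨hu, h⟩
      rw [indicator_of_mem hu', indicator_of_mem hu', cpow_one, max_eq_left (by linarith)]
      push_cast
      ring
    · have hu' : u ∉ Ioc (0 : ℝ) 1 := fun hc => h hc.2
      rw [indicator_of_notMem hu', indicator_of_notMem hu', max_eq_right (by linarith)]
      simp
  refine ⟨?_, ?_⟩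
  · refine IntegrableOn.congr_fun h3.1 (fun u hu => ?_) measurableSet_Ioi
    simp only
    rw [heq u hu]
  · have h4 : mellin (fun u : ℝ => ((max (1 - u) 0 : ℝ) : ℂ)) s =
        mellin (fun u : ℝ => (Ioc (0 : ℝ) 1).indicator (fun _ => (1 : ℂ)) u -
          (Ioc (0 : ℝ) 1).indicator (fun t : ℝ => (t : ℂ) ^ (1 : ℂ)) u) s := by
      refine setIntegral_congr_fun measurableSet_Ioi fun u hu => ?_
      simp only
      rw [heq u hu]
    rw [h4, h3.2, h1.2, h2.2]
    have hs0 : s ≠ 0 := by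
      rintro rfl
      simp at hs
    have hs1 := add_one_ne_zero_of_re hs
    field_simp
    ring

/-- The smoothed Perron kernel. -/
lemma integral_cpow_mul_inv {σ : ℝ} (hσ : 1 / 2 ≤ σ) {x : ℝ} (hx : 0 < x) :
    ∫ t : ℝ, (x : ℂ) ^ (-((σ : ℂ) + t * I)) * (((σ : ℂ) + t * I) * (σ + t * I + 1))⁻¹ =
      2 * Real.pi * ((max (1 - x) 0 : ℝ) : ℂ) := by
  have hre : ∀ t : ℝ, ((σ : ℂ) + t * I).re = σ := fun t => by simp
  have hm : ∀ t : ℝ, mellin (fun u : ℝ => ((max (1 - u) 0 : ℝ) : ℂ)) ((σ : ℂ) + t * I) =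
      (((σ : ℂ) + t * I) * (σ + t * I + 1))⁻¹ := fun t =>
    (hasMellin_max_one_sub (by rw [hre]; linarith)).2
  have h := mellinInv_mellin_eq σ (fun u : ℝ => ((max (1 - u) 0 : ℝ) : ℂ)) hx
    (hasMellin_max_one_sub (by rw [ofReal_re]; linarith)).1
    (by
      rw [VerticalIntegrable]
      simp only [hm]
      exact integrable_inv_mul_add_one hσ)
    (by fun_prop)
  rw [mellinInv] at h
  simp only [hm, smul_eq_mul] at h
  rw [← h]
  have : (Real.pi : ℂ) ≠ 0 := by exact_mod_cast Real.pi_ne_zero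
  rw [real_smul, ← mul_assoc]
  push_cast
  rw [mul_one_div_cancel (by simp), one_mul]

lemma cpow_neg_div_eq {n : ℕ} (hn : n ≠ 0) {X : ℝ} (hX : 0 < X) (s : ℂ) :
    ((n / X : ℝ) : ℂ) ^ (-s) = (X : ℂ) ^ s / (n : ℂ) ^ s := by
  have hn0 : (n : ℂ) ≠ 0 := by exact_mod_cast hn
  have hX0 : (X : ℂ) ≠ 0 := by exact_mod_cast hX.ne'
  have h1 : (n : ℂ) ^ s = ((n / X : ℝ) : ℂ) ^ s * (X : ℂ) ^ s := by
    rw [← Complex.mul_cpow_ofReal_nonneg (by positivity) hX.le]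
    congr 1
    push_cast
    field_simp
  have h2 : ((n / X : ℝ) : ℂ) ^ s ≠ 0 := by
    rw [Ne, Complex.cpow_eq_zero_iff, not_and_or]
    left
    push_cast
    exact div_ne_zero hn0 hX0
  have h3 : (X : ℂ) ^ s ≠ 0 := by
    rw [Ne, Complex.cpow_eq_zero_iff, not_and_or]
    exact Or.inl hX0
  rw [Complex.cpow_neg, h1]
  field_simp

/-- The smoothed Perron formula on the line `Re s = 2`. -/
lemma sum_mul_max_eq_integral {a : ℕ → ℂ} (ha : ∀ n, ‖a n‖ ≤ 1) {X : ℝ} (hX : 0 < X) {M : ℕ}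
    (hM : X ≤ M) :
    2 * Real.pi * ∑ n ∈ Finset.Icc 1 M, a n * ((max (X - n) 0 : ℝ) : ℂ) =
      ∫ t : ℝ, LSeries a (2 + t * I) * (X : ℂ) ^ (2 + t * I + 1) *
        ((2 + t * I) * (2 + t * I + 1))⁻¹ := by
  have hsum : LSeriesSummable a 2 :=
    LSeriesSummable_of_bounded_of_one_lt_re (fun n _ => ha n) (by simp)
  have hX0 : (X : ℂ) ≠ 0 := by exact_mod_cast hX.ne'
  have hre : ∀ t : ℝ, (2 + t * I : ℂ).re = 2 := fun t => by simp
  set F : ℕ → ℝ → ℂ := fun n t => LSeries.term a (2 + t * I) n * (X : ℂ) ^ (2 + t * I + 1) *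
        ((2 + t * I) * (2 + t * I + 1))⁻¹ with hF
  have hk := integrable_inv_mul_add_one (σ := 2) (by norm_num)
  simp only [ofReal_ofNat] at hk
  have hFn : ∀ n t, ‖F n t‖ ≤ ‖LSeries.term a 2 n‖ * X ^ (3 : ℝ) *
      ‖((2 + t * I : ℂ) * (2 + t * I + 1))⁻¹‖ := by
    intro n t
    rw [hF]
    simp only
    rw [norm_mul, norm_mul, Complex.norm_cpow_eq_rpow_re_of_pos hX]
    have h1 : (2 + t * I + 1 : ℂ).re = 3 := by
      rw [add_re, hre, one_re]
      norm_num
    rw [h1]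
    gcongr
    exact LSeries.norm_term_le_of_re_le_re a (by rw [hre]; simp) n
  have hFc : ∀ n, Continuous (F n) := by
    intro n
    have hc := continuous_inv_mul_add_one (σ := 2) (by norm_num)
    simp only [ofReal_ofNat] at hc
    refine Continuous.mul (Continuous.mul ?_ ?_) hc
    · rcases Nat.eq_zero_or_pos n with rfl | hn
      · simp only [LSeries.term_zero]
        exact continuous_const
      · have hn0 : (n : ℂ) ≠ 0 := by exact_mod_cast hn.ne'
        simp only [LSeries.term_of_ne_zero hn.ne']
        refine Continuous.div continuous_const ?_ fun t => ?_
        · exact Continuous.const_cpow (by fun_prop) (Or.inl hn0)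
        · rw [Ne, Complex.cpow_eq_zero_iff, not_and_or]
          exact Or.inl hn0
    · exact Continuous.const_cpow (by fun_prop) (Or.inl hX0)
  have hFi : ∀ n, Integrable (F n) := fun n =>
    ((hk.norm.const_mul (‖LSeries.term a 2 n‖ * X ^ (3 : ℝ)))).mono'
      (hFc n).aestronglyMeasurable (ae_of_all _ fun t => hFn n t)
  -- Absolute convergence of the series at `2`, with an integrable kernel, permits integration term
  -- by term.
  have hFs : Summable fun n => ∫ t : ℝ, ‖F n t‖ := by
    refine Summable.of_nonneg_of_le (fun n => integral_nonneg fun t => norm_nonneg _)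
      (fun n => (integral_mono (hFi n).norm (hk.norm.const_mul _) (hFn n)).trans_eq
        (integral_const_mul _ _)) ?_
    exact (hsum.norm.mul_right _).mul_right _
  have h := hasSum_integral_of_summable_integral_norm hFi hFs
  have hval : ∀ n, ∫ t : ℝ, F n t =
      if n = 0 then 0 else 2 * Real.pi * (a n * ((max (X - n) 0 : ℝ) : ℂ)) := by
    intro n
    split_ifs with hn
    · rw [hn]
      simp [hF, LSeries.term_zero]
    -- The term is `a n * X` times the Perron integrand at `n / X`, and `X * max (1 - n / X) 0 = max
    -- (X - n) 0`.
    · have h1 : ∀ t : ℝ, F n t = (a n * X) * (((n / X : ℝ) : ℂ) ^ (-(((2 : ℝ) : ℂ) + t * I)) *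
          ((((2 : ℝ) : ℂ) + t * I) * (((2 : ℝ) : ℂ) + t * I + 1))⁻¹) := by
        intro t
        rw [cpow_neg_div_eq hn hX, hF]
        simp only [ofReal_ofNat]
        rw [LSeries.term_of_ne_zero hn, Complex.cpow_add _ _ hX0, Complex.cpow_one]
        ring
      simp only [h1]
      rw [integral_const_mul, integral_cpow_mul_inv (by norm_num)
        (div_pos (by exact_mod_cast Nat.pos_of_ne_zero hn) hX)]
      have h2 : max (X - n) 0 = X * max (1 - n / X) 0 := by
        rw [mul_max_of_nonneg _ _ hX.le, mul_zero, mul_sub, mul_one, mul_div_cancel₀ _ hX.ne']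
      rw [h2]
      push_cast
      ring
  simp only [hval] at h
  have h3 : ∀ t : ℝ, ∑' n, F n t = LSeries a (2 + t * I) * (X : ℂ) ^ (2 + t * I + 1) *
        ((2 + t * I) * (2 + t * I + 1))⁻¹ := by
    intro t
    rw [hF]
    simp only
    rw [tsum_mul_right, tsum_mul_right]
    rfl
  simp only [h3] at h
  rw [← h.tsum_eq, tsum_eq_sum (s := Finset.Icc 1 M), Finset.mul_sum]
  · refine Finset.sum_congr rfl fun n hn => ?_
    rw [if_neg (by have := (Finset.mem_Icc.1 hn).1; omega)]
  · intro n hn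
    split_ifs with hn0
    · rfl
    · have h4 : M < n := by
        rw [Finset.mem_Icc] at hn
        omega
      have h5 : X - n ≤ 0 := by
        have : (M : ℝ) < n := by exact_mod_cast h4
        linarith
      rw [max_eq_right h5]
      simp

/-- Integrals over vertical lines agree for holomorphic functions with enough decay. -/
lemma integral_vertical_line_eq {f : ℂ → ℂ} {σ₁ σ₂ C β : ℝ} (h12 : σ₁ ≤ σ₂) (hβ : 1 < β)
    (hf : ∀ s : ℂ, σ₁ ≤ s.re → s.re ≤ σ₂ → DifferentiableAt ℂ f s)
    (hC : ∀ σ t : ℝ, σ₁ ≤ σ → σ ≤ σ₂ → ‖f (σ + t * I)‖ ≤ C * (2 + |t|) ^ (-β)) :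
    ∫ t : ℝ, f (σ₁ + t * I) = ∫ t : ℝ, f (σ₂ + t * I) := by
  have hint : ∀ σ : ℝ, σ₁ ≤ σ → σ ≤ σ₂ → Integrable fun t : ℝ => f (σ + t * I) := by
    intro σ h1 h2
    refine (integrable_two_add_abs_rpow hβ C).mono' ?_ (ae_of_all _ fun t => hC σ t h1 h2)
    refine Continuous.aestronglyMeasurable (continuous_iff_continuousAt.2 fun t => ?_)
    refine ContinuousAt.comp (f := fun t : ℝ => (σ : ℂ) + t * I) (g := f) ?_ (by fun_prop)
    exact (hf _ (by simpa using h1) (by simpa using h2)).continuousAt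
  have hC0 : 0 ≤ C := by
    have := (norm_nonneg _).trans (hC σ₁ 0 le_rfl h12)
    exact nonneg_of_mul_nonneg_left this (by positivity)
  -- Cauchy's theorem on the rectangle of height `2 T`; the decay makes the horizontal sides vanish
  -- as `T → ∞`.
  have hrect : ∀ T : ℝ, (∫ t in (-T)..T, f (σ₂ + t * I)) - ∫ t in (-T)..T, f (σ₁ + t * I) =
      I * ((∫ x in σ₁..σ₂, f (x + (-T : ℝ) * I)) - ∫ x in σ₁..σ₂, f (x + T * I)) := by
    intro T
    have h := Complex.integral_boundary_rect_eq_zero_of_differentiableOn f (σ₁ + (-T : ℝ) * I)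
      (σ₂ + T * I) ?_
    · simp only [add_re, ofReal_re, mul_re, I_re, mul_zero, ofReal_im, I_im, sub_self,
        add_zero, add_im, mul_im, mul_one, zero_add, smul_eq_mul] at h
      have hI := I_mul_I
      linear_combination (-I) * h + ((∫ t in (-T)..T, f (σ₂ + t * I)) -
        ∫ t in (-T)..T, f (σ₁ + t * I)) * hI
    · intro s hs
      have h1 := hs.1
      simp only [add_re, ofReal_re, mul_re, I_re, mul_zero, ofReal_im, I_im, zero_mul, sub_zero,
        add_zero, mem_preimage] at h1
      rw [uIcc_of_le h12] at h1
      exact (hf s h1.1 h1.2).differentiableWithinAt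
  have hhor : ∀ T : ℝ, ‖∫ x in σ₁..σ₂, f (x + T * I)‖ ≤
      C * (2 + |T|) ^ (-β) * |σ₂ - σ₁| := by
    intro T
    refine intervalIntegral.norm_integral_le_of_norm_le_const fun x hx => ?_
    rw [uIoc_of_le h12] at hx
    exact hC x T hx.1.le hx.2
  have hlim0 : Tendsto (fun T : ℝ => C * (2 + |T|) ^ (-β) * |σ₂ - σ₁|) atTop (𝓝 0) := by
    have h1 : Tendsto (fun T : ℝ => 2 + |T|) atTop atTop :=
      tendsto_atTop_add_const_left _ _ tendsto_abs_atTop_atTop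
    have h2 := (tendsto_rpow_neg_atTop (by linarith : 0 < β)).comp h1
    have h3 := (h2.const_mul C).mul_const |σ₂ - σ₁|
    simpa using h3
  have hA : Tendsto (fun T : ℝ => ∫ x in σ₁..σ₂, f (x + T * I)) atTop (𝓝 0) :=
    squeeze_zero_norm hhor hlim0
  have hB : Tendsto (fun T : ℝ => ∫ x in σ₁..σ₂, f (x + (-T : ℝ) * I)) atTop (𝓝 0) :=
    squeeze_zero_norm (fun T => (hhor (-T)).trans_eq (by rw [abs_neg])) hlim0
  have hv : ∀ σ : ℝ, σ₁ ≤ σ → σ ≤ σ₂ → Tendsto (fun T : ℝ => ∫ t in (-T)..T, f (σ + t * I)) atTop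
      (𝓝 (∫ t : ℝ, f (σ + t * I))) := fun σ h1 h2 =>
    intervalIntegral_tendsto_integral (hint σ h1 h2) tendsto_neg_atTop_atBot tendsto_id
  have h1 := (hv σ₂ h12 le_rfl).sub (hv σ₁ le_rfl h12)
  simp only [hrect] at h1
  have h2 := (hB.sub hA).const_mul I
  rw [sub_zero, mul_zero] at h2
  have h3 := tendsto_nhds_unique h1 h2
  exact (sub_eq_zero.1 h3).symm

end

/-! ### Square-root cancellation in the partial sums, and the displacement under GRH. -/

section

open Complex Set MeasureTheory Filter Topology

lemma norm_cpow_add_sub_cpow_le {X y : ℝ} (hX : 0 < X) (hy : 0 ≤ y) {s : ℂ} (hs : 0 ≤ s.re) :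
    ‖((X + y : ℝ) : ℂ) ^ (s + 1) - (X : ℂ) ^ (s + 1)‖ ≤ y * ‖s + 1‖ * (X + y) ^ s.re := by
  have hs1 : s + 1 ≠ 0 := by
    intro h
    have := congrArg re h
    simp at this
    linarith
  have hder : ∀ t ∈ Icc X (X + y), HasDerivWithinAt (fun t : ℝ => (t : ℂ) ^ (s + 1))
      ((s + 1) * (t : ℂ) ^ s) (Icc X (X + y)) t := by
    intro t ht
    have ht0 : t ≠ 0 := (hX.trans_le ht.1).ne'
    have h := hasDerivAt_ofReal_cpow_const (x := t) (r := s + 1) ht0 hs1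
    rw [add_sub_cancel_right] at h
    exact h.hasDerivWithinAt
  have h := Convex.norm_image_sub_le_of_norm_hasDerivWithin_le (C := ‖s + 1‖ * (X + y) ^ s.re)
    hder (fun t ht => ?_) (convex_Icc X (X + y)) (left_mem_Icc.2 (by linarith))
    (right_mem_Icc.2 (by linarith))
  · refine h.trans (le_of_eq ?_)
    rw [add_sub_cancel_left, Real.norm_of_nonneg hy]
    ring
  · have ht0 : 0 < t := hX.trans_le ht.1
    rw [norm_mul, Complex.norm_cpow_eq_rpow_re_of_pos ht0]
    gcongr
    exact ht.2

/-- A geometric mean of the mean value bound, which gains `y` but loses `‖s + 1‖`, and the trivial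
bound, which loses nothing. The saving `‖s + 1‖ ^ (-κ)` makes the integral for the increments
converge. -/
lemma norm_cpow_add_sub_cpow_le_rpow {X y κ : ℝ} (hX : 0 < X) (hy : 0 ≤ y) (hyX : y ≤ X)
    (hκ : 0 ≤ κ) (hκ1 : κ ≤ 1) {s : ℂ} (hs : 0 ≤ s.re) :
    ‖((X + y : ℝ) : ℂ) ^ (s + 1) - (X : ℂ) ^ (s + 1)‖ ≤
      2 * y ^ (1 - κ) * ‖s + 1‖ ^ (1 - κ) * (2 * X) ^ (s.re + κ) := by
  set N := ‖((X + y : ℝ) : ℂ) ^ (s + 1) - (X : ℂ) ^ (s + 1)‖ with hN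
  have hN0 : 0 ≤ N := norm_nonneg _
  have hXy : 0 < X + y := by linarith
  have h2X : 0 < 2 * X := by linarith
  have h1 : N ≤ y * ‖s + 1‖ * (2 * X) ^ s.re := by
    refine (norm_cpow_add_sub_cpow_le hX hy hs).trans ?_
    gcongr
    linarith
  have h2 : N ≤ 2 * (2 * X) ^ (s.re + 1) := by
    refine (norm_sub_le _ _).trans ?_
    rw [Complex.norm_cpow_eq_rpow_re_of_pos hXy, Complex.norm_cpow_eq_rpow_re_of_pos hX, add_re,
      one_re, two_mul ((2 * X) ^ (s.re + 1))]
    gcongr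
    · linarith
    · linarith
  have h3 : N = N ^ (1 - κ) * N ^ κ := by
    rw [← Real.rpow_add_of_nonneg hN0 (by linarith) hκ]
    simp
  rw [h3]
  calc N ^ (1 - κ) * N ^ κ
      ≤ (y * ‖s + 1‖ * (2 * X) ^ s.re) ^ (1 - κ) * (2 * (2 * X) ^ (s.re + 1)) ^ κ := by
        gcongr
    _ = 2 ^ κ * y ^ (1 - κ) * ‖s + 1‖ ^ (1 - κ) *
        ((2 * X) ^ (s.re * (1 - κ)) * (2 * X) ^ ((s.re + 1) * κ)) := by
        generalize 2 * X = Z at h2X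
        rw [Real.mul_rpow (by positivity) (by positivity), Real.mul_rpow hy (by positivity),
          Real.mul_rpow (by norm_num) (by positivity), ← Real.rpow_mul h2X.le,
          ← Real.rpow_mul h2X.le]
        ring
    _ = 2 ^ κ * y ^ (1 - κ) * ‖s + 1‖ ^ (1 - κ) * (2 * X) ^ (s.re + κ) := by
        rw [← Real.rpow_add h2X]
        congr 2
        ring
    _ ≤ _ := by
        gcongr
        calc (2 : ℝ) ^ κ ≤ 2 ^ (1 : ℝ) := Real.rpow_le_rpow_of_exponent_le (by norm_num) hκ1
          _ = 2 := Real.rpow_one 2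

section Perron

variable {a : ℕ → ℂ} {D : ℂ → ℂ}

/-- The smoothed Perron formula, moved to a line to the left of `1`. -/
lemma sum_mul_max_eq_integral_left (ha : ∀ n, ‖a n‖ ≤ 1)
    (hD : DifferentiableOn ℂ D {s | 1 / 2 < s.re})
    (hDa : ∀ s : ℂ, 1 < s.re → LSeries a s = D s) {σ₀ C ε : ℝ} (hσ : 1 / 2 < σ₀) (hσ2 : σ₀ ≤ 2)
    (hε : ε ≤ 1 / 2) (hC0 : 0 ≤ C)
    (hC : ∀ σ t : ℝ, σ₀ ≤ σ → σ ≤ 2 → ‖D (σ + t * I)‖ ≤ C * (2 + |t|) ^ ε)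
    {X : ℝ} (hX : 1 ≤ X) {M : ℕ} (hM : X ≤ M) :
    2 * Real.pi * ∑ n ∈ Finset.Icc 1 M, a n * ((max (X - n) 0 : ℝ) : ℂ) =
      ∫ t : ℝ, D (σ₀ + t * I) * (X : ℂ) ^ (σ₀ + t * I + 1) *
        ((σ₀ + t * I) * (σ₀ + t * I + 1))⁻¹ := by
  have hX0 : 0 < X := by linarith
  have hXc : (X : ℂ) ≠ 0 := by exact_mod_cast hX0.ne'
  rw [sum_mul_max_eq_integral ha hX0 hM]
  have hopen : IsOpen {s : ℂ | 1 / 2 < s.re} := isOpen_lt continuous_const continuous_re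
  have h := integral_vertical_line_eq
    (f := fun s => D s * (X : ℂ) ^ (s + 1) * (s * (s + 1))⁻¹) (σ₁ := σ₀) (σ₂ := 2)
    (C := C * X ^ (3 : ℝ) * 25) (β := 3 / 2) hσ2 (by norm_num) ?_ ?_
  · rw [h]
    congr 1
    ext t
    rw [hDa _ (by simp)]
    simp
  · intro s hs1 hs2
    refine DifferentiableAt.mul (DifferentiableAt.mul ?_ ?_) ?_
    · exact hD.differentiableAt (hopen.mem_nhds (by
        rw [mem_ofPred_eq]
        linarith))
    · exact DifferentiableAt.const_cpow (by fun_prop) (Or.inl hXc)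
    · refine DifferentiableAt.inv (by fun_prop) ?_
      exact mul_ne_zero (ne_zero_of_half_le_re (by linarith)) (add_one_ne_zero_of_re (by linarith))
  · intro σ t h1 h2
    have hre : ((σ : ℂ) + t * I).re = σ := by simp
    have him : ((σ : ℂ) + t * I).im = t := by simp
    have h3 := norm_inv_mul_add_one_le (s := (σ : ℂ) + t * I) (by rw [hre]; linarith)
    rw [him] at h3
    rw [norm_mul, norm_mul, Complex.norm_cpow_eq_rpow_re_of_pos hX0, add_re, hre, one_re]
    have h4 : 1 ≤ 2 + |t| := by linarith [abs_nonneg t]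
    have h5 : X ^ (σ + 1) ≤ X ^ (3 : ℝ) := Real.rpow_le_rpow_of_exponent_le hX (by linarith)
    calc _ ≤ (C * (2 + |t|) ^ ε) * X ^ (3 : ℝ) * (25 * (2 + |t|) ^ (-2 : ℝ)) := by
          have := hC σ t h1 h2
          gcongr
      _ = C * X ^ (3 : ℝ) * 25 * (2 + |t|) ^ (ε + -2) := by
          rw [Real.rpow_add (by positivity)]
          ring
      _ ≤ _ := by
          gcongr
          linarith

/-- The increments of the smoothed sums. -/
lemma exists_norm_increment_le (ha : ∀ n, ‖a n‖ ≤ 1)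
    (hD : DifferentiableOn ℂ D {s | 1 / 2 < s.re})
    (hDa : ∀ s : ℂ, 1 < s.re → LSeries a s = D s) {σ₀ C κ : ℝ} (hσ : 1 / 2 < σ₀) (hσ2 : σ₀ ≤ 2)
    (hκ : 0 < κ) (hκ1 : κ ≤ 1) (hC0 : 0 ≤ C)
    (hC : ∀ σ t : ℝ, σ₀ ≤ σ → σ ≤ 2 → ‖D (σ + t * I)‖ ≤ C * (2 + |t|) ^ (κ / 2)) :
    ∃ B : ℝ, 0 ≤ B ∧ ∀ X y : ℝ, 1 ≤ X → 0 ≤ y → y ≤ X → ∀ M : ℕ, X + y ≤ M →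
      ‖∑ n ∈ Finset.Icc 1 M, a n * ((max (X + y - n) 0 - max (X - n) 0 : ℝ) : ℂ)‖ ≤
        B * y ^ (1 - κ) * X ^ (σ₀ + κ) := by
  -- The exponent is `κ / 2` from `D` plus `-(1 + κ)` from kernel and increment together. The factor
  -- `50` is `2` from the increment times `25` from `‖s‖` and `‖s + 1‖` being at least `(2 + |t|) /
  -- 5`.
  set J := ∫ t : ℝ, C * 50 * (2 + |t|) ^ (-(1 + κ / 2)) with hJ
  have hJ0 : 0 ≤ J := integral_nonneg fun t => by positivity
  refine ⟨J * 2 ^ (σ₀ + κ), by positivity, fun X y hX hy hyX M hM => ?_⟩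
  have hX0 : 0 < X := by linarith
  have e1 := sum_mul_max_eq_integral_left ha hD hDa hσ hσ2 (by linarith : κ / 2 ≤ 1 / 2) hC0 hC
    hX (show X ≤ M by linarith)
  have e2 := sum_mul_max_eq_integral_left ha hD hDa hσ hσ2 (by linarith : κ / 2 ≤ 1 / 2) hC0 hC
    (show 1 ≤ X + y by linarith) hM
  have hopen : IsOpen {s : ℂ | 1 / 2 < s.re} := isOpen_lt continuous_const continuous_re
  have hre : ∀ t : ℝ, ((σ₀ : ℂ) + t * I).re = σ₀ := fun t => by simp
  have him : ∀ t : ℝ, ((σ₀ : ℂ) + t * I).im = t := fun t => by simp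
  have hint : ∀ Y : ℝ, 1 ≤ Y → Integrable fun t : ℝ => D (σ₀ + t * I) *
      (Y : ℂ) ^ (σ₀ + t * I + 1) * ((σ₀ + t * I) * (σ₀ + t * I + 1))⁻¹ := by
    intro Y hY
    have hY0 : 0 < Y := by linarith
    have hYc : (Y : ℂ) ≠ 0 := by exact_mod_cast hY0.ne'
    refine (integrable_two_add_abs_rpow (β := 3 / 2) (by norm_num)
      (C * Y ^ (σ₀ + 1) * 25)).mono' ?_ (ae_of_all _ fun t => ?_)
    · refine Continuous.aestronglyMeasurable ?_
      refine Continuous.mul (Continuous.mul ?_ ?_) (continuous_inv_mul_add_one hσ.le)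
      · refine continuous_iff_continuousAt.2 fun t => ?_
        refine ContinuousAt.comp (f := fun t : ℝ => (σ₀ : ℂ) + t * I) (g := D) ?_ (by fun_prop)
        exact (hD.differentiableAt (hopen.mem_nhds (by
          rw [mem_ofPred_eq, hre]
          exact hσ))).continuousAt
      · exact Continuous.const_cpow (by fun_prop) (Or.inl hYc)
    · have h3 := norm_inv_mul_add_one_le (s := (σ₀ : ℂ) + t * I) (by rw [hre]; exact hσ.le)
      rw [him] at h3
      rw [norm_mul, norm_mul, Complex.norm_cpow_eq_rpow_re_of_pos hY0, add_re, hre, one_re]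
      have h4 : 1 ≤ 2 + |t| := by linarith [abs_nonneg t]
      calc _ ≤ (C * (2 + |t|) ^ (κ / 2)) * Y ^ (σ₀ + 1) * (25 * (2 + |t|) ^ (-2 : ℝ)) := by
            have := hC σ₀ t le_rfl hσ2
            gcongr
        _ = C * Y ^ (σ₀ + 1) * 25 * (2 + |t|) ^ (κ / 2 + -2) := by
            rw [Real.rpow_add (show 0 < 2 + |t| by positivity)]
            ring
        _ ≤ _ := by
            gcongr
            linarith
  have e3 : 2 * Real.pi * ∑ n ∈ Finset.Icc 1 M,
      a n * ((max (X + y - n) 0 - max (X - n) 0 : ℝ) : ℂ) =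
      ∫ t : ℝ, D (σ₀ + t * I) * (((X + y : ℝ) : ℂ) ^ (σ₀ + t * I + 1) -
        (X : ℂ) ^ (σ₀ + t * I + 1)) * ((σ₀ + t * I) * (σ₀ + t * I + 1))⁻¹ := by
    have e4 : ∑ n ∈ Finset.Icc 1 M, a n * ((max (X + y - n) 0 - max (X - n) 0 : ℝ) : ℂ) =
        ∑ n ∈ Finset.Icc 1 M, a n * ((max (X + y - n) 0 : ℝ) : ℂ) -
          ∑ n ∈ Finset.Icc 1 M, a n * ((max (X - n) 0 : ℝ) : ℂ) := by
      rw [← Finset.sum_sub_distrib]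
      refine Finset.sum_congr rfl fun n _ => ?_
      push_cast
      ring
    rw [e4, mul_sub, e1, e2, ← integral_sub (hint _ (by linarith)) (hint _ hX)]
    congr 1
    ext t
    ring
  have e5 : ‖∫ t : ℝ, D (σ₀ + t * I) * (((X + y : ℝ) : ℂ) ^ (σ₀ + t * I + 1) -
        (X : ℂ) ^ (σ₀ + t * I + 1)) * ((σ₀ + t * I) * (σ₀ + t * I + 1))⁻¹‖ ≤
      ∫ t : ℝ, (y ^ (1 - κ) * (2 * X) ^ (σ₀ + κ)) * (C * 50 * (2 + |t|) ^ (-(1 + κ / 2))) := by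
    refine norm_integral_le_of_norm_le
      ((integrable_two_add_abs_rpow (by linarith) _).const_mul _) (ae_of_all _ fun t => ?_)
    set s : ℂ := (σ₀ : ℂ) + t * I with hs
    have hsre : s.re = σ₀ := hre t
    have hsim : s.im = t := him t
    have h1 := norm_cpow_add_sub_cpow_le_rpow hX0 hy hyX hκ.le hκ1 (s := s) (by rw [hsre]; linarith)
    rw [hsre] at h1
    have h2 := two_add_abs_im_le (s := s) (by rw [hsre]; exact hσ.le)
    rw [hsim] at h2
    have h3 := norm_le_norm_add_one (s := s) (by rw [hsre]; linarith)
    have h4 : 0 < 2 + |t| := by positivity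
    have h5 : 0 < ‖s‖ := by linarith
    have h6 : 0 < ‖s + 1‖ := by linarith
    have h7 : ‖s + 1‖ ^ (1 - κ) * (‖s‖ * ‖s + 1‖)⁻¹ ≤ 25 * (2 + |t|) ^ (-(1 + κ)) := by
      have e6 : ‖s + 1‖ ^ (1 - κ) * (‖s‖ * ‖s + 1‖)⁻¹ = ‖s + 1‖ ^ (-κ) * ‖s‖⁻¹ := by
        rw [sub_eq_add_neg, Real.rpow_add h6, Real.rpow_one]
        field_simp
      have e7 : ‖s + 1‖ ^ (-κ) ≤ ((2 + |t|) / 5) ^ (-κ) :=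
        Real.rpow_le_rpow_of_nonpos (by positivity) (by linarith) (by linarith)
      have e8 : ‖s‖⁻¹ ≤ 5 * (2 + |t|)⁻¹ := by
        rw [← div_eq_mul_inv, inv_le_comm₀ h5 (by positivity), inv_div]
        linarith
      have e9 : ((2 + |t|) / 5) ^ (-κ) ≤ 5 * (2 + |t|) ^ (-κ) := by
        rw [Real.div_rpow h4.le (by norm_num), div_eq_mul_inv, ← Real.rpow_neg (by norm_num),
          neg_neg, mul_comm]
        gcongr
        calc (5 : ℝ) ^ κ ≤ 5 ^ (1 : ℝ) := Real.rpow_le_rpow_of_exponent_le (by norm_num) hκ1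
          _ = 5 := Real.rpow_one 5
      rw [e6]
      calc ‖s + 1‖ ^ (-κ) * ‖s‖⁻¹ ≤ (5 * (2 + |t|) ^ (-κ)) * (5 * (2 + |t|)⁻¹) := by
            gcongr
            exact e7.trans e9
        _ = 25 * (2 + |t|) ^ (-(1 + κ)) := by
            rw [neg_add, Real.rpow_add h4, Real.rpow_neg_one]
            ring
    rw [norm_mul, norm_mul, norm_inv, norm_mul]
    calc _ ≤ (C * (2 + |t|) ^ (κ / 2)) * (2 * y ^ (1 - κ) * ‖s + 1‖ ^ (1 - κ) *
          (2 * X) ^ (σ₀ + κ)) * (‖s‖ * ‖s + 1‖)⁻¹ := by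
          have := hC σ₀ t le_rfl hσ2
          gcongr
      _ = (C * (2 + |t|) ^ (κ / 2)) * (2 * y ^ (1 - κ) * (2 * X) ^ (σ₀ + κ)) *
          (‖s + 1‖ ^ (1 - κ) * (‖s‖ * ‖s + 1‖)⁻¹) := by ring
      _ ≤ (C * (2 + |t|) ^ (κ / 2)) * (2 * y ^ (1 - κ) * (2 * X) ^ (σ₀ + κ)) *
          (25 * (2 + |t|) ^ (-(1 + κ))) := by gcongr
      _ = (y ^ (1 - κ) * (2 * X) ^ (σ₀ + κ)) *
          (C * 50 * ((2 + |t|) ^ (κ / 2) * (2 + |t|) ^ (-(1 + κ)))) := by ring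
      _ = _ := by
          rw [← Real.rpow_add h4]
          congr 4
          ring
  rw [integral_const_mul, ← hJ, ← e3, norm_mul] at e5
  have h2π : (1 : ℝ) ≤ ‖(2 * Real.pi : ℂ)‖ := by
    rw [norm_mul, norm_real, Real.norm_of_nonneg Real.pi_pos.le]
    have := Real.pi_gt_three
    simp
    linarith
  refine (le_mul_of_one_le_left (norm_nonneg _) h2π).trans (e5.trans (le_of_eq ?_))
  rw [Real.mul_rpow (by norm_num) hX0.le]
  ring

/-- Square-root cancellation in the partial sums of a Dirichlet series with bounded coefficients
that continues to `Re s > 1 / 2` with subpolynomial growth. -/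
theorem exists_norm_sum_le_rpow (ha : ∀ n, ‖a n‖ ≤ 1)
    (hD : DifferentiableOn ℂ D {s | 1 / 2 < s.re})
    (hDa : ∀ s : ℂ, 1 < s.re → LSeries a s = D s)
    (hC : ∀ δ ε : ℝ, 0 < δ → δ < 1 / 4 → 0 < ε → ∃ C : ℝ, 0 ≤ C ∧ ∀ σ t : ℝ,
      1 / 2 + 2 * δ ≤ σ → σ ≤ 2 → ‖D (σ + t * I)‖ ≤ C * (2 + |t|) ^ ε)
    {α : ℝ} (hα : 1 / 2 < α) :
    ∃ C : ℝ, ∀ N : ℕ, ‖∑ n ∈ Finset.Icc 1 N, a n‖ ≤ C * (N : ℝ) ^ α := by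
  set δ := min ((α - 1 / 2) / 4) (1 / 8) with hδ
  have hδ0 : 0 < δ := lt_min (by linarith) (by norm_num)
  have hδ1 : δ ≤ 1 / 8 := min_le_right _ _
  have hδ2 : δ ≤ (α - 1 / 2) / 4 := min_le_left _ _
  obtain ⟨C, hC0, hC⟩ := hC δ (2 * δ / 2) hδ0 (by linarith) (by linarith)
  obtain ⟨B, hB0, hB⟩ := exists_norm_increment_le ha hD hDa (σ₀ := 1 / 2 + 2 * δ) (C := C)
    (κ := 2 * δ) (by linarith) (by linarith) (by linarith) (by linarith) hC0 hC
  refine ⟨B + 1, fun N => ?_⟩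
  rcases Nat.eq_zero_or_pos N with rfl | hN
  · simp
    positivity
  have hN1 : (1 : ℝ) ≤ N := by exact_mod_cast hN
  -- The increment of the smoothed sum over a step `y` is `y` times the sharp sum up to `N` plus at
  -- most `y ^ 2` from `N < n ≤ N + y`. With `y = √N`, division by `y` leaves errors `N ^ (1/2)` and
  -- `B * N ^ (1/2 + 4 δ)`, and `δ` was chosen so that `1/2 + 4 δ ≤ α`.
  set y := Real.sqrt N with hy
  have hy1 : 1 ≤ y := Real.one_le_sqrt.2 hN1
  have hyy : y * y = N := Real.mul_self_sqrt (by linarith)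
  have hyN : y ≤ N := by nlinarith
  have h1 := hB N y hN1 (by linarith) hyN (N + N) (by push_cast; linarith)
  have h2 : ∑ n ∈ Finset.Icc 1 (N + N), a n * ((max (N + y - n) 0 - max ((N : ℝ) - n) 0 : ℝ) : ℂ) =
      y * ∑ n ∈ Finset.Icc 1 N, a n +
        ∑ n ∈ Finset.Icc (N + 1) (N + N), a n * ((max (N + y - n) 0 : ℝ) : ℂ) := by
    have hdis : Finset.Icc 1 (N + N) = Finset.Icc 1 N ∪ Finset.Icc (N + 1) (N + N) := by
      ext n
      simp only [Finset.mem_Icc, Finset.mem_union]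
      omega
    rw [hdis, Finset.sum_union, Finset.mul_sum]
    · congr 1
      · refine Finset.sum_congr rfl fun n hn => ?_
        have hn1 : (n : ℝ) ≤ N := by exact_mod_cast (Finset.mem_Icc.1 hn).2
        rw [max_eq_left (by linarith), max_eq_left (by linarith)]
        push_cast
        ring
      · refine Finset.sum_congr rfl fun n hn => ?_
        have hn1 : (N : ℝ) ≤ n := by
          have := (Finset.mem_Icc.1 hn).1
          exact_mod_cast (by omega : N ≤ n)
        rw [max_eq_right (by linarith : (N : ℝ) - n ≤ 0), sub_zero]
    · rw [Finset.disjoint_left]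
      intro n hn hn2
      rw [Finset.mem_Icc] at hn hn2
      omega
  have h3 : ‖∑ n ∈ Finset.Icc (N + 1) (N + N), a n * ((max (N + y - n) 0 : ℝ) : ℂ)‖ ≤ y * y := by
    have hsub : ∀ n ∈ Finset.Icc (N + 1) (N + N), n ∉ Finset.Icc (N + 1) (N + ⌊y⌋₊) →
        a n * ((max (N + y - n) 0 : ℝ) : ℂ) = 0 := by
      intro n hn hn2
      have h4 : N + ⌊y⌋₊ + 1 ≤ n := by
        rw [Finset.mem_Icc] at hn hn2
        omega
      have h5 : (N : ℝ) + ⌊y⌋₊ + 1 ≤ n := by exact_mod_cast h4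
      have h6 := Nat.lt_floor_add_one y
      rw [max_eq_right (by linarith)]
      simp
    have hfl : ⌊y⌋₊ ≤ N := by
      have := Nat.floor_le_floor hyN
      simpa using this
    rw [← Finset.sum_subset (Finset.Icc_subset_Icc le_rfl (by omega)) hsub]
    refine (norm_sum_le _ _).trans ?_
    have h7 : ∀ n ∈ Finset.Icc (N + 1) (N + ⌊y⌋₊), ‖a n * ((max (N + y - n) 0 : ℝ) : ℂ)‖ ≤ y := by
      intro n hn
      have hn1 : (N : ℝ) ≤ n := by
        have := (Finset.mem_Icc.1 hn).1
        exact_mod_cast (by omega : N ≤ n)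
      rw [norm_mul, norm_real, Real.norm_of_nonneg (le_max_right _ _)]
      calc _ ≤ 1 * max (N + y - n) 0 := by
            gcongr
            exact ha n
        _ ≤ y := by
            rw [one_mul]
            exact max_le (by linarith) (by linarith)
    refine (Finset.sum_le_card_nsmul _ _ _ h7).trans ?_
    rw [Nat.card_Icc, nsmul_eq_mul]
    gcongr
    have : N + ⌊y⌋₊ + 1 - (N + 1) = ⌊y⌋₊ := by omega
    rw [this]
    exact Nat.floor_le (by linarith)
  rw [h2] at h1
  have h4 : y * ‖∑ n ∈ Finset.Icc 1 N, a n‖ ≤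
      B * y ^ (1 - 2 * δ) * (N : ℝ) ^ (1 / 2 + 2 * δ + 2 * δ) + y * y := by
    have h5 := norm_sub_le (y * ∑ n ∈ Finset.Icc 1 N, a n +
      ∑ n ∈ Finset.Icc (N + 1) (N + N), a n * ((max (N + y - n) 0 : ℝ) : ℂ))
      (∑ n ∈ Finset.Icc (N + 1) (N + N), a n * ((max (N + y - n) 0 : ℝ) : ℂ))
    rw [add_sub_cancel_right, norm_mul, norm_real, Real.norm_of_nonneg (by linarith)] at h5
    linarith
  have h5 : y ^ (1 - 2 * δ) ≤ y := by
    calc y ^ (1 - 2 * δ) ≤ y ^ (1 : ℝ) := Real.rpow_le_rpow_of_exponent_le hy1 (by linarith)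
      _ = y := Real.rpow_one y
  have h6 : (N : ℝ) ^ (1 / 2 + 2 * δ + 2 * δ) ≤ (N : ℝ) ^ α :=
    Real.rpow_le_rpow_of_exponent_le hN1 (by linarith)
  have h7 : y ≤ (N : ℝ) ^ α := by
    rw [hy, Real.sqrt_eq_rpow]
    exact Real.rpow_le_rpow_of_exponent_le hN1 hα.le
  have h8 : y * ‖∑ n ∈ Finset.Icc 1 N, a n‖ ≤ y * ((B + 1) * (N : ℝ) ^ α) := by
    calc _ ≤ B * y * (N : ℝ) ^ α + y * (N : ℝ) ^ α := by
          refine h4.trans ?_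
          gcongr
      _ = _ := by ring
  exact le_of_mul_le_mul_left h8 (by linarith)

end Perron

/-- Under GRH modulo `m`, the displacement of the Farey fractions is `O(Q ^ (1 / 2 + ε))`,
uniformly in `k` and `b`. -/
theorem exists_fareyDisplacement_le_of_GRHModulo {m : ℕ} [NeZero m] (h : GRHModulo m) {ε : ℝ}
    (hε : 0 < ε) : ∃ C : ℝ, ∀ k : ℕ, 2 ≤ k → ∀ b : ℤ, IsCoprime b (m : ℤ) → ∀ Q : ℕ, 1 ≤ Q →
      fareyDisplacement Q k m b ≤ C * (Q : ℝ) ^ (1 / 2 + ε) := by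
  refine exists_fareyDisplacement_le (fun χ α hα => ?_) hε
  have h1 := exists_norm_sum_le_rpow (a := moebiusTwist χ)
    (D := fun s => poleFactor χ s / regularLFunction χ s) (norm_moebiusTwist_le χ) ?_
    (fun s hs => LSeries_moebiusTwist χ hs)
    (fun δ ε hδ hδ2 hε => exists_norm_poleFactor_div_le h χ hδ hδ2 hε) hα
  · obtain ⟨C, hC⟩ := h1
    refine ⟨C, fun x => ?_⟩
    have h2 : mertensTwist χ ∅ x = ∑ n ∈ Finset.Icc 1 x, moebiusTwist χ n := by
      simp [mertensTwist, moebiusTwist]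
    rw [h2]
    exact hC x
  · have hsub : {s : ℂ | 1 / 2 < s.re} ⊆ {s : ℂ | 0 < s.re} := fun s hs => by
      rw [mem_ofPred_eq] at hs ⊢
      linarith
    exact ((differentiableOn_poleFactor χ).mono hsub).div
      ((differentiableOn_regularLFunction χ).mono hsub)
      fun s hs => regularLFunction_ne_zero_of_GRHModulo h χ hs

end

/-! ### Exponential sums over Farey fractions and the weights at primes. -/

section

open Finset ArithmeticFunction
open scoped ArithmeticFunction.Moebius

lemma norm_exp_I_mul_sub_exp_I_mul_le (x y : ℝ) :
    ‖Complex.exp (Complex.I * x) - Complex.exp (Complex.I * y)‖ ≤ |x - y| := by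
  have h : Complex.exp (Complex.I * x) - Complex.exp (Complex.I * y) =
      Complex.exp (Complex.I * y) * (Complex.exp (Complex.I * (x - y : ℝ)) - 1) := by
    rw [mul_sub, ← Complex.exp_add]
    push_cast
    ring_nf
  have h2 : ‖Complex.exp (Complex.I * y)‖ = 1 := by
    rw [mul_comm]
    exact Complex.norm_exp_ofReal_mul_I y
  rw [h, norm_mul, h2, one_mul]
  exact Real.norm_exp_I_mul_ofReal_sub_one_le

/-- The additive character `e(n x) = exp (2 π i n x)`. -/
noncomputable def expMul (n : ℕ) (x : ℝ) : ℂ :=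
  Complex.exp (Complex.I * ((2 * Real.pi * n * x : ℝ) : ℂ))

lemma norm_expMul_sub_le (n : ℕ) (x y : ℝ) :
    ‖expMul n x - expMul n y‖ ≤ 2 * Real.pi * n * |x - y| := by
  refine (norm_exp_I_mul_sub_exp_I_mul_le _ _).trans (le_of_eq ?_)
  have := Real.pi_pos
  rw [← mul_sub, abs_mul, abs_of_nonneg (by positivity)]

lemma sum_expMul_div (n : ℕ) {d : ℕ} (hd : d ≠ 0) :
    ∑ i ∈ range d, expMul n (((i : ℝ) + 1) / d) = if d ∣ n then (d : ℂ) else 0 := by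
  have hdc : (d : ℂ) ≠ 0 := by exact_mod_cast hd
  have hz := Complex.isPrimitiveRoot_exp d hd
  set ω := Complex.exp (2 * Real.pi * Complex.I / d) with hω
  have h1 : ∀ i : ℕ, expMul n (((i : ℝ) + 1) / d) = ω ^ n * (ω ^ n) ^ i := by
    intro i
    rw [← pow_succ', ← pow_mul, hω, ← Complex.exp_nat_mul, expMul]
    congr 1
    push_cast
    field_simp
  simp only [h1]
  rw [← mul_sum]
  split_ifs with hdn
  · rw [(hz.pow_eq_one_iff_dvd n).2 hdn]
    simp
  · have h2 := mul_geom_sum (ω ^ n) d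
    rw [← pow_mul, mul_comm n d, pow_mul, hz.pow_eq_one, one_pow, sub_self] at h2
    rcases mul_eq_zero.1 h2 with h3 | h3
    · exact absurd ((hz.pow_eq_one_iff_dvd n).1 (sub_eq_zero.1 h3)) hdn
    · rw [h3, mul_zero]

lemma sum_Icc_expMul_div (n : ℕ) {d : ℕ} (hd : d ≠ 0) :
    ∑ a ∈ Icc 1 d, expMul n (((a : ℚ) / d : ℚ) : ℝ) = if d ∣ n then (d : ℂ) else 0 := by
  have h : Icc 1 d = Ico 1 (d + 1) := by
    ext a
    simp
  rw [← sum_expMul_div n hd, h, sum_Ico_eq_sum_range, Nat.add_sub_cancel]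
  refine sum_congr rfl fun i _ => ?_
  push_cast
  rw [add_comm]

/-- The exponential sums over Farey fractions measure the displacement. -/
lemma norm_sum_expMul_kFreeFarey_le {n : ℕ} (hn : 1 ≤ n) (Q k m : ℕ) (b : ℤ) :
    ‖∑ γ ∈ kFreeFarey Q k m b, expMul n (γ : ℝ)‖ ≤
      2 * Real.pi * n * fareyDisplacement Q k m b + n := by
  set N := (kFreeFarey Q k m b).card with hN
  have h1 := sum_orderEmbOfFin (kFreeFarey Q k m b) fun γ : ℚ => expMul n (γ : ℝ)
  -- For the equally spaced points `j / N` the sum is `N` if `N ∣ n` and `0` otherwise, hence at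
  -- most `n` as `n ≥ 1`.
  have h2 : ‖∑ j : Fin N, expMul n ((((j : ℕ) : ℝ) + 1) / (N : ℝ))‖ ≤ n := by
    rw [Fin.sum_univ_eq_sum_range (fun i : ℕ => expMul n (((i : ℝ) + 1) / N))]
    rcases eq_or_ne N 0 with h0 | h0
    · simp [h0]
    · rw [sum_expMul_div n h0]
      split_ifs with h3
      · rw [Complex.norm_natCast]
        exact_mod_cast Nat.le_of_dvd (by omega) h3
      · simp
  have h3 : ‖∑ j : Fin N, expMul n (((kFreeFarey Q k m b).orderEmbOfFin rfl j : ℚ) : ℝ) -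
      ∑ j : Fin N, expMul n ((((j : ℕ) : ℝ) + 1) / (N : ℝ))‖ ≤
      2 * Real.pi * n * fareyDisplacement Q k m b := by
    rw [← sum_sub_distrib, fareyDisplacement, mul_sum]
    exact norm_sum_le_of_le _ fun j _ => norm_expMul_sub_le n _ _
  rw [← h1]
  have h4 := norm_sub_norm_le (∑ j : Fin N,
    expMul n (((kFreeFarey Q k m b).orderEmbOfFin rfl j : ℚ) : ℝ))
    (∑ j : Fin N, expMul n ((((j : ℕ) : ℝ) + 1) / (N : ℝ)))
  linarith

/-- A complete exponential sum modulo `d` vanishes unless `d ∣ n`, so the frequency selects which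
weights are seen. -/
lemma sum_expMul_kFreeFarey (n Q k m : ℕ) (b : ℤ) :
    ∑ γ ∈ kFreeFarey Q k m b, expMul n (γ : ℝ) =
      ∑ d ∈ (Icc 1 Q).filter (· ∣ n), (fareyWeight Q k m b d : ℂ) * d := by
  rw [sum_kFreeFarey (fun γ : ℚ => expMul n (γ : ℝ)), sum_filter]
  refine sum_congr rfl fun d hd => ?_
  rw [sum_Icc_expMul_div n (by rw [mem_Icc] at hd; omega)]
  split_ifs <;> simp

/-- The weights of a prime are controlled by the displacement. -/
theorem abs_fareyWeight_prime_le {p : ℕ} (hp : p.Prime) {Q : ℕ} (hQ : 1 ≤ Q) (k m : ℕ) (b : ℤ) :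
    |(fareyWeight Q k m b p : ℝ)| ≤ 2 * (2 * Real.pi * fareyDisplacement Q k m b + 1) := by
  have hS : 0 ≤ fareyDisplacement Q k m b := sum_nonneg fun _ _ => abs_nonneg _
  have hπ := Real.pi_pos
  rcases lt_or_ge Q p with h | h
  · have : fareyWeight Q k m b p = 0 := by
      rw [fareyWeight, Nat.div_eq_of_lt h]
      simp
    rw [this]
    simp
    positivity
  -- Frequency `1` sees `w 1` and frequency `p` sees `w 1 + p * w p`. The bound for the difference
  -- is of order `p`, which cancels, so the result is uniform in `p`.
  have e1 : (Icc 1 Q).filter (· ∣ 1) = {1} := by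
    ext d
    simp only [mem_filter, mem_Icc, Nat.dvd_one, mem_singleton]
    omega
  have e2 : (Icc 1 Q).filter (· ∣ p) = {1, p} := by
    ext d
    simp only [mem_filter, mem_Icc, Nat.dvd_prime hp, mem_insert, mem_singleton]
    have := hp.one_lt
    omega
  have h1 := norm_sum_expMul_kFreeFarey_le le_rfl Q k m b
  have h2 := norm_sum_expMul_kFreeFarey_le hp.one_lt.le Q k m b
  rw [sum_expMul_kFreeFarey, e1, sum_singleton] at h1
  rw [sum_expMul_kFreeFarey, e2, sum_pair hp.one_lt.ne] at h2
  set w₁ := fareyWeight Q k m b 1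
  set w := fareyWeight Q k m b p
  have h3 : ‖(w : ℂ) * p‖ ≤ 2 * Real.pi * p * fareyDisplacement Q k m b + p +
      (2 * Real.pi * fareyDisplacement Q k m b + 1) := by
    have := norm_sub_le ((w₁ : ℂ) * (1 : ℕ) + w * p) (w₁ * (1 : ℕ))
    rw [add_sub_cancel_left] at this
    simp only [Nat.cast_one, mul_one] at h1 h2 this
    linarith
  rw [norm_mul, Complex.norm_intCast, Complex.norm_natCast] at h3
  have hp1 : (1 : ℝ) ≤ p := by exact_mod_cast hp.one_lt.le
  refine le_of_mul_le_mul_right (h3.trans ?_) (by linarith : (0 : ℝ) < p)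
  nlinarith [mul_nonneg hπ.le hS]

end

/-! ### Leading polar terms of combinations of reciprocals. -/

section

open Complex Set Filter Topology

/-- Leading coefficients at a point `s₀` of a combination of reciprocals: if `∑ H i / F i` continues
analytically to `s₀`, then the values `H i s₀` satisfy a linear relation depending only on `F`. -/
theorem exists_leading_coeff {ι : Type*} [Fintype ι] {U : Set ℂ} (hU : IsOpen U)
    (hU2 : IsPreconnected U) {F : ι → ℂ → ℂ} (hF : ∀ i, DifferentiableOn ℂ (F i) U) {z₀ s₀ : ℂ}
    (hz₀ : z₀ ∈ U) (hs₀ : s₀ ∈ U) (hFz : ∀ i, F i z₀ ≠ 0) {i₀ : ι} (hi₀ : F i₀ s₀ = 0) :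
    ∃ a : ι → ℂ, (∃ i, a i ≠ 0) ∧ ∀ (G : ℂ → ℂ) (H : ι → ℂ → ℂ), DifferentiableOn ℂ G U →
      (∀ i, DifferentiableOn ℂ (H i) U) → (∀ᶠ s in 𝓝 z₀, G s = ∑ i, H i s / F i s) →
      ∑ i, H i s₀ * a i = 0 := by
  classical
  have hFa : ∀ i, AnalyticOnNhd ℂ (F i) U := fun i => (hF i).analyticOnNhd hU
  have h1 : ∀ i, ∃ n : ℕ, ∃ g : ℂ → ℂ, AnalyticAt ℂ g s₀ ∧ g s₀ ≠ 0 ∧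
      ∀ᶠ z in 𝓝 s₀, F i z = (z - s₀) ^ n • g z := by
    intro i
    rw [(hFa i s₀ hs₀).exists_eventuallyEq_pow_smul_nonzero_iff]
    intro h
    exact hFz i ((hFa i).eqOn_zero_of_preconnected_of_eventuallyEq_zero hU2 hs₀ h hz₀)
  choose n g hg hg0 hgF using h1
  -- An index of maximal order of vanishing at `s₀`; that order is positive because `F i₀ s₀ = 0`.
  obtain ⟨i₁, -, hi₁⟩ := Finset.exists_max_image Finset.univ n ⟨i₀, Finset.mem_univ i₀⟩
  have hr : 1 ≤ n i₁ := by
    refine le_trans ?_ (hi₁ i₀ (Finset.mem_univ _))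
    by_contra h
    have h0 : n i₀ = 0 := by omega
    have := (hgF i₀).self_of_nhds
    rw [hi₀, h0] at this
    exact hg0 i₀ (by simpa using this.symm)
  -- These are the limits of `(s - s₀) ^ n i₁ / F i s`: with `0 ^ 0 = 1`, they are nonzero exactly
  -- at the indices of maximal order. They involve neither `G` nor `H`.
  refine ⟨fun i => (0 : ℂ) ^ (n i₁ - n i) / g i s₀, ⟨i₁, by simp [hg0]⟩, fun G H hG hH hGH => ?_⟩
  -- Clearing denominators keeps both sides holomorphic on `U`, so the identity theorem applies
  -- across the zeros of the `F i`.
  have hEq : EqOn (fun s => G s * ∏ i, F i s)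
      (fun s => ∑ i, H i s * ∏ j ∈ Finset.univ.erase i, F j s) U := by
    refine AnalyticOnNhd.eqOn_of_preconnected_of_eventuallyEq (z₀ := z₀)
      (DifferentiableOn.analyticOnNhd ?_ hU) (DifferentiableOn.analyticOnNhd ?_ hU) hU2 hz₀ ?_
    · exact hG.mul (DifferentiableOn.fun_finsetProd fun i _ => hF i)
    · exact DifferentiableOn.fun_sum fun i _ =>
        (hH i).mul (DifferentiableOn.fun_finsetProd fun j _ => hF j)
    · have h2 : ∀ᶠ s in 𝓝 z₀, ∀ i, F i s ≠ 0 := by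
        rw [eventually_all]
        exact fun i => (hFa i z₀ hz₀).continuousAt.eventually_ne (hFz i)
      filter_upwards [hGH, h2] with s h3 h4
      rw [h3, Finset.sum_mul]
      refine Finset.sum_congr rfl fun i _ => ?_
      rw [← Finset.mul_prod_erase _ _ (Finset.mem_univ i)]
      have := h4 i
      field_simp
  have hcont : ∀ {f : ℂ → ℂ}, DifferentiableOn ℂ f U → ContinuousAt f s₀ := fun hf =>
    (hf.differentiableAt (hU.mem_nhds hs₀)).continuousAt
  have hev : ∀ᶠ s in 𝓝[≠] s₀, (s - s₀) ^ n i₁ * G s =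
      ∑ i, H i s * ((s - s₀) ^ (n i₁ - n i) / g i s) := by
    have e1 : ∀ᶠ s in 𝓝[≠] s₀, ∀ i, F i s = (s - s₀) ^ n i • g i s :=
      (eventually_all.2 hgF).filter_mono nhdsWithin_le_nhds
    have e2 : ∀ᶠ s in 𝓝[≠] s₀, ∀ i, g i s ≠ 0 :=
      (eventually_all.2 fun i => (hg i).continuousAt.eventually_ne (hg0 i)).filter_mono
        nhdsWithin_le_nhds
    have e3 : ∀ᶠ s in 𝓝[≠] s₀, s ∈ U := 
      mem_nhdsWithin_of_mem_nhds (hU.mem_nhds hs₀)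
    filter_upwards [e1, e2, e3, self_mem_nhdsWithin] with s h1 h2 h3 h4
    have h5 : s - s₀ ≠ 0 := sub_ne_zero.2 h4
    have h6 : ∀ i, F i s ≠ 0 := fun i => by
      rw [h1 i]
      exact smul_ne_zero (pow_ne_zero _ h5) (h2 i)
    have h7 : G s = ∑ i, H i s / F i s := by
      have h8 := hEq h3
      simp only at h8
      have h9 : ∏ i, F i s ≠ 0 := Finset.prod_ne_zero_iff.2 fun i _ => h6 i
      rw [← eq_div_iff h9, Finset.sum_div] at h8
      rw [h8]
      refine Finset.sum_congr rfl fun i _ => ?_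
      rw [← Finset.mul_prod_erase _ _ (Finset.mem_univ i)]
      have h10 : ∏ j ∈ Finset.univ.erase i, F j s ≠ 0 :=
        Finset.prod_ne_zero_iff.2 fun i _ => h6 i
      rw [mul_div_mul_right _ _ h10]
    rw [h7, Finset.mul_sum]
    refine Finset.sum_congr rfl fun i _ => ?_
    have h8 : (s - s₀) ^ n i₁ = (s - s₀) ^ (n i₁ - n i) * (s - s₀) ^ n i := by
      rw [← pow_add, Nat.sub_add_cancel (hi₁ i (Finset.mem_univ _))]
    have h9 := h2 i
    have h10 := pow_ne_zero (n i) h5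
    rw [h1 i, h8, smul_eq_mul]
    field_simp
  have hl : Tendsto (fun s => (s - s₀) ^ n i₁ * G s) (𝓝[≠] s₀) (𝓝 ((s₀ - s₀) ^ n i₁ * G s₀)) := by
    refine tendsto_nhdsWithin_of_tendsto_nhds (ContinuousAt.tendsto (f := fun s =>
      (s - s₀) ^ n i₁ * G s) ?_)
    exact ContinuousAt.mul (by fun_prop) (hcont hG)
  have hR : Tendsto (fun s => ∑ i, H i s * ((s - s₀) ^ (n i₁ - n i) / g i s)) (𝓝[≠] s₀)
      (𝓝 (∑ i, H i s₀ * ((s₀ - s₀) ^ (n i₁ - n i) / g i s₀))) := by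
    refine tendsto_nhdsWithin_of_tendsto_nhds (tendsto_finsetSum _ fun i _ => ?_)
    refine (hcont (hH i)).mul (Tendsto.div ?_ (hg i).continuousAt (hg0 i))
    exact ContinuousAt.tendsto (f := fun s => (s - s₀) ^ (n i₁ - n i)) (by fun_prop)
  have := tendsto_nhds_unique (hl.congr' hev) hR
  rw [sub_self, zero_pow (by omega), zero_mul] at this
  exact this.symm

end

/-! ### The Dirichlet series attached to the weight at a prime. -/

section

open Complex Set Filter Topology Asymptotics
open scoped ArithmeticFunction.Moebius

/-- A Dirichlet series with square-root cancellation in its partial sums continues analytically to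
`Re s > 1 / 2`. -/
theorem exists_differentiableOn_eq_LSeries {a : ℕ → ℂ} (ha : ∀ n, ‖a n‖ ≤ 1)
    (hA : ∀ ε : ℝ, 0 < ε → ∃ C : ℝ, ∀ x : ℕ,
      ‖∑ n ∈ Finset.Icc 1 x, a n‖ ≤ C * (x : ℝ) ^ (1 / 2 + ε)) :
    ∃ G : ℂ → ℂ, DifferentiableOn ℂ G {s | 1 / 2 < s.re} ∧
      ∀ s : ℂ, 1 < s.re → LSeries a s = G s := by
  set A : ℝ → ℂ := fun t => ∑ n ∈ Finset.Icc 1 ⌊t⌋₊, a n with hAdef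
  have hAm : Measurable A :=
    (measurable_from_nat (f := fun x : ℕ => ∑ n ∈ Finset.Icc 1 x, a n)).comp Nat.measurable_floor
  have hAb : ∀ ε : ℝ, 0 < ε → ∃ C : ℝ, ∀ t : ℝ, 1 < t → ‖A t‖ ≤ C * t ^ (1 / 2 + ε) := by
    intro ε hε
    obtain ⟨C, hC⟩ := hA ε hε
    have hC0 : 0 ≤ C := by
      have := (norm_nonneg _).trans (hC 1)
      simpa using this
    refine ⟨C, fun t ht => (hC ⌊t⌋₊).trans ?_⟩
    gcongr
    exact Nat.floor_le (by linarith)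
  refine ⟨fun s => s * tailMellin A s, fun s hs => ?_, fun s hs => ?_⟩
  · rw [mem_ofPred_eq] at hs
    obtain ⟨C, hC⟩ := hAb ((s.re - 1 / 2) / 2) (by linarith)
    exact (differentiableAt_id.mul
      (differentiableAt_tailMellin hAm hC (by linarith))).differentiableWithinAt
  · obtain ⟨C, hC⟩ := hA (1 / 2) (by norm_num)
    refine LSeries_eq_mul_integral a zero_le_one hs
      (LSeriesSummable_of_bounded_of_one_lt_re (fun n _ => ha n) hs) ?_
    refine IsBigO.of_bound C (Eventually.of_forall fun x => (hC x).trans (le_of_eq ?_))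
    rw [Real.norm_of_nonneg (by positivity)]
    norm_num

open Classical in
/-- The coefficients `μ(e)`, restricted to the `e` for which `d * e` is an admissible
denominator. -/
noncomputable def fareyMoebius (k m : ℕ) (b : ℤ) (d e : ℕ) : ℂ :=
  if IsFareyDenominator k m b (d * e) then (μ e : ℂ) else 0

lemma norm_fareyMoebius_le (k m : ℕ) (b : ℤ) (d e : ℕ) : ‖fareyMoebius k m b d e‖ ≤ 1 := by
  rw [fareyMoebius]
  split_ifs
  · rw [norm_intCast]
    exact_mod_cast ArithmeticFunction.abs_moebius_le_one
  · simp

lemma sum_fareyMoebius (k m : ℕ) (b : ℤ) {d : ℕ} (hd : 0 < d) (x : ℕ) :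
    ∑ e ∈ Finset.Icc 1 x, fareyMoebius k m b d e = fareyWeight (d * x) k m b d := by
  classical
  rw [fareyWeight, Nat.mul_div_cancel_left _ hd, Int.cast_sum, Finset.sum_filter]
  rfl

/-- With `Q = p * x` the partial sum up to `x` is exactly the weight at `p`. As `p` is fixed, its
power goes into the constant. -/
lemma exists_norm_sum_fareyMoebius_le {k m : ℕ} {b : ℤ}
    (h : ∀ ε : ℝ, 0 < ε → ∃ C : ℝ, ∀ Q : ℕ, 1 ≤ Q →
      fareyDisplacement Q k m b ≤ C * (Q : ℝ) ^ (1 / 2 + ε)) {p : ℕ} (hp : p.Prime) {ε : ℝ}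
    (hε : 0 < ε) : ∃ C : ℝ, ∀ x : ℕ,
      ‖∑ e ∈ Finset.Icc 1 x, fareyMoebius k m b p e‖ ≤ C * (x : ℝ) ^ (1 / 2 + ε) := by
  obtain ⟨C, hC⟩ := h ε hε
  refine ⟨2 * (2 * Real.pi * (C * (p : ℝ) ^ (1 / 2 + ε)) + 1), fun x => ?_⟩
  rcases Nat.eq_zero_or_pos x with rfl | hx
  · rw [Nat.cast_zero, Real.zero_rpow (by linarith)]
    simp
  have hpx : 1 ≤ p * x := Nat.mul_pos hp.pos hx
  rw [sum_fareyMoebius k m b hp.pos, norm_intCast]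
  refine (abs_fareyWeight_prime_le hp hpx k m b).trans ?_
  have h1 := hC _ hpx
  rw [Nat.cast_mul, Real.mul_rpow (by positivity) (by positivity)] at h1
  have h2 : (1 : ℝ) ≤ (x : ℝ) ^ (1 / 2 + ε) :=
    Real.one_le_rpow (by exact_mod_cast hx) (by linarith)
  have hπ := Real.pi_pos
  have h3 := mul_le_mul_of_nonneg_left h1 (by positivity : 0 ≤ 2 * Real.pi)
  nlinarith

section

variable {m : ℕ} [NeZero m]

/-- The Euler factor at `p` by which `1 / L(s, χ)` is modified when `k = 2`. -/
noncomputable def squarefreeFactor {m : ℕ} (k : ℕ) (χ : DirichletCharacter ℂ m) (p : ℕ) (s : ℂ) : ℂ :=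
  if k = 2 then (1 - χ p * (p : ℂ) ^ (-s))⁻¹ else 1

lemma norm_char_mul_cpow_lt_one {m : ℕ} (χ : DirichletCharacter ℂ m) {p : ℕ} (hp : p.Prime) {s : ℂ}
    (hs : 0 < s.re) : ‖χ p * (p : ℂ) ^ (-s)‖ < 1 := by
  rw [norm_mul, Complex.norm_natCast_cpow_of_pos hp.pos, neg_re]
  refine (mul_le_of_le_one_left (by positivity) (χ.norm_le_one _)).trans_lt ?_
  exact Real.rpow_lt_one_of_one_lt_of_neg (by exact_mod_cast hp.one_lt) (by linarith)

lemma one_sub_char_mul_cpow_ne_zero {m : ℕ} (χ : DirichletCharacter ℂ m) {p : ℕ} (hp : p.Prime) {s : ℂ}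
    (hs : 0 < s.re) : 1 - χ p * (p : ℂ) ^ (-s) ≠ 0 := by
  intro h
  have := norm_char_mul_cpow_lt_one χ hp hs
  rw [← sub_eq_zero.1 h, norm_one] at this
  exact lt_irrefl _ this

lemma differentiableOn_squarefreeFactor {m : ℕ} (k : ℕ) (χ : DirichletCharacter ℂ m) {p : ℕ}
    (hp : p.Prime) : DifferentiableOn ℂ (squarefreeFactor k χ p) {s | 0 < s.re} := by
  intro s hs
  rw [mem_ofPred_eq] at hs
  have hp0 : (p : ℂ) ≠ 0 := by exact_mod_cast hp.ne_zero
  unfold squarefreeFactor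
  split_ifs
  · refine DifferentiableAt.differentiableWithinAt (DifferentiableAt.inv ?_
      (one_sub_char_mul_cpow_ne_zero χ hp hs))
    refine (differentiableAt_const _).sub ((differentiableAt_const _).mul ?_)
    exact DifferentiableAt.const_cpow (by fun_prop) (Or.inl hp0)
  · exact differentiableWithinAt_const _

/-- Raising the level to `m * p` imposes `p ∤ e`; if `p ∣ m` already, both sides vanish at multiples
of `p`. -/
lemma changeLevel_natCast {m : ℕ} (χ : DirichletCharacter ℂ m) {p : ℕ} (hp : p.Prime) (e : ℕ) :
    DirichletCharacter.changeLevel (dvd_mul_right m p) χ (e : ZMod (m * p)) =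
      if p ∣ e then 0 else χ e := by
  by_cases h : Nat.Coprime e (m * p)
  · have h1 := DirichletCharacter.changeLevel_eq_cast_of_dvd χ (dvd_mul_right m p)
      (ZMod.unitOfCoprime e h)
    rw [ZMod.coe_unitOfCoprime, ZMod.cast_natCast (dvd_mul_right m p)] at h1
    rw [h1, if_neg]
    exact (Nat.Prime.coprime_iff_not_dvd hp).1 (Nat.Coprime.coprime_mul_left_right h).symm
  · rw [MulChar.map_nonunit _ (by rwa [ZMod.isUnit_iff_coprime])]
    split_ifs with h1
    · rfl
    · rw [MulChar.map_nonunit]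
      rw [ZMod.isUnit_iff_coprime]
      exact fun h2 => h (h2.mul_right ((Nat.Prime.coprime_iff_not_dvd hp).2 h1).symm)

lemma LFunction_changeLevel_mul_prime (χ : DirichletCharacter ℂ m) {p : ℕ} (hp : p.Prime)
    [NeZero (m * p)] {s : ℂ} (hs : s ≠ 1) :
    DirichletCharacter.LFunction (DirichletCharacter.changeLevel (dvd_mul_right m p) χ) s =
      DirichletCharacter.LFunction χ s * (1 - χ p * (p : ℂ) ^ (-s)) := by
  rw [DirichletCharacter.LFunction_changeLevel _ χ (Or.inr hs)]
  congr 1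
  refine Finset.prod_eq_single p (fun q hq hqp => ?_) fun h => ?_
  · have hq1 := Nat.prime_of_mem_primeFactors hq
    have hq2 : q ∣ m := ((hq1.dvd_mul).1 (Nat.dvd_of_mem_primeFactors hq)).resolve_right
      fun h => hqp ((Nat.prime_dvd_prime_iff_eq hq1 hp).1 h)
    rw [MulChar.map_nonunit]
    · simp
    · rw [ZMod.isUnit_iff_coprime, hq1.coprime_iff_not_dvd]
      exact not_not.2 hq2
  · exact absurd (Nat.mem_primeFactors.2 ⟨hp, dvd_mul_left p m, NeZero.ne _⟩) h

/-- For `k = 2` the restriction `p ∤ e` is a change of level, which removes the Euler factor at `p`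
from `L(s, χ)`; otherwise there is no restriction. -/
lemma LSeries_moebiusTwist_ite (k : ℕ) (χ : DirichletCharacter ℂ m) {p : ℕ} (hp : p.Prime) {s : ℂ}
    (hs : 1 < s.re) :
    LSeries (fun e => if k = 2 ∧ p ∣ e then 0 else moebiusTwist χ e) s =
      poleFactor χ s * squarefreeFactor k χ p s / regularLFunction χ s := by
  have hs1 : s ≠ 1 := by
    rintro rfl
    simp at hs
  by_cases hk : k = 2
  · have : NeZero (m * p) := ⟨mul_ne_zero (NeZero.ne m) hp.ne_zero⟩
    have h1 : (fun e => if k = 2 ∧ p ∣ e then 0 else moebiusTwist χ e) =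
        moebiusTwist (DirichletCharacter.changeLevel (dvd_mul_right m p) χ) := by
      ext e
      rw [moebiusTwist, moebiusTwist, changeLevel_natCast χ hp]
      simp only [hk, true_and]
      split_ifs <;> simp
    have h2 : regularLFunction χ s ≠ 0 := regularLFunction_ne_zero_of_one_le_re χ hs.le
    rw [regularLFunction_eq χ hs1] at h2
    rw [h1, LSeries_moebiusTwist_eq_inv _ hs, LFunction_changeLevel_mul_prime χ hp hs1,
      regularLFunction_eq χ hs1, squarefreeFactor, if_pos hk]
    have h3 := one_sub_char_mul_cpow_ne_zero χ hp (by linarith : 0 < s.re)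
    have h4 := left_ne_zero_of_mul h2
    have h5 := right_ne_zero_of_mul h2
    field_simp
  · simp only [hk, false_and, if_false, squarefreeFactor, mul_one]
    exact LSeries_moebiusTwist χ hs

/-- For squarefree `e` the exponent of `p` in `p * e` is at most `2` and the others at most `1`, so
only `k = 2` imposes a condition. -/
lemma isPowFree_prime_mul_iff {k p e : ℕ} (hk : 2 ≤ k) (hp : p.Prime) (he : Squarefree e) :
    IsPowFree k (p * e) ↔ ¬ (k = 2 ∧ p ∣ e) := by
  have hpk : IsPowFree k p := by
    intro q hq h
    have h1 : q ^ 2 ∣ p := (pow_dvd_pow q hk).trans h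
    have h2 : q = p := (Nat.prime_dvd_prime_iff_eq hq hp).1 ((dvd_pow_self q two_ne_zero).trans h1)
    subst h2
    have := Nat.le_of_dvd hp.pos h1
    nlinarith [hp.one_lt]
  rw [isPowFree_mul_iff hk hpk hp.ne_zero he, hp.primeFactors]
  have h3 : p ^ (k - 1) ∣ p ↔ k = 2 := by
    constructor
    · intro h
      have h4 := (Nat.pow_dvd_pow_iff_le_right hp.one_lt).1 (h.trans (pow_one p).symm.dvd)
      omega
    · rintro rfl
      simp
  simp [h3]

lemma totient_mul_fareyMoebius {k : ℕ} (hk : 2 ≤ k) {b : ℤ} (hb : IsCoprime b (m : ℤ)) {p : ℕ}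
    (hp : p.Prime) (e : ℕ) :
    (m.totient : ℂ) * fareyMoebius k m b p e = ∑ χ : DirichletCharacter ℂ m,
      χ (b : ZMod m)⁻¹ * χ p * if k = 2 ∧ p ∣ e then 0 else moebiusTwist χ e := by
  by_cases he : Squarefree e
  · have hbu : IsUnit (b : ZMod m) := by
      rwa [ZMod.coe_int_isUnit_iff_isCoprime, isCoprime_comm]
    rw [fareyMoebius, IsFareyDenominator, isPowFree_prime_mul_iff hk hp he]
    by_cases h : k = 2 ∧ p ∣ e
    · simp [h]
    · simp only [h, not_false_eq_true, true_and, if_false]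
      have h1 := DirichletCharacter.sum_char_inv_mul_char_eq ℂ hbu ((p * e : ℕ) : ZMod m)
      have h2 : (((p * e : ℕ) : ℤ) ≡ b [ZMOD (m : ℤ)]) ↔ (b : ZMod m) = ((p * e : ℕ) : ZMod m) := by
        rw [← ZMod.intCast_eq_intCast_iff, eq_comm]
        simp
      have h3 : ∑ χ : DirichletCharacter ℂ m, χ (b : ZMod m)⁻¹ * χ p * moebiusTwist χ e =
          (∑ χ : DirichletCharacter ℂ m, χ (b : ZMod m)⁻¹ * χ ((p * e : ℕ) : ZMod m)) * μ e := by
        rw [Finset.sum_mul]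
        refine Finset.sum_congr rfl fun χ _ => ?_
        rw [moebiusTwist, Nat.cast_mul, map_mul]
        ring
      rw [h3, h1, if_congr h2 rfl rfl]
      split_ifs <;> simp
  · have h0 : μ e = 0 := ArithmeticFunction.moebius_eq_zero_of_not_squarefree he
    rw [fareyMoebius, h0]
    simp [moebiusTwist, h0]

/-- The Dirichlet series of `fareyMoebius` in terms of Dirichlet `L`-functions. -/
theorem totient_mul_LSeries_fareyMoebius {k : ℕ} (hk : 2 ≤ k) {b : ℤ} (hb : IsCoprime b (m : ℤ))
    {p : ℕ} (hp : p.Prime) {s : ℂ} (hs : 1 < s.re) :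
    (m.totient : ℂ) * LSeries (fareyMoebius k m b p) s = ∑ χ : DirichletCharacter ℂ m,
      χ (b : ZMod m)⁻¹ * χ p * (poleFactor χ s * squarefreeFactor k χ p s) /
        regularLFunction χ s := by
  have h1 : (m.totient : ℂ) • fareyMoebius k m b p = ∑ χ : DirichletCharacter ℂ m,
      (χ (b : ZMod m)⁻¹ * χ p) • fun e : ℕ => if k = 2 ∧ p ∣ e then 0 else moebiusTwist χ e := by
    ext e
    rw [Pi.smul_apply, smul_eq_mul, totient_mul_fareyMoebius hk hb hp, Finset.sum_apply]
    rfl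
  rw [← LSeries_smul, h1, LSeries_sum]
  · refine Finset.sum_congr rfl fun χ _ => ?_
    rw [LSeries_smul, LSeries_moebiusTwist_ite k χ hp hs]
    ring
  · intro χ _
    refine LSeriesSummable.smul _ (LSeriesSummable_of_bounded_of_one_lt_re (m := 1)
      (fun n _ => ?_) hs)
    split_ifs
    · simp
    · exact norm_moebiusTwist_le χ n

end

end

/-! ### Exclusion of zeros off the critical line. -/

section

open Complex Set Filter Topology

lemma gammaFactor_ne_zero {N : ℕ} (χ : DirichletCharacter ℂ N) {s : ℂ} (hs : 0 < s.re) :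
    DirichletCharacter.gammaFactor χ s ≠ 0 := by
  rw [DirichletCharacter.gammaFactor]
  split_ifs
  · exact Gammaℝ_ne_zero_of_re_pos hs
  · refine Gammaℝ_ne_zero_of_re_pos ?_
    rw [add_re, one_re]
    linarith

section

variable {m : ℕ} [NeZero m]

/-- The nontrivial zeros of Dirichlet `L`-functions are symmetric under `s ↦ 1 - s`, `χ ↦ χ⁻¹`. -/
theorem LFunction_inv_one_sub_eq_zero (χ : DirichletCharacter ℂ m) {s : ℂ} (hs0 : 0 < s.re)
    (hs1 : s.re < 1) (h : DirichletCharacter.LFunction χ s = 0) :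
    DirichletCharacter.LFunction χ⁻¹ (1 - s) = 0 := by
  -- The functional equation is used for the primitive character inducing `χ`. The Euler factors
  -- relating the two do not vanish for `Re s > 0`, so the zero passes to the primitive character,
  -- and after reflection back to level `m`.
  set N := χ.conductor with hN
  set ψ := χ.primitiveCharacter with hψ
  have hdvd : N ∣ m := χ.conductor_dvd_level
  have : NeZero N := ⟨fun h0 => NeZero.ne m (Nat.eq_zero_of_zero_dvd (h0 ▸ hdvd))⟩
  have hχ : DirichletCharacter.changeLevel hdvd ψ = χ := χ.changeLevel_primitiveCharacter
  have hprim : ψ⁻¹.IsPrimitive := by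
    have h1 := χ.primitiveCharacter_isPrimitive
    rw [DirichletCharacter.IsPrimitive] at h1 ⊢
    rw [DirichletCharacter.conductor_inv, h1]
  have hne : s ≠ 1 := by
    rintro rfl
    simp at hs1
  have hne0 : s ≠ 0 := by
    rintro rfl
    simp at hs0
  have hsub0 : 1 - s ≠ 0 := sub_ne_zero.2 hne.symm
  have hsub1 : 1 - s ≠ 1 := by simpa using hne0
  have h2 : DirichletCharacter.LFunction ψ s = 0 := by
    rw [← hχ, DirichletCharacter.LFunction_changeLevel hdvd ψ (Or.inr hne)] at h
    refine (mul_eq_zero.1 h).resolve_right (Finset.prod_ne_zero_iff.2 fun p hp => ?_)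
    exact one_sub_char_mul_cpow_ne_zero ψ (Nat.prime_of_mem_primeFactors hp) hs0
  have h3 : DirichletCharacter.completedLFunction ψ s = 0 := by
    rw [DirichletCharacter.LFunction_eq_completed_div_gammaFactor ψ s (Or.inl hne0)] at h2
    exact (div_eq_zero_iff.1 h2).resolve_right (gammaFactor_ne_zero ψ hs0)
  have h4 : DirichletCharacter.LFunction ψ⁻¹ (1 - s) = 0 := by
    rw [DirichletCharacter.LFunction_eq_completed_div_gammaFactor _ _ (Or.inl hsub0),
      hprim.completedLFunction_one_sub, inv_inv, h3, mul_zero, zero_div]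
  rw [← hχ, ← map_inv, DirichletCharacter.LFunction_changeLevel hdvd _ (Or.inr hsub1), h4,
    zero_mul]

/-- A linear relation between the values of all Dirichlet characters at the units is trivial. -/
lemma eq_zero_of_sum_char_mul_eq_zero {c : DirichletCharacter ℂ m → ℂ}
    (h : ∀ u : ZMod m, IsUnit u → ∑ χ : DirichletCharacter ℂ m, χ u * c χ = 0)
    (χ : DirichletCharacter ℂ m) : c χ = 0 := by
  have h1 : LinearIndependent ℂ fun χ : DirichletCharacter ℂ m => (χ : ZMod m → ℂ) :=
    (linearIndependent_monoidHom (ZMod m) ℂ).comp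
      (fun χ : DirichletCharacter ℂ m => χ.toMonoidHom) fun χ ψ hχ => by
        ext u
        exact DFunLike.congr_fun hχ (u : ZMod m)
  refine Fintype.linearIndependent_iff.1 h1 c ?_ χ
  ext u
  rw [Finset.sum_apply, Pi.zero_apply]
  by_cases hu : IsUnit u
  · rw [← h u hu]
    refine Finset.sum_congr rfl fun χ _ => ?_
    rw [Pi.smul_apply, smul_eq_mul, mul_comm]
  · refine Finset.sum_eq_zero fun χ _ => ?_
    rw [Pi.smul_apply, MulChar.map_nonunit _ hu, smul_zero]

/-- The Euler factor special to `k = 2` disappears along large primes, so all `k ≥ 2` lead to the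
same limiting relation. -/
lemma tendsto_squarefreeFactor {m : ℕ} (k : ℕ) (χ : DirichletCharacter ℂ m) {s : ℂ} (hs : 0 < s.re)
    {p : ℕ → ℕ} (hp : Tendsto p atTop atTop) :
    Tendsto (fun n => squarefreeFactor k χ (p n) s) atTop (𝓝 1) := by
  unfold squarefreeFactor
  split_ifs
  · have h1 : Tendsto (fun n => χ (p n) * ((p n : ℕ) : ℂ) ^ (-s)) atTop (𝓝 0) := by
      have h2 : Tendsto (fun n => ((p n : ℕ) : ℝ) ^ (-s.re)) atTop (𝓝 0) :=
        (tendsto_rpow_neg_atTop hs).comp (tendsto_natCast_atTop_atTop.comp hp)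
      refine squeeze_zero_norm' ?_ h2
      filter_upwards [hp.eventually_gt_atTop 0] with n hn
      rw [norm_mul, Complex.norm_natCast_cpow_of_pos hn, neg_re]
      exact mul_le_of_le_one_left (by positivity) (χ.norm_le_one _)
    have h3 := (tendsto_const_nhds (x := (1 : ℂ))).sub h1
    rw [sub_zero] at h3
    have h4 := h3.inv₀ one_ne_zero
    rwa [inv_one] at h4
  · exact tendsto_const_nhds

/-- If the displacement is `O(Q ^ (1 / 2 + ε))`, the `L`-functions modulo `m` do not vanish to the
right of the critical line. -/
theorem LFunction_ne_zero_of_fareyDisplacement_le {k : ℕ} (hk : 2 ≤ k) {b : ℤ}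
    (hb : IsCoprime b (m : ℤ))
    (h : ∀ ε : ℝ, 0 < ε → ∃ C : ℝ, ∀ Q : ℕ, 1 ≤ Q →
      fareyDisplacement Q k m b ≤ C * (Q : ℝ) ^ (1 / 2 + ε))
    (χ₀ : DirichletCharacter ℂ m) {s₀ : ℂ} (hs : 1 / 2 < s₀.re) (hs1 : s₀.re < 1) :
    DirichletCharacter.LFunction χ₀ s₀ ≠ 0 := by
  intro hzero
  have hne : s₀ ≠ 1 := by
    rintro rfl
    simp at hs1
  have hopen : IsOpen {s : ℂ | 1 / 2 < s.re} := isOpen_lt continuous_const continuous_re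
  have hsub : {s : ℂ | 1 / 2 < s.re} ⊆ {s : ℂ | 0 < s.re} := fun s hs => by
    rw [mem_ofPred_eq] at hs ⊢
    linarith
  have hz : regularLFunction χ₀ s₀ = 0 := by
    rw [regularLFunction_eq χ₀ hne, hzero, mul_zero]
  -- The coefficients `a` are fixed here, before any prime is chosen; the prime enters only through
  -- the numerators `H`.
  obtain ⟨a, ⟨χ₁, ha⟩, hrel⟩ := exists_leading_coeff (z₀ := 2) hopen
    (convex_halfSpace_re_gt (1 / 2)).isPreconnected
    (fun χ : DirichletCharacter ℂ m => (differentiableOn_regularLFunction χ).mono hsub)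
    (by rw [mem_ofPred_eq]; norm_num) hs
    (fun χ => regularLFunction_ne_zero_of_one_le_re χ (by norm_num)) hz
  have hprime : ∀ p : ℕ, p.Prime → ∑ χ : DirichletCharacter ℂ m,
      χ (b : ZMod m)⁻¹ * χ p * (poleFactor χ s₀ * squarefreeFactor k χ p s₀) * a χ = 0 := by
    intro p hp
    obtain ⟨G, hG, hGL⟩ := exists_differentiableOn_eq_LSeries (norm_fareyMoebius_le k m b p)
      fun ε hε => exists_norm_sum_fareyMoebius_le h hp hε
    refine hrel (fun s => (m.totient : ℂ) * G s)
      (fun χ s => χ (b : ZMod m)⁻¹ * χ p * (poleFactor χ s * squarefreeFactor k χ p s))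
      (hG.const_mul _) (fun χ => ?_) ?_
    · exact (((differentiableOn_poleFactor χ).mul
        (differentiableOn_squarefreeFactor k χ hp)).mono hsub).const_mul _
    · have h2 : ∀ᶠ s : ℂ in 𝓝 2, 1 < s.re :=
        (isOpen_lt continuous_const continuous_re).mem_nhds (by
          rw [mem_ofPred_eq]
          norm_num)
      filter_upwards [h2] with s hs
      rw [← hGL s hs]
      exact totient_mul_LSeries_fareyMoebius hk hb hp hs
  -- Dirichlet's theorem supplies primes tending to infinity in the class `u`. Along them `χ p = χ
  -- u` is constant and the Euler factor tends to `1`, leaving a relation between characters at `u`.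
  have hunit : ∀ u : ZMod m, IsUnit u → ∑ χ : DirichletCharacter ℂ m,
      χ u * (χ (b : ZMod m)⁻¹ * poleFactor χ s₀ * a χ) = 0 := by
    intro u hu
    choose p hpn hp hpu using Nat.forall_exists_prime_gt_and_eq_mod hu
    have htop : Tendsto p atTop atTop :=
      tendsto_atTop_mono (fun n => (hpn n).le) tendsto_id
    have h1 : Tendsto (fun n => ∑ χ : DirichletCharacter ℂ m,
        χ (b : ZMod m)⁻¹ * χ u * (poleFactor χ s₀ * squarefreeFactor k χ (p n) s₀) * a χ) atTop
        (𝓝 (∑ χ : DirichletCharacter ℂ m,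
          χ (b : ZMod m)⁻¹ * χ u * (poleFactor χ s₀ * 1) * a χ)) :=
      tendsto_finsetSum _ fun χ _ => (((tendsto_squarefreeFactor k χ (by linarith)
        htop).const_mul _).const_mul _).mul_const _
    have h2 : ∀ n, ∑ χ : DirichletCharacter ℂ m,
        χ (b : ZMod m)⁻¹ * χ u * (poleFactor χ s₀ * squarefreeFactor k χ (p n) s₀) * a χ = 0 := by
      intro n
      have := hprime (p n) (hp n)
      rwa [hpu n] at this
    simp only [h2] at h1
    rw [← tendsto_nhds_unique h1 tendsto_const_nhds]
    refine Finset.sum_congr rfl fun χ _ => ?_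
    ring
  have h1 := eq_zero_of_sum_char_mul_eq_zero hunit χ₁
  have hbu : IsUnit (b : ZMod m)⁻¹ := by
    have : IsUnit (b : ZMod m) := by
      rwa [ZMod.coe_int_isUnit_iff_isCoprime, isCoprime_comm]
    obtain ⟨v, hv⟩ := this
    rw [← hv, ZMod.inv_coe_unit]
    exact v⁻¹.isUnit
  -- Independence of the characters makes this product vanish, yet each of its three factors is
  -- nonzero.
  refine mul_ne_zero (mul_ne_zero ?_ (poleFactor_ne_zero χ₁ (by linarith) hne)) ha h1
  exact ((hbu.map χ₁).ne_zero)

/-- The displacement bound for one family of Farey fractions implies GRH modulo `m`. -/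
theorem GRHModulo_of_fareyDisplacement_le {k : ℕ} (hk : 2 ≤ k) {b : ℤ}
    (hb : IsCoprime b (m : ℤ))
    (h : ∀ ε : ℝ, 0 < ε → ∃ C : ℝ, ∀ Q : ℕ, 1 ≤ Q →
      fareyDisplacement Q k m b ≤ C * (Q : ℝ) ^ (1 / 2 + ε)) : GRHModulo m := by
  intro χ s hzero hs0 hs1
  rcases lt_trichotomy s.re (1 / 2) with h1 | h1 | h1
  · refine absurd (LFunction_inv_one_sub_eq_zero χ hs0 hs1 hzero)
      (LFunction_ne_zero_of_fareyDisplacement_le hk hb h χ⁻¹ ?_ ?_)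
    · rw [sub_re, one_re]
      linarith
    · rw [sub_re, one_re]
      linarith
  · exact h1
  · exact absurd hzero (LFunction_ne_zero_of_fareyDisplacement_le hk hb h χ h1 hs1)

end

end

/-- The uniform bound is needed at a single family to recover GRH; `k = 2`, `b = 1` is available for
every `m`. -/
lemma GRHModulo_iff_forall_fareyDisplacement_le (m : ℕ) [NeZero m] :
    GRHModulo m ↔ ∀ ε : ℝ, 0 < ε → ∃ C : ℝ,
      ∀ k : ℕ, 2 ≤ k → ∀ b : ℤ, IsCoprime b (m : ℤ) → ∀ Q : ℕ, 1 ≤ Q →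
        fareyDisplacement Q k m b ≤ C * (Q : ℝ) ^ (1 / 2 + ε) := by
  refine ⟨fun h ε hε => exists_fareyDisplacement_le_of_GRHModulo h hε, fun h => ?_⟩
  refine GRHModulo_of_fareyDisplacement_le le_rfl (isCoprime_one_left (x := (m : ℤ)))
    fun ε hε => ?_
  obtain ⟨C, hC⟩ := h ε hε
  exact ⟨C, hC 2 le_rfl 1 isCoprime_one_left⟩

theorem theorem2 :
    -- the criterion for all Dirichlet `L`-functions, the constant depending only on `m` and `ε`
    (GRH ↔ ∀ (m : ℕ) [NeZero m], ∀ ε : ℝ, 0 < ε → ∃ C : ℝ,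
      ∀ k : ℕ, 2 ≤ k → ∀ b : ℤ, IsCoprime b (m : ℤ) → ∀ Q : ℕ, 1 ≤ Q →
        fareyDisplacement Q k m b ≤ C * (Q : ℝ) ^ (1 / 2 + ε)) ∧
    ∀ (m : ℕ) [NeZero m],
      -- the criterion for a given modulus, the constant depending only on `m` and `ε`
      (GRHModulo m ↔ ∀ ε : ℝ, 0 < ε → ∃ C : ℝ,
        ∀ k : ℕ, 2 ≤ k → ∀ b : ℤ, IsCoprime b (m : ℤ) → ∀ Q : ℕ, 1 ≤ Q →
          fareyDisplacement Q k m b ≤ C * (Q : ℝ) ^ (1 / 2 + ε)) ∧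
      -- the criterion for a single family of fractions, with `m`, `k`, `b` given
      ∀ k : ℕ, 2 ≤ k → ∀ b : ℤ, IsCoprime b (m : ℤ) →
        (GRHModulo m ↔ ∀ ε : ℝ, 0 < ε → ∃ C : ℝ, ∀ Q : ℕ, 1 ≤ Q →
          fareyDisplacement Q k m b ≤ C * (Q : ℝ) ^ (1 / 2 + ε)) := by

  refine ⟨⟨fun h m _ => (GRHModulo_iff_forall_fareyDisplacement_le m).1 (h m),
    fun h m _ => (GRHModulo_iff_forall_fareyDisplacement_le m).2 (h m)⟩, fun m _ =>
    ⟨GRHModulo_iff_forall_fareyDisplacement_le m, fun k hk b hb => ⟨fun h ε hε => ?_,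
      GRHModulo_of_fareyDisplacement_le hk hb⟩⟩⟩
  obtain ⟨C, hC⟩ := exists_fareyDisplacement_le_of_GRHModulo h hε
  exact ⟨C, hC k hk b hb⟩
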